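/- Let $X_1, X_2, \dots$ be independent, identically distributed real-valued random variables, $S_k=\sum_{j=1}^k X_j$, and for $k \ge 1$ let $$\psi(k)=\sup_{0\le t\le 1}\left|\mathbb{P}(\{S_k\}\le t)-t\right|,$$ where $\{\cdot\}$ denotes fractional part. Let $\mathcal{F}$ be the real vector space of all $1$-periodic functions $f:\mathbb{R}\to\mathbb{R}$ which are of bounded variation on $[0,1]$ and satisfy $\int_0^1 f(x)\,\mathrm{d}x=0$. For $f,g\in\mathcal{F}$ let $$C(f,g)=\mathbb{E} f(U)g(U)+\sum_{k=1}^\infty \mathbb{E} f(U)g(U+S_k)+\sum_{k=1}^\infty \mathbb{E} g(U)f(U+S_k),$$ where $U$ is a random variable uniformly distributed on $[0,1)$ and independent of $X_1,X_2,\dots$. Theorem. Assume that $\psi(k)=O(k^{-(1+\delta)})$ as $k\to\infty$ for some $\delta>0$. Then for any $f,g\in\mathcal{F}$ both series in the definition of $C(f,g)$ are absolutely convergent, and $C$ is a symmetric, positive semidefinite bilinear form on $\mathcal{F}$; moreover, for $f \in \mathcal{F}$ we have $C(f,f)=0$ if and only if $f=0$ almost everywhere. For any $f\in\mathcal{F}$,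 with $\sigma=\sqrt{C(f,f)}$, the central limit theorem $$\frac{\sum_{k=1}^N f(S_k)}{\sqrt N}\overset{d}{\longrightarrow}\mathcal{N}(0,\sigma^2)\qquad (N\to\infty)$$ holds (where $\mathcal{N}(0,0)$ is the point mass at $0$), as does the law of the iterated logarithm $$\limsup_{N\to\infty}\frac{\sum_{k=1}^N f(S_k)}{\sqrt{2N\log\log N}}=\sigma\quad\text{almost surely}.$$ -/

import Mathlib

open MeasureTheory ProbabilityTheory Filter Asymptotics
open scoped Topology

namespace RandomWalkModOne

theorem boundedVariationOn_add {f g : ℝ → ℝ} {s : Set ℝ}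
    (hf : BoundedVariationOn f s) (hg : BoundedVariationOn g s) :
    BoundedVariationOn (f + g) s := by
  have h : eVariationOn (f + g) s ≤ eVariationOn f s + eVariationOn g s := by
    refine iSup_le fun p => ?_
    calc ∑ i ∈ Finset.range p.1, edist ((f + g) (p.2.1 (i + 1))) ((f + g) (p.2.1 i))
        ≤ ∑ i ∈ Finset.range p.1, (edist (f (p.2.1 (i + 1))) (f (p.2.1 i)) +
            edist (g (p.2.1 (i + 1))) (g (p.2.1 i))) :=
          Finset.sum_le_sum fun i _ => edist_add_add_le _ _ _ _
      _ = ∑ i ∈ Finset.range p.1, edist (f (p.2.1 (i + 1))) (f (p.2.1 i)) +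
            ∑ i ∈ Finset.range p.1, edist (g (p.2.1 (i + 1))) (g (p.2.1 i)) :=
          Finset.sum_add_distrib
      _ ≤ eVariationOn f s + eVariationOn g s := by
          gcongr
          · exact le_iSup (fun q : ℕ × { u : ℕ → ℝ // Monotone u ∧ ∀ i, u i ∈ s } =>
              ∑ i ∈ Finset.range q.1, edist (f (q.2.1 (i + 1))) (f (q.2.1 i))) p
          · exact le_iSup (fun q : ℕ × { u : ℕ → ℝ // Monotone u ∧ ∀ i, u i ∈ s } =>
              ∑ i ∈ Finset.range q.1, edist (g (q.2.1 (i + 1))) (g (q.2.1 i))) p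
  exact ne_top_of_le_ne_top (ENNReal.add_ne_top.2 ⟨hf, hg⟩) h

theorem boundedVariationOn_zero (s : Set ℝ) : BoundedVariationOn (0 : ℝ → ℝ) s := by
  simp [BoundedVariationOn, eVariationOn]

theorem boundedVariationOn_const_smul (c : ℝ) {f : ℝ → ℝ} {s : Set ℝ}
    (hf : BoundedVariationOn f s) : BoundedVariationOn (c • f) s :=
  (lipschitzWith_smul c).comp_boundedVariationOn hf

theorem intervalIntegrable_of_boundedVariationOn {f : ℝ → ℝ}
    (hf : BoundedVariationOn f (Set.Icc 0 1)) : IntervalIntegrable f volume 0 1 := by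
  obtain ⟨p, q, hp, hq, rfl⟩ :=
    hf.locallyBoundedVariationOn.exists_monotoneOn_sub_monotoneOn
  rw [← Set.uIcc_of_le (zero_le_one' ℝ)] at hp hq
  exact hp.intervalIntegrable.sub hq.intervalIntegrable

/-- The real vector space of all `1`-periodic functions `f : ℝ → ℝ` that are of bounded variation
on `[0,1]` and satisfy `∫₀¹ f = 0`. -/
def meanZeroBV : Submodule ℝ (ℝ → ℝ) where
  carrier := {f | Function.Periodic f 1 ∧ BoundedVariationOn f (Set.Icc 0 1) ∧
    ∫ x in (0 : ℝ)..1, f x = 0}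
  zero_mem' := ⟨fun _ => rfl, boundedVariationOn_zero _, by simp⟩
  add_mem' := by
    rintro f g ⟨hf1, hf2, hf3⟩ ⟨hg1, hg2, hg3⟩
    refine ⟨hf1.add hg1, boundedVariationOn_add hf2 hg2, ?_⟩
    have h := intervalIntegral.integral_add (intervalIntegrable_of_boundedVariationOn hf2)
      (intervalIntegrable_of_boundedVariationOn hg2)
    simpa [hf3, hg3] using h
  smul_mem' := by
    rintro c f ⟨hf1, hf2, hf3⟩
    refine ⟨hf1.smul c, boundedVariationOn_const_smul c hf2, ?_⟩
    simp [hf3]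

/-- The law of a random variable `U` uniformly distributed on `[0,1)`. -/
noncomputable def unif : Measure ℝ := volume.restrict (Set.Ico 0 1)

section

variable {Ω : Type*} [MeasurableSpace Ω]

/-- The partial sum `S_k = X_1 + ⋯ + X_k`, where the variables `X_1, X_2, …` are indexed in Lean as
`X 0, X 1, …`. -/
def partialSum (X : ℕ → Ω → ℝ) (k : ℕ) (ω : Ω) : ℝ := ∑ j ∈ Finset.range k, X j ω

/-- `ψ(k) = sup_{0 ≤ t ≤ 1} |P({S_k} ≤ t) - t|`. -/
noncomputable def psi (μ : Measure Ω) (X : ℕ → Ω → ℝ) (k : ℕ) : ℝ :=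
  ⨆ t : Set.Icc (0 : ℝ) 1, |μ.real {ω | Int.fract (partialSum X k ω) ≤ (t : ℝ)} - (t : ℝ)|

/-- `E f(U) g(U + S_k)`, where `U` is uniform on `[0,1)` and independent of `X_1, X_2, …`: on the
product space `ℝ × Ω` with the measure `unif.prod μ`, the variable `U` is the first coordinate. -/
noncomputable def crossCov (μ : Measure Ω) (X : ℕ → Ω → ℝ) (f g : ℝ → ℝ) (k : ℕ) : ℝ :=
  ∫ p : ℝ × Ω, f p.1 * g (p.1 + partialSum X k p.2) ∂(unif.prod μ)

/-- `C(f,g) = E f(U)g(U) + ∑_{k ≥ 1} E f(U)g(U + S_k) + ∑_{k ≥ 1} E g(U)f(U + S_k)`. -/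
noncomputable def C (μ : Measure Ω) (X : ℕ → Ω → ℝ) (f g : ℝ → ℝ) : ℝ :=
  ∫ u, f u * g u ∂unif + ∑' k : ℕ, crossCov μ X f g (k + 1) + ∑' k : ℕ, crossCov μ X g f (k + 1)

end

end RandomWalkModOne

/-! Everything depends only on the law of the increments, so the walk is realised on sequence space
and may be started at any point `x`. Let P be its transition operator and V the variation of f on
[0,1]. Koksma's inequality, applied to translates of f, gives |P^k f(x)| ≤ 4Vψ(k) for all x. Applied
to products of two translates, it shows that the correlations of f along the walk from x approach
those of a uniform start at the same rate. `IsMixing` records both facts with a summable, uniform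
rate, and the two limit theorems use nothing else.

Summability makes g₀ = ∑_{k≥1} P^k f a bounded function, and adding g₀(x + W_n) - g₀(x) to the orbit
sum, W_n being the displacement after n steps, yields a mean-zero martingale M_n at bounded distance
from it (Gordin's decomposition). Conditioning is replaced by splicing independent paths: M over n +
k steps is M over n steps plus an independent copy over k steps, started at the point reached. The
second moment of M_n is nσ² + o(n), uniformly in x. For the central limit theorem, time is cut into
blocks of a fixed length. From every start the characteristic function of a block is nearly
Gaussian, and the errors of successive blocks only add.

The upper half of the iterated logarithm law follows from a Gaussian bound on exponential moments,
an exponential maximal inequality and Borel–Cantelli along geometric times. For the lower half, the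
central limit theorem, uniform in x, bounds below the chance of gaining u√L in L steps. Demanding
this gain in about log j/(κu²) consecutive blocks has probability at least of order 1/j, so a second
Borel–Cantelli argument applies. Block lengths grow geometrically with a large ratio, so the past is
negligible.

For degeneracy put g = f + g₀. Then Pg = g₀ and C(f,f) = ‖g‖² - ‖Pg‖² in L² of the circle. The
energy lost per step is non-increasing along the walk, so a zero first loss keeps ‖P^n g‖ from
falling below ‖g‖, while P^n g → 0 uniformly. Hence g, g₀ and f vanish almost everywhere. -/

namespace RandomWalkModOne

set_option linter.unusedSectionVars false

/-! ### Path space, splicing of paths and transition operators -/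

section

/-- The position after `k` steps of the walk with increments `s`. -/
def walk (k : ℕ) (s : ℕ → ℝ) : ℝ := ∑ j ∈ Finset.range k, s j

/-- Follow the first path for `n` steps, and the second one from then on. -/
def splice (n : ℕ) (p : (ℕ → ℝ) × (ℕ → ℝ)) : ℕ → ℝ :=
  fun i => if i < n then p.1 i else p.2 (i - n)

/-- The sum of `f` over the first `n` positions, after the start, of the walk started at `x`. -/
def orbitSum (f : ℝ → ℝ) (n : ℕ) (x : ℝ) (s : ℕ → ℝ) : ℝ :=
  ∑ k ∈ Finset.range n, f (x + walk (k + 1) s)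

/-- The law of a sequence of independent variables with law `ν`. -/
noncomputable def pathMeasure (ν : Measure ℝ) : Measure (ℕ → ℝ) :=
  Measure.infinitePi fun _ => ν

/-- The `k`-step transition operator of the random walk. -/
noncomputable def walkOp (ν : Measure ℝ) (k : ℕ) (u : ℝ → ℝ) (x : ℝ) : ℝ :=
  ∫ s, u (x + walk k s) ∂pathMeasure ν

@[simp] theorem walk_zero (s : ℕ → ℝ) : walk 0 s = 0 := by simp [walk]

@[simp] theorem orbitSum_zero (f : ℝ → ℝ) (x : ℝ) (s : ℕ → ℝ) : orbitSum f 0 x s = 0 := by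
  simp [orbitSum]

@[fun_prop]
theorem measurable_walk (k : ℕ) : Measurable (walk k) := by
  unfold walk; fun_prop

@[fun_prop]
theorem measurable_splice (n : ℕ) : Measurable (splice n) := by
  refine measurable_pi_lambda _ fun i => ?_
  unfold splice
  split_ifs <;> fun_prop

theorem walk_splice_of_le {k n : ℕ} (h : k ≤ n) (p : (ℕ → ℝ) × (ℕ → ℝ)) :
    walk k (splice n p) = walk k p.1 := by
  refine Finset.sum_congr rfl fun j hj => ?_
  have : j < n := (Finset.mem_range.1 hj).trans_le h
  simp [splice, this]

theorem walk_splice_add (n k : ℕ) (p : (ℕ → ℝ) × (ℕ → ℝ)) :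
    walk (n + k) (splice n p) = walk n p.1 + walk k p.2 := by
  rw [walk, Finset.sum_range_add]
  congr 1
  · exact walk_splice_of_le le_rfl p
  · simp [splice, walk]

theorem orbitSum_splice_of_le (f : ℝ → ℝ) {k n : ℕ} (h : k ≤ n) (x : ℝ)
    (p : (ℕ → ℝ) × (ℕ → ℝ)) : orbitSum f k x (splice n p) = orbitSum f k x p.1 := by
  refine Finset.sum_congr rfl fun j hj => ?_
  rw [walk_splice_of_le ((Nat.succ_le_of_lt (Finset.mem_range.1 hj)).trans h)]

theorem orbitSum_splice_add (f : ℝ → ℝ) (n k : ℕ) (x : ℝ) (p : (ℕ → ℝ) × (ℕ → ℝ)) :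
    orbitSum f (n + k) x (splice n p) =
      orbitSum f n x p.1 + orbitSum f k (x + walk n p.1) p.2 := by
  rw [orbitSum, Finset.sum_range_add]
  congr 1
  · exact orbitSum_splice_of_le f le_rfl x p
  · refine Finset.sum_congr rfl fun j _ => ?_
    rw [add_assoc n, walk_splice_add, add_assoc]

theorem abs_orbitSum_le {f : ℝ → ℝ} {K : ℝ} (hK : ∀ x, |f x| ≤ K) (n : ℕ) (x : ℝ)
    (s : ℕ → ℝ) : |orbitSum f n x s| ≤ n * K := by
  refine (Finset.abs_sum_le_sum_abs _ _).trans ?_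
  refine (Finset.sum_le_sum fun k _ => hK _).trans ?_
  simp

@[fun_prop]
theorem measurable_orbitSum {f : ℝ → ℝ} (hf : Measurable f) (n : ℕ) :
    Measurable fun p : ℝ × (ℕ → ℝ) => orbitSum f n p.1 p.2 := by
  unfold orbitSum
  fun_prop

theorem orbitSum_succ (f : ℝ → ℝ) (n : ℕ) (x : ℝ) (s : ℕ → ℝ) :
    orbitSum f (n + 1) x s = orbitSum f n x s + f (x + walk (n + 1) s) :=
  Finset.sum_range_succ _ _

/-- The sum over positions `m + 1, …, n`. -/
theorem abs_orbitSum_sub_le {f : ℝ → ℝ} {K : ℝ} (hK : ∀ x, |f x| ≤ K) {m n : ℕ} (h : m ≤ n)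
    (x : ℝ) (s : ℕ → ℝ) : |orbitSum f n x s - orbitSum f m x s| ≤ (n - m) * K := by
  induction n, h using Nat.le_induction with
  | base => simp
  | succ n hn ih =>
    rw [orbitSum_succ]
    push_cast
    have := abs_add_le (orbitSum f n x s - orbitSum f m x s) (f (x + walk (n + 1) s))
    have := hK (x + walk (n + 1) s)
    calc _ = |orbitSum f n x s - orbitSum f m x s + f (x + walk (n + 1) s)| := by congr 1; ring
      _ ≤ _ := by linarith

variable (ν : Measure ℝ) [IsProbabilityMeasure ν]

instance : IsProbabilityMeasure (pathMeasure ν) := by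
  unfold pathMeasure; infer_instance

/-- This is the Markov property in the form used throughout: integrating over a path may be replaced
by integrating over its first `n` steps and then over an independent continuation. A cylinder set
pulls back to a product, because its constraints below and above `n` fall on different paths. -/
theorem measurePreserving_splice (n : ℕ) :
    MeasurePreserving (splice n) ((pathMeasure ν).prod (pathMeasure ν)) (pathMeasure ν) := by
  refine ⟨measurable_splice n, ?_⟩
  refine Measure.eq_infinitePi _ fun s t ht => ?_
  have hmeas : MeasurableSet (Set.pi (s : Set ℕ) t) :=
    MeasurableSet.pi s.countable_toSet fun i _ => ht i
  rw [Measure.map_apply (measurable_splice n) hmeas]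
  have hpre : splice n ⁻¹' Set.pi (s : Set ℕ) t =
      (Set.pi ((s.filter (· < n) : Finset ℕ) : Set ℕ) t) ×ˢ
      (Set.pi (((s.filter fun i => ¬ i < n).image (· - n) : Finset ℕ) : Set ℕ)
        fun i => t (i + n)) := by
    ext p
    simp only [Set.mem_preimage, Set.mem_pi, Finset.mem_coe, Set.mem_prod, Finset.mem_filter,
      Finset.mem_image, splice]
    constructor
    · intro h
      refine ⟨fun i hi => by simpa [hi.2] using h i hi.1, ?_⟩
      rintro _ ⟨i, hi, rfl⟩
      have := h i hi.1
      rw [if_neg hi.2] at this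
      rwa [Nat.sub_add_cancel (not_lt.1 hi.2)]
    · rintro ⟨h1, h2⟩ i hi
      split_ifs with hin
      · exact h1 i ⟨hi, hin⟩
      · have := h2 (i - n) ⟨i, ⟨hi, hin⟩, rfl⟩
        rwa [Nat.sub_add_cancel (not_lt.1 hin)] at this
  rw [hpre, Measure.prod_prod, pathMeasure, Measure.infinitePi_pi _ fun i _ => ht i,
    Measure.infinitePi_pi _ fun i _ => ht _, ← Finset.prod_filter_mul_prod_filter_not s (· < n)]
  congr 1
  rw [Finset.prod_image]
  · refine Finset.prod_congr rfl fun i hi => ?_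
    rw [Nat.sub_add_cancel (not_lt.1 (Finset.mem_filter.1 hi).2)]
  · intro i hi j hj hij
    have h1 := (Finset.mem_filter.1 (Finset.mem_coe.1 hi)).2
    have h2 := (Finset.mem_filter.1 (Finset.mem_coe.1 hj)).2
    dsimp at hij
    omega

theorem integral_splice {E : Type*} [NormedAddCommGroup E] [NormedSpace ℝ E] (n : ℕ)
    {G : (ℕ → ℝ) → E} (hG : Integrable G (pathMeasure ν)) :
    ∫ s, G s ∂pathMeasure ν =
      ∫ s, ∫ s', G (splice n (s, s')) ∂pathMeasure ν ∂pathMeasure ν := by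
  have hp := measurePreserving_splice ν n
  have hG' : AEStronglyMeasurable G
      (Measure.map (splice n) ((pathMeasure ν).prod (pathMeasure ν))) := by
    rw [hp.map_eq]; exact hG.1
  have h := integral_map hp.measurable.aemeasurable hG'
  rw [hp.map_eq] at h
  rw [h, integral_prod]
  exact hp.integrable_comp_of_integrable hG

theorem lintegral_splice (n : ℕ) {G : (ℕ → ℝ) → ENNReal} (hG : Measurable G) :
    ∫⁻ s, G s ∂pathMeasure ν =
      ∫⁻ s, ∫⁻ s', G (splice n (s, s')) ∂pathMeasure ν ∂pathMeasure ν := by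
  have hp := measurePreserving_splice ν n
  have h := lintegral_map (μ := (pathMeasure ν).prod (pathMeasure ν)) hG hp.measurable
  rw [hp.map_eq] at h
  rw [h, lintegral_prod]
  exact (hG.comp hp.measurable).aemeasurable

variable {ν}

theorem integrable_walk {u : ℝ → ℝ} (hu : Measurable u) {K : ℝ} (hK : ∀ x, |u x| ≤ K) (k : ℕ)
    (x : ℝ) : Integrable (fun s => u (x + walk k s)) (pathMeasure ν) := by
  refine Integrable.of_bound (C := K) ?_ (ae_of_all _ fun s => hK _)
  exact Measurable.aestronglyMeasurable (by fun_prop)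

@[fun_prop]
theorem measurable_walkOp {u : ℝ → ℝ} (hu : Measurable u) (k : ℕ) :
    Measurable (walkOp ν k u) := by
  unfold walkOp
  refine StronglyMeasurable.measurable ?_
  refine StronglyMeasurable.integral_prod_right' (f := fun p : ℝ × (ℕ → ℝ) => u (p.1 + walk k p.2)) ?_
  exact Measurable.stronglyMeasurable (by fun_prop)

theorem abs_walkOp_le {u : ℝ → ℝ} {K : ℝ} (hK : ∀ x, |u x| ≤ K) (k : ℕ) (x : ℝ) :
    |walkOp ν k u x| ≤ K := by
  have := norm_integral_le_of_norm_le_const (μ := pathMeasure ν)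
    (f := fun s => u (x + walk k s)) (C := K) (ae_of_all _ fun s => hK _)
  simpa [walkOp] using this

@[simp] theorem walkOp_zero (u : ℝ → ℝ) (x : ℝ) : walkOp ν 0 u x = u x := by
  simp [walkOp]

theorem walkOp_add {u : ℝ → ℝ} (hu : Measurable u) {K : ℝ} (hK : ∀ x, |u x| ≤ K) (i j : ℕ)
    (x : ℝ) : walkOp ν (i + j) u x = walkOp ν i (walkOp ν j u) x := by
  rw [walkOp, integral_splice ν i (integrable_walk hu hK _ _)]
  simp only [walk_splice_add, walkOp, add_assoc]

theorem integral_mul_walk {u v : ℝ → ℝ} (hu : Measurable u) {K : ℝ} (hK : ∀ x, |u x| ≤ K)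
    (hv : Measurable v) {K' : ℝ} (hK' : ∀ x, |v x| ≤ K') (i j : ℕ) (x : ℝ) :
    ∫ s, u (x + walk i s) * v (x + walk (i + j) s) ∂pathMeasure ν =
      walkOp ν i (fun y => u y * walkOp ν j v y) x := by
  rw [integral_splice ν i]
  · simp only [walk_splice_add, walkOp, ← integral_const_mul, add_assoc,
      walk_splice_of_le (le_refl i)]
  · refine Integrable.of_bound (C := K * K') (Measurable.aestronglyMeasurable (by fun_prop))
      (ae_of_all _ fun s => ?_)
    rw [Real.norm_eq_abs, abs_mul]
    exact mul_le_mul (hK _) (hK' _) (abs_nonneg _) ((abs_nonneg _).trans (hK 0))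

end

/-! ### The mixing hypothesis, martingale approximation and variance growth -/

section

/-- Summable decay, uniformly in the starting point, of the transition operators of the random walk
on `f`, and convergence of the correlations of `f` along the walk to `m`. -/
structure IsMixing (ν : Measure ℝ) (f : ℝ → ℝ) (K : ℝ) (a m : ℕ → ℝ) : Prop where
  measurable : Measurable f
  bound : ∀ x, |f x| ≤ K
  summable : Summable a
  decay : ∀ k x, |walkOp ν k f x| ≤ a k
  corr : ∀ i d x, |walkOp ν i (fun y => f y * walkOp ν d f y) x - m d| ≤ a i

/-- The asymptotic variance with autocovariances `m`. -/
noncomputable def asympVar (m : ℕ → ℝ) : ℝ := m 0 + 2 * ∑' d, m (d + 1)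

/-- The solution `u` of `u - P u = P f`, with `P` the one-step transition operator. -/
noncomputable def potential (ν : Measure ℝ) (f : ℝ → ℝ) (x : ℝ) : ℝ :=
  ∑' k, walkOp ν (k + 1) f x

/-- The martingale part of `orbitSum`. -/
noncomputable def martPart (ν : Measure ℝ) (f : ℝ → ℝ) (n : ℕ) (x : ℝ) (s : ℕ → ℝ) : ℝ :=
  orbitSum f n x s - potential ν f x + potential ν f (x + walk n s)

namespace IsMixing

variable {ν : Measure ℝ} [IsProbabilityMeasure ν] {f : ℝ → ℝ} {K : ℝ} {a m : ℕ → ℝ}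

theorem K_nonneg (h : IsMixing ν f K a m) : 0 ≤ K := (abs_nonneg _).trans (h.bound 0)

theorem a_nonneg (h : IsMixing ν f K a m) (k : ℕ) : 0 ≤ a k := (abs_nonneg _).trans (h.decay k 0)

theorem summable_succ (h : IsMixing ν f K a m) : Summable fun k => a (k + 1) :=
  (summable_nat_add_iff 1).2 h.summable

theorem abs_mul_walkOp_le (h : IsMixing ν f K a m) (d : ℕ) (y : ℝ) :
    |f y * walkOp ν d f y| ≤ K * a d := by
  rw [abs_mul]
  exact mul_le_mul (h.bound y) (h.decay d y) (abs_nonneg _) h.K_nonneg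

/-- By `corr`, `m d` is the limit of averages of f · P^d f, a function bounded by `K * a d`. This
makes the autocovariances summable. -/
theorem abs_mean_le (h : IsMixing ν f K a m) (d : ℕ) : |m d| ≤ K * a d := by
  have hlim : Tendsto (fun i => K * a d + a i) atTop (𝓝 (K * a d + 0)) :=
    h.summable.tendsto_atTop_zero.const_add _
  rw [add_zero] at hlim
  refine ge_of_tendsto' hlim fun i => ?_
  have h1 := abs_walkOp_le (ν := ν) (h.abs_mul_walkOp_le d) i 0
  have h2 := h.corr i d 0
  have h3 := abs_sub_abs_le_abs_sub (m d) (walkOp ν i (fun y => f y * walkOp ν d f y) 0)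
  rw [abs_sub_comm] at h2
  linarith

theorem summable_mean (h : IsMixing ν f K a m) : Summable fun d => m (d + 1) :=
  .of_norm_bounded (h.summable_succ.mul_left K) fun d => h.abs_mean_le (d + 1)

theorem summable_walkOp (h : IsMixing ν f K a m) (x : ℝ) :
    Summable fun k => walkOp ν (k + 1) f x :=
  .of_norm_bounded h.summable_succ fun k => h.decay (k + 1) x

theorem abs_potential_le (h : IsMixing ν f K a m) (x : ℝ) :
    |potential ν f x| ≤ ∑' k, a (k + 1) :=
  tsum_of_norm_bounded (f := fun k => walkOp ν (k + 1) f x) h.summable_succ.hasSum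
    fun k => h.decay (k + 1) x

theorem potBound_nonneg (h : IsMixing ν f K a m) : 0 ≤ ∑' k, a (k + 1) :=
  tsum_nonneg fun _ => h.a_nonneg _

theorem measurable_potential (h : IsMixing ν f K a m) : Measurable (potential ν f) := by
  have hf := h.measurable
  refine measurable_of_tendsto_metrizable
    (f := fun n x => ∑ k ∈ Finset.range n, walkOp ν (k + 1) f x) (fun _ => by fun_prop) ?_
  exact tendsto_pi_nhds.2 fun x => (h.summable_walkOp x).hasSum.tendsto_sum_nat

theorem measurable_martPart (h : IsMixing ν f K a m) (n : ℕ) :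
    Measurable fun p : ℝ × (ℕ → ℝ) => martPart ν f n p.1 p.2 := by
  have := h.measurable_potential
  have := h.measurable
  unfold martPart
  fun_prop

theorem abs_martPart_sub_le (h : IsMixing ν f K a m) (n : ℕ) (x : ℝ) (s : ℕ → ℝ) :
    |martPart ν f n x s - orbitSum f n x s| ≤ 2 * ∑' k, a (k + 1) := by
  have h1 := h.abs_potential_le x
  have h2 := h.abs_potential_le (x + walk n s)
  have h3 := abs_sub (potential ν f (x + walk n s)) (potential ν f x)
  calc _ = |potential ν f (x + walk n s) - potential ν f x| := by
        rw [martPart]; congr 1; ring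
    _ ≤ _ := by linarith

theorem abs_martPart_le (h : IsMixing ν f K a m) (n : ℕ) (x : ℝ) (s : ℕ → ℝ) :
    |martPart ν f n x s| ≤ n * K + 2 * ∑' k, a (k + 1) := by
  have h1 := h.abs_martPart_sub_le n x s
  have h2 := abs_orbitSum_le h.bound n x s
  have h3 := abs_add_le (martPart ν f n x s - orbitSum f n x s) (orbitSum f n x s)
  rw [sub_add_cancel] at h3
  linarith

/-- The potential at the intermediate point cancels. This exact additivity is what allows arguments
by blocks. -/
theorem martPart_splice_add (n k : ℕ) (x : ℝ) (p : (ℕ → ℝ) × (ℕ → ℝ)) :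
    martPart ν f (n + k) x (splice n p) =
      martPart ν f n x p.1 + martPart ν f k (x + walk n p.1) p.2 := by
  simp only [martPart, orbitSum_splice_add, walk_splice_add, ← add_assoc]
  ring

theorem martPart_zero (x : ℝ) (s : ℕ → ℝ) : martPart ν f 0 x s = 0 := by
  simp [martPart]

/-- The operator passes through the absolutely convergent series and the semigroup law shifts every
index by `n`, leaving a tail of the potential. -/
theorem walkOp_potential (h : IsMixing ν f K a m) (n : ℕ) (x : ℝ) :
    walkOp ν n (potential ν f) x = ∑' k, walkOp ν (n + k + 1) f x := by
  have hf := h.measurable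
  have hint : ∀ k, Integrable (fun s => walkOp ν (k + 1) f (x + walk n s)) (pathMeasure ν) :=
    fun k => integrable_walk (by fun_prop) (h.decay (k + 1)) n x
  have := hasSum_integral_of_summable_integral_norm hint ?_
  · rw [walkOp]
    simp only [potential]
    rw [← this.tsum_eq]
    refine tsum_congr fun k => ?_
    rw [add_assoc, walkOp_add hf h.bound]
    rfl
  · refine .of_nonneg_of_le (fun k => integral_nonneg fun s => norm_nonneg _) (fun k => ?_)
      h.summable_succ
    have := norm_integral_le_of_norm_le_const (μ := pathMeasure ν)
      (f := fun s => ‖walkOp ν (k + 1) f (x + walk n s)‖) (C := a (k + 1))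
      (ae_of_all _ fun s => by simpa using h.decay (k + 1) _)
    simpa using (le_abs_self _).trans this

theorem integral_orbitSum (h : IsMixing ν f K a m) (n : ℕ) (x : ℝ) :
    ∫ s, orbitSum f n x s ∂pathMeasure ν = ∑ k ∈ Finset.range n, walkOp ν (k + 1) f x :=
  integral_finsetSum _ fun _ _ => integrable_walk h.measurable h.bound _ _

theorem integrable_orbitSum (h : IsMixing ν f K a m) (n : ℕ) (x : ℝ) :
    Integrable (orbitSum f n x) (pathMeasure ν) := by
  have := measurable_orbitSum h.measurable n
  exact .of_bound (C := n * K) (Measurable.aestronglyMeasurable (by fun_prop))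
    (ae_of_all _ fun s => abs_orbitSum_le h.bound n x s)

/-- The mean of the orbit sum is the first `n` terms of the potential at `x`, and the mean of the
potential at the endpoint is the remaining tail. Together they cancel the subtracted potential. -/
theorem integral_martPart (h : IsMixing ν f K a m) (n : ℕ) (x : ℝ) :
    ∫ s, martPart ν f n x s ∂pathMeasure ν = 0 := by
  have h1 := integrable_walk (ν := ν) h.measurable_potential h.abs_potential_le n x
  simp only [martPart]
  have h0 : Integrable (fun s => orbitSum f n x s - potential ν f x) (pathMeasure ν) :=
    (h.integrable_orbitSum n x).sub (integrable_const _)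
  rw [integral_add h0 h1,
    integral_sub (h.integrable_orbitSum n x) (integrable_const _), h.integral_orbitSum]
  have h2 := h.walkOp_potential n x
  rw [walkOp] at h2
  rw [h2]
  have h3 := (h.summable_walkOp x).sum_add_tsum_nat_add n
  simp only [integral_const, probReal_univ, one_smul, potential]
  rw [← h3]
  have : ∀ k, n + k = k + n := fun k => add_comm _ _
  simp only [this]
  ring

theorem integrable_martPart (h : IsMixing ν f K a m) (n : ℕ) (x : ℝ) :
    Integrable (martPart ν f n x) (pathMeasure ν) := by
  have := h.measurable_martPart n
  exact .of_bound (C := n * K + 2 * ∑' k, a (k + 1)) (Measurable.aestronglyMeasurable (by fun_prop))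
    (ae_of_all _ fun s => h.abs_martPart_le n x s)

/-! ### Second moments -/

/-- The increment of the second moment of `orbitSum`. -/
theorem integral_orbitSum_sq_succ (h : IsMixing ν f K a m) (n : ℕ) (x : ℝ) :
    ∫ s, orbitSum f (n + 1) x s ^ 2 ∂pathMeasure ν = ∫ s, orbitSum f n x s ^ 2 ∂pathMeasure ν +
      (walkOp ν (n + 1) (fun y => f y * walkOp ν 0 f y) x + 2 * ∑ d ∈ Finset.range n,
        walkOp ν (n - d) (fun y => f y * walkOp ν (d + 1) f y) x) := by
  have hf := h.measurable
  have hT := measurable_orbitSum hf n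
  -- The cross terms with the new position are indexed by the lag `d + 1`, which pairs position `n -
  -- d` with position `n + 1`. The index `n + 1 + 0` puts the diagonal term into the same form with
  -- lag zero.
  have hexp : ∀ s, orbitSum f (n + 1) x s ^ 2 = orbitSum f n x s ^ 2 +
      (f (x + walk (n + 1) s) * f (x + walk (n + 1 + 0) s) + 2 * ∑ d ∈ Finset.range n,
        f (x + walk (n - d) s) * f (x + walk (n - d + (d + 1)) s)) := by
    intro s
    have : ∑ d ∈ Finset.range n, f (x + walk (n - d) s) * f (x + walk (n - d + (d + 1)) s) =
        orbitSum f n x s * f (x + walk (n + 1) s) := by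
      rw [orbitSum, ← Finset.sum_range_reflect (fun k => f (x + walk (k + 1) s)), Finset.sum_mul]
      refine Finset.sum_congr rfl fun d hd => ?_
      have hd := Finset.mem_range.1 hd
      rw [show n - 1 - d + 1 = n - d by omega, show n - d + (d + 1) = n + 1 by omega]
    rw [this, orbitSum_succ]
    simp only [add_zero]
    ring
  have hmul : ∀ i j, Integrable (fun s => f (x + walk i s) * f (x + walk j s)) (pathMeasure ν) := by
    intro i j
    refine Integrable.of_bound (C := K * K) (Measurable.aestronglyMeasurable (by fun_prop))
      (ae_of_all _ fun s => ?_)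
    rw [Real.norm_eq_abs, abs_mul]
    exact mul_le_mul (h.bound _) (h.bound _) (abs_nonneg _) h.K_nonneg
  have hsq : Integrable (fun s => orbitSum f n x s ^ 2) (pathMeasure ν) := by
    refine Integrable.of_bound (C := (n * K) ^ 2) (Measurable.aestronglyMeasurable (by fun_prop))
      (ae_of_all _ fun s => ?_)
    rw [Real.norm_eq_abs, abs_pow]
    exact pow_le_pow_left₀ (abs_nonneg _) (abs_orbitSum_le h.bound n x s) 2
  simp only [hexp]
  have hs : Integrable (fun s => ∑ d ∈ Finset.range n,
      f (x + walk (n - d) s) * f (x + walk (n - d + (d + 1)) s)) (pathMeasure ν) :=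
    integrable_finsetSum _ fun d _ => hmul _ _
  have hs' : Integrable (fun s => f (x + walk (n + 1) s) * f (x + walk (n + 1 + 0) s) +
      2 * ∑ d ∈ Finset.range n, f (x + walk (n - d) s) * f (x + walk (n - d + (d + 1)) s))
      (pathMeasure ν) := (hmul _ _).add (hs.const_mul 2)
  rw [integral_add hsq hs', integral_add (hmul _ _) (hs.const_mul 2),
    integral_const_mul, integral_finsetSum _ fun d _ => hmul _ _]
  simp only [integral_mul_walk hf h.bound hf h.bound]

/-- Dominated convergence: each term tends to zero with `n` for fixed `d`, and the second argument
of `min` is a summable majorant. The sequence bounds the error of the variance increments, with no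
reference to the starting point. -/
theorem tendsto_sum_min (h : IsMixing ν f K a m) :
    Tendsto (fun n => a (n + 1) + 2 * ∑' d, min (if d < n then a (n - d) else K * a (d + 1))
      (2 * K * a (d + 1))) atTop (𝓝 0) := by
  have ha := h.summable.tendsto_atTop_zero
  have hK := h.K_nonneg
  have h1 : Tendsto (fun n => ∑' d, min (if d < n then a (n - d) else K * a (d + 1))
      (2 * K * a (d + 1))) atTop (𝓝 (∑' d : ℕ, (0 : ℝ))) := by
    refine tendsto_tsum_of_dominated_convergence (h.summable_succ.mul_left (2 * K)) (fun d => ?_)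
      (Eventually.of_forall fun n d => ?_)
    · have h2 : Tendsto (fun n => a (n - d)) atTop (𝓝 0) :=
        ha.comp (tendsto_sub_atTop_nat d)
      refine squeeze_zero' (Eventually.of_forall fun n => ?_) ?_ h2
      · have := h.a_nonneg (n - d)
        have := h.a_nonneg (d + 1)
        refine le_min ?_ (by positivity)
        split_ifs <;> positivity
      · filter_upwards [eventually_gt_atTop d] with n hn
        rw [if_pos hn]
        exact min_le_left _ _
    · have := h.a_nonneg (n - d)
      have := h.a_nonneg (d + 1)
      rw [Real.norm_of_nonneg]
      · exact min_le_right _ _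
      · refine le_min ?_ (by positivity)
        split_ifs <;> positivity
  have h2 : Tendsto (fun n => a (n + 1)) atTop (𝓝 0) := ha.comp (tendsto_add_atTop_nat 1)
  simpa using h2.add (h1.const_mul 2)

/-- A lag `d + 1` with `d < n` has two bounds: `corr` gives `a (n - d)`, good for short lags, and
the crude size of both terms gives `2 * K * a (d + 1)`, good for long ones. For `d ≥ n` the
correlation is absent and only `m (d + 1)` is lost. -/
theorem abs_increment_sub_le (h : IsMixing ν f K a m) (n : ℕ) (x : ℝ) :
    |walkOp ν (n + 1) (fun y => f y * walkOp ν 0 f y) x + 2 * ∑ d ∈ Finset.range n,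
        walkOp ν (n - d) (fun y => f y * walkOp ν (d + 1) f y) x - asympVar m| ≤
      a (n + 1) + 2 * ∑' d, min (if d < n then a (n - d) else K * a (d + 1))
        (2 * K * a (d + 1)) := by
  have hK := h.K_nonneg
  set e : ℕ → ℝ := fun d => min (if d < n then a (n - d) else K * a (d + 1)) (2 * K * a (d + 1))
  set c : ℕ → ℝ := fun d => if d < n then
    walkOp ν (n - d) (fun y => f y * walkOp ν (d + 1) f y) x else 0 with hc
  have hsum : ∑ d ∈ Finset.range n, walkOp ν (n - d) (fun y => f y * walkOp ν (d + 1) f y) x =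
      ∑' d, c d := by
    rw [tsum_eq_sum (s := Finset.range n) fun d hd => if_neg (by simpa using hd)]
    exact Finset.sum_congr rfl fun d hd => (if_pos (Finset.mem_range.1 hd)).symm
  have hcs : Summable c := summable_of_ne_finset_zero (s := Finset.range n)
    fun d hd => if_neg (by simpa using hd)
  have he : ∀ d, |c d - m (d + 1)| ≤ e d := by
    intro d
    have h1 := h.abs_mean_le (d + 1)
    have h2 := h.a_nonneg (d + 1)
    have h3 := mul_nonneg hK h2
    by_cases hd : d < n
    · simp only [hc, e, if_pos hd]
      refine le_min (h.corr _ _ _) ?_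
      have h4 := abs_walkOp_le (ν := ν) (h.abs_mul_walkOp_le (d + 1)) (n - d) x
      have h5 := abs_sub (walkOp ν (n - d) (fun y => f y * walkOp ν (d + 1) f y) x) (m (d + 1))
      linarith
    · simp only [hc, e, if_neg hd, zero_sub, abs_neg]
      exact le_min h1 (by linarith)
  have hes : Summable e := by
    refine .of_nonneg_of_le (fun d => (abs_nonneg _).trans (he d)) (fun d => min_le_right _ _)
      (h.summable_succ.mul_left (2 * K))
  have h1 : |∑' d, c d - ∑' d, m (d + 1)| ≤ ∑' d, e d := by
    rw [← hcs.tsum_sub h.summable_mean]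
    exact tsum_of_norm_bounded (f := fun d => c d - m (d + 1)) hes.hasSum he
  have h2 := h.corr (n + 1) 0 x
  rw [hsum, asympVar]
  have h3 := abs_add_le (walkOp ν (n + 1) (fun y => f y * walkOp ν 0 f y) x - m 0)
    (2 * (∑' d, c d - ∑' d, m (d + 1)))
  rw [abs_mul, abs_two] at h3
  calc _ = |walkOp ν (n + 1) (fun y => f y * walkOp ν 0 f y) x - m 0 +
        2 * (∑' d, c d - ∑' d, m (d + 1))| := by congr 1; ring
    _ ≤ _ := by linarith

/-- The second moment is the sum of its increments, and the Cesàro means of their errors tend to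
zero. -/
theorem exists_abs_integral_orbitSum_sq_sub_le (h : IsMixing ν f K a m) {ε : ℝ} (hε : 0 < ε) :
    ∃ n₀ : ℕ, ∀ n ≥ n₀, ∀ x,
      |∫ s, orbitSum f n x s ^ 2 ∂pathMeasure ν - n * asympVar m| ≤ ε * n := by
  set r : ℕ → ℝ := fun n => a (n + 1) + 2 * ∑' d, min (if d < n then a (n - d) else K * a (d + 1))
      (2 * K * a (d + 1)) with hr
  have hle : ∀ n x, |∫ s, orbitSum f n x s ^ 2 ∂pathMeasure ν - n * asympVar m| ≤
      ∑ i ∈ Finset.range n, r i := by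
    intro n x
    induction n with
    | zero => simp
    | succ n ih =>
      rw [h.integral_orbitSum_sq_succ, Finset.sum_range_succ]
      have h1 := h.abs_increment_sub_le n x
      refine le_trans ?_ (add_le_add ih h1)
      refine le_trans (le_of_eq ?_) (abs_add_le _ _)
      congr 1
      push_cast
      ring
  have hces := h.tendsto_sum_min.cesaro
  have hev : ∀ᶠ n : ℕ in atTop, (n : ℝ)⁻¹ * ∑ i ∈ Finset.range n, r i < ε :=
    hces.eventually (gt_mem_nhds hε)
  obtain ⟨n₀, hn₀⟩ := eventually_atTop.1 (hev.and (eventually_gt_atTop 0))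
  refine ⟨n₀, fun n hn x => (hle n x).trans ?_⟩
  obtain ⟨h1, h2⟩ := hn₀ n hn
  have h2 : (0 : ℝ) < n := by exact_mod_cast h2
  rw [inv_mul_lt_iff₀ h2] at h1
  linarith

theorem asympVar_nonneg (h : IsMixing ν f K a m) : 0 ≤ asympVar m := by
  refine le_of_forall_pos_le_add fun ε hε => ?_
  obtain ⟨n₀, hn⟩ := h.exists_abs_integral_orbitSum_sq_sub_le hε
  have h1 := (abs_le.1 (hn (n₀ + 1) (by omega) 0)).2
  have h2 : 0 ≤ ∫ s, orbitSum f (n₀ + 1) 0 s ^ 2 ∂pathMeasure ν :=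
    integral_nonneg fun s => sq_nonneg _
  have h3 : (0 : ℝ) < ((n₀ + 1 : ℕ) : ℝ) := by positivity
  by_contra! hcon
  nlinarith

theorem integrable_orbitSum_sq (h : IsMixing ν f K a m) (n : ℕ) (x : ℝ) :
    Integrable (fun s => orbitSum f n x s ^ 2) (pathMeasure ν) := by
  have hT := measurable_orbitSum h.measurable n
  refine Integrable.of_bound (C := (n * K) ^ 2) (Measurable.aestronglyMeasurable (by fun_prop))
    (ae_of_all _ fun s => ?_)
  rw [Real.norm_eq_abs, abs_pow]
  exact pow_le_pow_left₀ (abs_nonneg _) (abs_orbitSum_le h.bound n x s) 2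

theorem integrable_martPart_sq (h : IsMixing ν f K a m) (n : ℕ) (x : ℝ) :
    Integrable (fun s => martPart ν f n x s ^ 2) (pathMeasure ν) := by
  have hT := h.measurable_martPart n
  refine Integrable.of_bound (C := (n * K + 2 * ∑' k, a (k + 1)) ^ 2)
    (Measurable.aestronglyMeasurable (by fun_prop)) (ae_of_all _ fun s => ?_)
  rw [Real.norm_eq_abs, abs_pow]
  exact pow_le_pow_left₀ (abs_nonneg _) (h.abs_martPart_le n x s) 2

/-- The second moment of the martingale part grows linearly, uniformly in the starting point. -/
theorem exists_abs_integral_martPart_sq_sub_le (h : IsMixing ν f K a m) {ε : ℝ} (hε : 0 < ε) :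
    ∃ n₀ : ℕ, ∀ n ≥ n₀, ∀ x,
      |∫ s, martPart ν f n x s ^ 2 ∂pathMeasure ν - n * asympVar m| ≤ ε * n := by
  set σ := asympVar m with hσ
  set B := 2 * ∑' k, a (k + 1) with hB
  have hσ0 : 0 ≤ σ := h.asympVar_nonneg
  -- Three errors are each held below `ε / 4 * n`. This weight handles `η` times the second moment
  -- of the orbit sum, which is at most `(σ + 1) * n`; `δ` handles the variance of the orbit sum,
  -- and `n₁` the constant coming from the coboundary.
  set η := min (1 : ℝ) (ε / 4 / (σ + 1)) with hη
  have hη0 : 0 < η := by positivity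
  have hη1 : η ≤ 1 := min_le_left _ _
  have hησ : η * (σ + 1) ≤ ε / 4 := by
    have : η ≤ ε / 4 / (σ + 1) := min_le_right _ _
    rwa [le_div_iff₀ (by positivity)] at this
  set δ := min (1 : ℝ) (ε / 4) with hδ
  have hδ0 : 0 < δ := by positivity
  obtain ⟨n₀, hn₀⟩ := h.exists_abs_integral_orbitSum_sq_sub_le hδ0
  obtain ⟨n₁, hn₁⟩ := exists_nat_ge (4 / ε * ((1 + η⁻¹) * B ^ 2))
  refine ⟨max n₀ n₁, fun n hn x => ?_⟩
  have h1 := hn₀ n (le_of_max_le_left hn) x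
  have hn0 : (0 : ℝ) ≤ n := by positivity
  have hnB : (1 + η⁻¹) * B ^ 2 ≤ ε / 4 * n := by
    have : (n₁ : ℝ) ≤ n := by exact_mod_cast le_of_max_le_right hn
    have := hn₁.trans this
    rw [div_mul_eq_mul_div, div_le_iff₀ hε] at this
    linarith
  have hpt : ∀ s, |martPart ν f n x s ^ 2 - orbitSum f n x s ^ 2| ≤
      η * orbitSum f n x s ^ 2 + (1 + η⁻¹) * B ^ 2 := by
    intro s
    have h2 := h.abs_martPart_sub_le n x s
    rw [← hB] at h2
    set T := orbitSum f n x s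
    obtain ⟨D, hD⟩ : ∃ D, D = martPart ν f n x s - T := ⟨_, rfl⟩
    rw [← hD] at h2
    have hM : martPart ν f n x s = T + D := by rw [hD]; ring
    have hDB : D ^ 2 ≤ B ^ 2 := sq_le_sq' (by linarith [(abs_le.1 h2).1]) (abs_le.1 h2).2
    -- Young's inequality with weight `η`: the cross term of the unbounded `T` with the bounded `D`
    -- costs a small fraction of `T ^ 2` and a constant.
    have hx : |2 * T * D| ≤ η * T ^ 2 + η⁻¹ * D ^ 2 := by
      have e1 : 0 ≤ η⁻¹ * (η * T - D) ^ 2 := by positivity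
      have e2 : 0 ≤ η⁻¹ * (η * T + D) ^ 2 := by positivity
      have e3 : η⁻¹ * (η * T - D) ^ 2 = η * T ^ 2 - 2 * T * D + η⁻¹ * D ^ 2 := by
        field_simp
        ring
      have e4 : η⁻¹ * (η * T + D) ^ 2 = η * T ^ 2 + 2 * T * D + η⁻¹ * D ^ 2 := by
        field_simp
        ring
      rw [abs_le]
      constructor <;> linarith
    have hηB : η⁻¹ * D ^ 2 ≤ η⁻¹ * B ^ 2 := by gcongr
    calc |martPart ν f n x s ^ 2 - T ^ 2| = |2 * T * D + D ^ 2| := by rw [hM]; congr 1; ring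
      _ ≤ |2 * T * D| + |D ^ 2| := abs_add_le _ _
      _ ≤ _ := by rw [abs_of_nonneg (sq_nonneg D)]; linarith
  have hint : |∫ s, martPart ν f n x s ^ 2 ∂pathMeasure ν -
      ∫ s, orbitSum f n x s ^ 2 ∂pathMeasure ν| ≤
      η * ∫ s, orbitSum f n x s ^ 2 ∂pathMeasure ν + (1 + η⁻¹) * B ^ 2 := by
    rw [← integral_sub (h.integrable_martPart_sq n x) (h.integrable_orbitSum_sq n x)]
    have h3 := norm_integral_le_of_norm_le (μ := pathMeasure ν)
      (f := fun s => martPart ν f n x s ^ 2 - orbitSum f n x s ^ 2)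
      (((h.integrable_orbitSum_sq n x).const_mul η).add (integrable_const ((1 + η⁻¹) * B ^ 2)))
      (ae_of_all _ hpt)
    rw [Real.norm_eq_abs] at h3
    refine h3.trans (le_of_eq ?_)
    have := integral_add ((h.integrable_orbitSum_sq n x).const_mul η)
      (integrable_const (μ := pathMeasure ν) ((1 + η⁻¹) * B ^ 2))
    simpa [integral_const_mul] using this
  set I := ∫ s, orbitSum f n x s ^ 2 ∂pathMeasure ν
  have hδ1 : δ ≤ 1 := min_le_left _ _
  have hδ2 : δ ≤ ε / 4 := min_le_right _ _
  have hI : I ≤ (σ + 1) * n := by nlinarith [(abs_le.1 h1).2]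
  have hηI : η * I ≤ ε / 4 * n := by
    calc η * I ≤ η * ((σ + 1) * n) := by gcongr
      _ = (η * (σ + 1)) * n := by ring
      _ ≤ _ := by gcongr
  have hδn : δ * n ≤ ε / 4 * n := by gcongr
  have h4 := abs_sub_le (∫ s, martPart ν f n x s ^ 2 ∂pathMeasure ν) I (n * σ)
  nlinarith

end IsMixing

end

/-! ### The central limit theorem, uniformly in the starting point -/

section

theorem norm_cexp_ofReal_mul_I_sub_le {y : ℝ} (hy : |y| ≤ 1) :
    ‖Complex.exp ((y : ℂ) * Complex.I) - ((1 - y ^ 2 / 2 : ℝ) + (y : ℝ) * Complex.I : ℂ)‖ ≤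
      |y| ^ 3 := by
  have hn : ‖(y : ℂ) * Complex.I‖ = |y| := by simp
  have h := Complex.exp_bound (x := (y : ℂ) * Complex.I) (by rw [hn]; exact hy) (n := 3) (by norm_num)
  rw [hn] at h
  have he : ∑ m ∈ Finset.range 3, ((y : ℂ) * Complex.I) ^ m / (m.factorial : ℂ) =
      ((1 - y ^ 2 / 2 : ℝ) + (y : ℝ) * Complex.I : ℂ) := by
    simp only [Finset.sum_range_succ, Finset.sum_range_zero, Nat.factorial, mul_pow, Complex.I_sq]
    push_cast
    ring
  rw [he] at h
  refine h.trans ?_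
  have : 0 ≤ |y| ^ 3 := by positivity
  simp only [Nat.factorial]
  push_cast
  nlinarith

theorem norm_cexp_mul_I_sub_le (y z : ℝ) :
    ‖Complex.exp ((y : ℂ) * Complex.I) - Complex.exp ((z : ℂ) * Complex.I)‖ ≤ |y - z| := by
  have h1 : Complex.exp ((y : ℂ) * Complex.I) - Complex.exp ((z : ℂ) * Complex.I) =
      Complex.exp ((z : ℂ) * Complex.I) * (Complex.exp (Complex.I * ((y - z : ℝ) : ℂ)) - 1) := by
    rw [mul_sub, ← Complex.exp_add, mul_one]
    push_cast
    congr 2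
    ring
  rw [h1, norm_mul, Complex.norm_exp_ofReal_mul_I, one_mul]
  exact Real.norm_exp_I_mul_ofReal_sub_one_le

theorem exp_neg_sub_exp_neg_le {u v : ℝ} (hu : 0 ≤ u) (huv : u ≤ v) :
    Real.exp (-u) - Real.exp (-v) ≤ v - u := by
  have : Real.exp (-v) = Real.exp (-u) * Real.exp (-(v - u)) := by
    rw [← Real.exp_add]; congr 1; ring
  rw [this]
  have h2 := Real.add_one_le_exp (-(v - u))
  have h3 : Real.exp (-u) ≤ 1 := Real.exp_le_one_iff.2 (by linarith)
  have h4 := Real.exp_pos (-u)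
  nlinarith

namespace IsMixing

variable {ν : Measure ℝ} [IsProbabilityMeasure ν] {f : ℝ → ℝ} {K : ℝ} {a m : ℕ → ℝ}

theorem integrable_cexp {u : (ℕ → ℝ) → ℝ} (hu : Measurable u) :
    Integrable (fun s => Complex.exp ((u s : ℂ) * Complex.I)) (pathMeasure ν) := by
  refine Integrable.of_bound (C := 1) (Measurable.aestronglyMeasurable (by fun_prop))
    (ae_of_all _ fun s => ?_)
  rw [Complex.norm_exp_ofReal_mul_I]

theorem measurable_martPart_right (h : IsMixing ν f K a m) (n : ℕ) (x : ℝ) :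
    Measurable (martPart ν f n x) := by
  have := h.measurable_martPart n
  fun_prop

theorem measurable_orbitSum_right (h : IsMixing ν f K a m) (n : ℕ) (x : ℝ) :
    Measurable (orbitSum f n x) := by
  have := measurable_orbitSum h.measurable n
  fun_prop

/-- Expand both exponentials to second order. The linear term vanishes because the martingale part
has mean zero, and the quadratic terms differ by the variance error `hL`. The two cubic errors come
from the two remainders. -/
theorem norm_integral_cexp_martPart_block_le (h : IsMixing ν f K a m) {L : ℕ} {ε D : ℝ}
    (hL : ∀ x, |∫ s, martPart ν f L x s ^ 2 ∂pathMeasure ν - L * asympVar m| ≤ ε * L)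
    (hD : ∀ x s, |martPart ν f L x s| ≤ D) (hD1 : 1 ≤ D) (hDL : L * asympVar m ≤ D)
    {θ : ℝ} (hθ1 : |θ| ≤ 1) (hθD : |θ| * D ≤ 1) (x : ℝ) :
    ‖∫ s, Complex.exp ((θ * martPart ν f L x s : ℝ) * Complex.I) ∂pathMeasure ν -
      (Real.exp (-(θ ^ 2 * (L * asympVar m) / 2)) : ℝ)‖ ≤
      θ ^ 2 * (ε * L) + 2 * (|θ| * D) ^ 3 := by
  set σ := asympVar m
  have hσ : 0 ≤ σ := h.asympVar_nonneg
  have hM := h.measurable_martPart_right L x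
  have hMi := h.integrable_martPart L x
  have hM2 := h.integrable_martPart_sq L x
  set z := θ ^ 2 * (L * σ) / 2 with hz
  have hz0 : 0 ≤ z := by positivity
  have hzD : z ≤ |θ| * (|θ| * D) / 2 := by
    rw [hz, ← sq_abs]
    have : |θ| ^ 2 * (L * σ) ≤ |θ| ^ 2 * D := by gcongr
    linarith
  have hzθ : z ≤ |θ| / 2 := by
    have : |θ| * (|θ| * D) ≤ |θ| * 1 := by gcongr
    linarith
  -- `L * σ ≤ D` and `1 ≤ D` let the quadratic remainder of `exp (-z)` be absorbed into the same
  -- cubic error as the other expansion.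
  have hz2 : z ^ 2 ≤ (|θ| * D) ^ 3 := by
    have h0 : 0 ≤ |θ| := abs_nonneg θ
    have h0' : |θ| ≤ |θ| * D := le_mul_of_one_le_right h0 hD1
    calc z ^ 2 = z * z := sq z
      _ ≤ (|θ| * (|θ| * D) / 2) * (|θ| / 2) := by gcongr
      _ ≤ (|θ| * D * (|θ| * D)) * (|θ| * D) := by
          gcongr
          · have : 0 ≤ |θ| * (|θ| * D) := by positivity
            calc |θ| * (|θ| * D) / 2 ≤ |θ| * (|θ| * D) := by linarith
              _ ≤ _ := by gcongr
          · linarith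
      _ = _ := by ring
  have hexpz : |Real.exp (-z) - (1 - z)| ≤ (|θ| * D) ^ 3 := by
    have := Real.abs_exp_sub_one_sub_id_le (x := -z) (by rw [abs_neg, abs_of_nonneg hz0]; linarith)
    calc _ = |Real.exp (-z) - 1 - -z| := by congr 1; ring
      _ ≤ _ := by rw [neg_sq] at this; exact this.trans hz2
  have hquad : ∫ s, (((1 - (θ * martPart ν f L x s) ^ 2 / 2 : ℝ) : ℂ) +
      ((θ * martPart ν f L x s : ℝ) : ℂ) * Complex.I) ∂pathMeasure ν =
      ((1 - θ ^ 2 / 2 * ∫ s, martPart ν f L x s ^ 2 ∂pathMeasure ν : ℝ) : ℂ) := by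
    have e1 : Integrable (fun s => 1 - (θ * martPart ν f L x s) ^ 2 / 2) (pathMeasure ν) := by
      simp only [mul_pow]
      exact (integrable_const _).sub ((hM2.const_mul _).div_const _)
    have e2 : Integrable (fun s => θ * martPart ν f L x s) (pathMeasure ν) := hMi.const_mul _
    rw [integral_add e1.ofReal (e2.ofReal.mul_const _), integral_mul_const,
      integral_complex_ofReal, integral_complex_ofReal, integral_const_mul, h.integral_martPart]
    simp only [mul_pow]
    rw [integral_sub (integrable_const _) ((hM2.const_mul _).div_const _), integral_div,
      integral_const_mul]
    simp
    ring
  have hdiff : ‖∫ s, Complex.exp ((θ * martPart ν f L x s : ℝ) * Complex.I) ∂pathMeasure ν -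
      ((1 - θ ^ 2 / 2 * ∫ s, martPart ν f L x s ^ 2 ∂pathMeasure ν : ℝ) : ℂ)‖ ≤
      (|θ| * D) ^ 3 := by
    rw [← hquad, ← integral_sub (integrable_cexp (by fun_prop)) ?_]
    · have := norm_integral_le_of_norm_le_const (μ := pathMeasure ν) (C := (|θ| * D) ^ 3)
        (f := fun s => Complex.exp ((θ * martPart ν f L x s : ℝ) * Complex.I) -
        (((1 - (θ * martPart ν f L x s) ^ 2 / 2 : ℝ) : ℂ) +
          ((θ * martPart ν f L x s : ℝ) : ℂ) * Complex.I)) (ae_of_all _ fun s => ?_)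
      · simpa using this
      · have hle : |θ * martPart ν f L x s| ≤ |θ| * D := by
          rw [abs_mul]
          gcongr
          exact hD x s
        exact (norm_cexp_ofReal_mul_I_sub_le (hle.trans hθD)).trans (by gcongr)
    · refine Integrable.add ?_ ?_
      · refine Integrable.ofReal ?_
        simp only [mul_pow]
        exact (integrable_const _).sub ((hM2.const_mul _).div_const _)
      · exact (hMi.const_mul θ).ofReal.mul_const _
  have hvar : |(1 - θ ^ 2 / 2 * ∫ s, martPart ν f L x s ^ 2 ∂pathMeasure ν) - (1 - z)| ≤
      θ ^ 2 * (ε * L) := by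
    have : (1 - θ ^ 2 / 2 * ∫ s, martPart ν f L x s ^ 2 ∂pathMeasure ν) - (1 - z) =
        -(θ ^ 2 / 2 * (∫ s, martPart ν f L x s ^ 2 ∂pathMeasure ν - L * σ)) := by
      rw [hz]; ring
    rw [this, abs_neg, abs_mul, abs_of_nonneg (by positivity)]
    have h1 := hL x
    have h2 : 0 ≤ ε * L := (abs_nonneg _).trans h1
    calc _ ≤ θ ^ 2 / 2 * (ε * L) := by gcongr
      _ ≤ _ := by nlinarith [sq_nonneg θ]
  have hreal : |(1 - θ ^ 2 / 2 * ∫ s, martPart ν f L x s ^ 2 ∂pathMeasure ν) - Real.exp (-z)| ≤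
      θ ^ 2 * (ε * L) + (|θ| * D) ^ 3 := by
    refine (abs_sub_le _ (1 - z) _).trans (add_le_add hvar ?_)
    rwa [abs_sub_comm]
  refine (norm_sub_le_norm_sub_add_norm_sub _
    ((1 - θ ^ 2 / 2 * ∫ s, martPart ν f L x s ^ 2 ∂pathMeasure ν : ℝ) : ℂ) _).trans ?_
  rw [← Complex.ofReal_sub, Complex.norm_real, Real.norm_eq_abs]
  linarith

/-- Splitting off one block, the error of the continuation is multiplied by a number of modulus one
and the error of the block by `q ^ k`, of modulus at most one. Errors therefore add, provided the
block estimate holds from every start. -/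
theorem norm_integral_cexp_martPart_mul_le (h : IsMixing ν f K a m) {L : ℕ} {θ q r : ℝ}
    (hq : |q| ≤ 1) (hblock : ∀ x,
      ‖∫ s, Complex.exp ((θ * martPart ν f L x s : ℝ) * Complex.I) ∂pathMeasure ν - (q : ℂ)‖ ≤ r)
    (k : ℕ) (x : ℝ) :
    ‖∫ s, Complex.exp ((θ * martPart ν f (L * k) x s : ℝ) * Complex.I) ∂pathMeasure ν -
      ((q ^ k : ℝ) : ℂ)‖ ≤ k * r := by
  induction k generalizing x with
  | zero => simp [martPart_zero]
  | succ k ih =>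
    have hM := h.measurable_martPart_right (L * (k + 1)) x
    have hML := h.measurable_martPart_right L x
    have hint : Integrable (fun s => Complex.exp ((θ * martPart ν f (L * (k + 1)) x s : ℝ) *
        Complex.I)) (pathMeasure ν) := integrable_cexp (by fun_prop)
    rw [integral_splice ν L hint]
    have hsplit : ∀ s s', Complex.exp ((θ * martPart ν f (L * (k + 1)) x (splice L (s, s')) : ℝ) *
        Complex.I) = Complex.exp ((θ * martPart ν f L x s : ℝ) * Complex.I) *
        Complex.exp ((θ * martPart ν f (L * k) (x + walk L s) s' : ℝ) * Complex.I) := by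
      intro s s'
      rw [show L * (k + 1) = L + L * k by ring, martPart_splice_add, ← Complex.exp_add]
      push_cast
      congr 1
      ring
    simp only [hsplit, integral_const_mul]
    set φ : (ℕ → ℝ) → ℂ := fun s => ∫ s', Complex.exp
      ((θ * martPart ν f (L * k) (x + walk L s) s' : ℝ) * Complex.I) ∂pathMeasure ν with hφ
    have hφm : StronglyMeasurable φ := by
      refine StronglyMeasurable.integral_prod_right' (f := fun p : (ℕ → ℝ) × (ℕ → ℝ) => Complex.exp
        ((θ * martPart ν f (L * k) (x + walk L p.1) p.2 : ℝ) * Complex.I)) ?_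
      have h1 := h.measurable_martPart (L * k)
      have h2 : Measurable fun p : (ℕ → ℝ) × (ℕ → ℝ) =>
          martPart ν f (L * k) (x + walk L p.1) p.2 :=
        h1.comp (f := fun p : (ℕ → ℝ) × (ℕ → ℝ) => (x + walk L p.1, p.2)) (by fun_prop)
      exact Measurable.stronglyMeasurable (by fun_prop)
    have e1 : Integrable (fun s => Complex.exp ((θ * martPart ν f L x s : ℝ) * Complex.I))
        (pathMeasure ν) := integrable_cexp (by fun_prop)
    have e2 : Integrable (fun s => Complex.exp ((θ * martPart ν f L x s : ℝ) * Complex.I) *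
        (φ s - ((q ^ k : ℝ) : ℂ))) (pathMeasure ν) := by
      refine Integrable.of_bound (C := 1 * (k * r)) ?_ (ae_of_all _ fun s => ?_)
      · exact e1.1.mul (hφm.aestronglyMeasurable.sub aestronglyMeasurable_const)
      · rw [norm_mul, Complex.norm_exp_ofReal_mul_I]
        gcongr
        exact ih _
    have hkey : ∫ s, Complex.exp ((θ * martPart ν f L x s : ℝ) * Complex.I) * φ s ∂pathMeasure ν -
        ((q ^ (k + 1) : ℝ) : ℂ) = ∫ s, Complex.exp ((θ * martPart ν f L x s : ℝ) * Complex.I) *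
          (φ s - ((q ^ k : ℝ) : ℂ)) ∂pathMeasure ν +
        (∫ s, Complex.exp ((θ * martPart ν f L x s : ℝ) * Complex.I) ∂pathMeasure ν - (q : ℂ)) *
          ((q ^ k : ℝ) : ℂ) := by
      have : ∀ s, Complex.exp ((θ * martPart ν f L x s : ℝ) * Complex.I) * φ s =
          Complex.exp ((θ * martPart ν f L x s : ℝ) * Complex.I) * (φ s - ((q ^ k : ℝ) : ℂ)) +
          Complex.exp ((θ * martPart ν f L x s : ℝ) * Complex.I) * ((q ^ k : ℝ) : ℂ) := by
        intro s; ring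
      simp only [this]
      rw [integral_add e2 (e1.mul_const _), integral_mul_const]
      push_cast
      ring
    rw [hkey]
    refine (norm_add_le _ _).trans ?_
    have b1 : ‖∫ s, Complex.exp ((θ * martPart ν f L x s : ℝ) * Complex.I) *
          (φ s - ((q ^ k : ℝ) : ℂ)) ∂pathMeasure ν‖ ≤ k * r := by
      have := norm_integral_le_of_norm_le_const (μ := pathMeasure ν) (C := k * r) (f := fun s =>
        Complex.exp ((θ * martPart ν f L x s : ℝ) * Complex.I) * (φ s - ((q ^ k : ℝ) : ℂ)))
        (ae_of_all _ fun s => by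
          rw [norm_mul, Complex.norm_exp_ofReal_mul_I, one_mul]
          exact ih _)
      simpa using this
    have b2 : ‖(∫ s, Complex.exp ((θ * martPart ν f L x s : ℝ) * Complex.I) ∂pathMeasure ν -
        (q : ℂ)) * ((q ^ k : ℝ) : ℂ)‖ ≤ r := by
      rw [norm_mul, Complex.norm_real, Real.norm_eq_abs, abs_pow]
      have h1 := hblock x
      have h2 : |q| ^ k ≤ 1 := pow_le_one₀ (abs_nonneg _) hq
      calc _ ≤ r * 1 := mul_le_mul h1 h2 (by positivity) ((norm_nonneg _).trans h1)
        _ = r := mul_one r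
    rw [Nat.cast_succ, add_mul, one_mul]
    exact add_le_add b1 b2

set_option maxHeartbeats 800000 in
/-- Convergence of characteristic functions, uniformly in the starting point. -/
theorem exists_norm_integral_cexp_orbitSum_sub_le (h : IsMixing ν f K a m) (t : ℝ) {ε : ℝ}
    (hε : 0 < ε) : ∃ n₀ : ℕ, ∀ n ≥ n₀, ∀ x,
      ‖∫ s, Complex.exp ((t / √n * orbitSum f n x s : ℝ) * Complex.I) ∂pathMeasure ν -
        (Real.exp (-(t ^ 2 * asympVar m / 2)) : ℝ)‖ ≤ ε := by
  set σ := asympVar m with hσ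
  have hσ0 : 0 ≤ σ := h.asympVar_nonneg
  set B := 2 * ∑' k, a (k + 1) with hB
  have hB0 : 0 ≤ B := mul_nonneg zero_le_two h.potBound_nonneg
  have hK := h.K_nonneg
  -- The variance errors of all the blocks total at most `t ^ 2 * η`, hence `ε / 4`. The other
  -- errors tend to zero with `n` and are held below `ε / 2`.
  set η := ε / 4 / (t ^ 2 + 1) with hη
  have hη0 : 0 < η := by positivity
  obtain ⟨L₀, hL₀⟩ := h.exists_abs_integral_martPart_sq_sub_le hη0
  set L := L₀ + 1 with hLdef
  have hL := hL₀ L (by omega)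
  have hLpos : 0 < L := by omega
  -- One constant bounds the martingale part of a block and also dominates `1` and `L * σ`, as the
  -- block estimate requires.
  set D := 1 + L * K + B + L * σ with hD
  have hLK : 0 ≤ L * K := by positivity
  have hLσ : 0 ≤ L * σ := by positivity
  have hD1 : 1 ≤ D := by linarith
  have hlim : Tendsto (fun n : ℕ => 2 * |t| ^ 3 * D ^ 3 / √(n : ℝ) + t ^ 2 * L * σ / 2 / n +
      |t| * (B + L * K) / √(n : ℝ)) atTop (𝓝 (0 + 0 + 0)) := by
    have hs : Tendsto (fun n : ℕ => √(n : ℝ)) atTop atTop :=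
      Real.tendsto_sqrt_atTop.comp tendsto_natCast_atTop_atTop
    exact ((tendsto_const_nhds.div_atTop hs).add
      (tendsto_const_nhds.div_atTop tendsto_natCast_atTop_atTop)).add
      (tendsto_const_nhds.div_atTop hs)
  have hlim2 : Tendsto (fun n : ℕ => |t| * D / √(n : ℝ)) atTop (𝓝 0) :=
    tendsto_const_nhds.div_atTop (Real.tendsto_sqrt_atTop.comp tendsto_natCast_atTop_atTop)
  have hev : ∀ᶠ n : ℕ in atTop, 2 * |t| ^ 3 * D ^ 3 / √(n : ℝ) + t ^ 2 * L * σ / 2 / n +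
      |t| * (B + L * K) / √(n : ℝ) < ε / 2 := by
    refine hlim.eventually (gt_mem_nhds ?_)
    linarith
  obtain ⟨n₀, hn₀⟩ := eventually_atTop.1
    (hev.and ((hlim2.eventually (gt_mem_nhds one_pos)).and (eventually_gt_atTop 0)))
  refine ⟨n₀, fun n hn x => ?_⟩
  obtain ⟨hn1, hn2, hn3⟩ := hn₀ n hn
  have hnpos : (0 : ℝ) < n := by exact_mod_cast hn3
  have hsn : 0 < √(n : ℝ) := Real.sqrt_pos.2 hnpos
  have hsq : √(n : ℝ) ^ 2 = n := Real.sq_sqrt hnpos.le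
  set θ := t / √(n : ℝ) with hθ
  have hθabs : |θ| = |t| / √(n : ℝ) := by rw [hθ, abs_div, abs_of_pos hsn]
  have hθD : |θ| * D ≤ 1 := by
    rw [hθabs, div_mul_eq_mul_div]; exact hn2.le
  have hθ1 : |θ| ≤ 1 := (le_mul_of_one_le_right (abs_nonneg θ) hD1).trans hθD
  have hθ2 : θ ^ 2 * n = t ^ 2 := by rw [hθ, div_pow, hsq]; field_simp
  set k := n / L with hk
  have hkL : L * k ≤ n := Nat.mul_div_le n L
  have hkL' : n ≤ L * k + L := by
    have := Nat.lt_mul_div_succ n hLpos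
    rw [mul_add, mul_one] at this
    exact this.le
  have hkLr : (L : ℝ) * k ≤ n := by exact_mod_cast hkL
  have hkLr' : (n : ℝ) ≤ L * k + L := by exact_mod_cast hkL'
  have hkn : (k : ℝ) ≤ n := by exact_mod_cast Nat.div_le_self n L
  set q := Real.exp (-(θ ^ 2 * (L * σ) / 2)) with hq
  have hq1 : |q| ≤ 1 := by
    rw [abs_of_pos (Real.exp_pos _), Real.exp_le_one_iff]
    have : 0 ≤ θ ^ 2 * (L * σ) / 2 := by positivity
    linarith
  have hDM : ∀ x s, |martPart ν f L x s| ≤ D := fun x s =>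
    (h.abs_martPart_le L x s).trans (by linarith)
  have h1 := h.norm_integral_cexp_martPart_mul_le hq1
    (fun x => h.norm_integral_cexp_martPart_block_le hL hDM hD1 (by linarith) hθ1 hθD x) k x
  -- the error from the blocks
  have e1 : k * (θ ^ 2 * (η * L) + 2 * (|θ| * D) ^ 3) ≤
      ε / 4 + 2 * |t| ^ 3 * D ^ 3 / √(n : ℝ) := by
    have c1 : k * (θ ^ 2 * (η * L)) ≤ ε / 4 := by
      calc k * (θ ^ 2 * (η * L)) = θ ^ 2 * (L * k) * η := by ring
        _ ≤ θ ^ 2 * n * η := by gcongr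
        _ = t ^ 2 * η := by rw [hθ2]
        _ ≤ ε / 4 := by
          rw [hη, mul_div_assoc', div_le_iff₀ (by positivity)]
          nlinarith
    have c2 : k * (2 * (|θ| * D) ^ 3) ≤ 2 * |t| ^ 3 * D ^ 3 / √(n : ℝ) := by
      calc k * (2 * (|θ| * D) ^ 3) ≤ n * (2 * (|θ| * D) ^ 3) := by gcongr
        _ = _ := by
          rw [hθabs, mul_pow, div_pow]
          have : √(n : ℝ) ^ 3 = n * √(n : ℝ) := by rw [pow_succ, hsq]
          rw [this]
          field_simp
    rw [mul_add]
    linarith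
  -- the error from the remainder in the variance
  have e2 : |q ^ k - Real.exp (-(t ^ 2 * σ / 2))| ≤ t ^ 2 * L * σ / 2 / n := by
    have hqk : q ^ k = Real.exp (-(θ ^ 2 * (L * k) * σ / 2)) := by
      rw [hq, ← Real.exp_nat_mul]
      congr 1
      ring
    have hle : θ ^ 2 * (L * k) * σ / 2 ≤ t ^ 2 * σ / 2 := by
      rw [← hθ2]
      gcongr
    rw [hqk, abs_of_nonneg (sub_nonneg.2 (Real.exp_le_exp.2 (neg_le_neg hle)))]
    set u := θ ^ 2 * (L * k) * σ / 2
    set v := t ^ 2 * σ / 2 with hv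
    have hu0 : 0 ≤ u := by positivity
    have hvu : v - u ≤ t ^ 2 * L * σ / 2 / n := by
      have : v - u = θ ^ 2 * (n - L * k) * σ / 2 := by
        rw [hv, ← hθ2]; ring
      rw [this, le_div_iff₀ hnpos]
      calc θ ^ 2 * (n - L * k) * σ / 2 * n = (θ ^ 2 * n) * (n - L * k) * σ / 2 := by ring
        _ ≤ (θ ^ 2 * n) * L * σ / 2 := by
          gcongr
          linarith
        _ = _ := by rw [hθ2]
    exact (exp_neg_sub_exp_neg_le hu0 hle).trans hvu
  -- the error from the coboundary and the incomplete block
  have e3 : ‖∫ s, Complex.exp ((θ * orbitSum f n x s : ℝ) * Complex.I) ∂pathMeasure ν -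
      ∫ s, Complex.exp ((θ * martPart ν f (L * k) x s : ℝ) * Complex.I) ∂pathMeasure ν‖ ≤
      |t| * (B + L * K) / √(n : ℝ) := by
    have m1 := h.measurable_orbitSum_right n x
    have m2 := h.measurable_martPart_right (L * k) x
    rw [← integral_sub (integrable_cexp (by fun_prop)) (integrable_cexp (by fun_prop))]
    have := norm_integral_le_of_norm_le_const (μ := pathMeasure ν)
      (C := |t| * (B + L * K) / √(n : ℝ)) (f := fun s =>
        Complex.exp ((θ * orbitSum f n x s : ℝ) * Complex.I) -
        Complex.exp ((θ * martPart ν f (L * k) x s : ℝ) * Complex.I)) (ae_of_all _ fun s => ?_)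
    · simpa using this
    · refine (norm_cexp_mul_I_sub_le _ _).trans ?_
      rw [← mul_sub, abs_mul, hθabs, div_mul_eq_mul_div]
      gcongr
      have d1 := h.abs_martPart_sub_le (L * k) x s
      have d2 := abs_orbitSum_sub_le h.bound hkL x s
      rw [abs_sub_comm] at d1
      have d3 := abs_sub_le (orbitSum f n x s) (orbitSum f (L * k) x s) (martPart ν f (L * k) x s)
      have d4 : ((n : ℝ) - (L * k : ℕ)) * K ≤ L * K := by
        gcongr
        push_cast
        linarith
      linarith
  calc _ ≤ ‖∫ s, Complex.exp ((θ * orbitSum f n x s : ℝ) * Complex.I) ∂pathMeasure ν -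
      ∫ s, Complex.exp ((θ * martPart ν f (L * k) x s : ℝ) * Complex.I) ∂pathMeasure ν‖ +
      (‖∫ s, Complex.exp ((θ * martPart ν f (L * k) x s : ℝ) * Complex.I) ∂pathMeasure ν -
        ((q ^ k : ℝ) : ℂ)‖ + ‖((q ^ k : ℝ) : ℂ) - (Real.exp (-(t ^ 2 * σ / 2)) : ℝ)‖) :=
        (norm_sub_le_norm_sub_add_norm_sub _ _ _).trans
          (add_le_add_right (norm_sub_le_norm_sub_add_norm_sub _ _ _) _)
    _ ≤ ε := by
      rw [← Complex.ofReal_sub, Complex.norm_real, Real.norm_eq_abs]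
      linarith

/-- The central limit theorem for arbitrary, varying starting points. -/
theorem tendstoInDistribution (h : IsMixing ν f K a m) (x : ℕ → ℝ) :
    TendstoInDistribution (fun (n : ℕ) s => orbitSum f n (x n) s / √(n : ℝ)) atTop (id : ℝ → ℝ)
      (fun _ => pathMeasure ν) (gaussianReal 0 (asympVar m).toNNReal) where
  forall_aemeasurable n := by
    have := h.measurable_orbitSum_right n (x n)
    exact Measurable.aemeasurable (by fun_prop)
  tendsto := by
    refine ProbabilityMeasure.tendsto_iff_tendsto_charFun.2 fun t => ?_
    simp only [ProbabilityMeasure.coe_mk, Measure.map_id, charFun_gaussianReal]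
    have hlim : Complex.exp (t * (0 : ℝ) * Complex.I - ((asympVar m).toNNReal : ℝ) * t ^ 2 / 2) =
        ((Real.exp (-(t ^ 2 * asympVar m / 2)) : ℝ) : ℂ) := by
      rw [Real.coe_toNNReal _ h.asympVar_nonneg]
      push_cast
      congr 1
      ring
    have hchar : ∀ n : ℕ, charFun
        ((pathMeasure ν).map fun s => orbitSum f n (x n) s / √(n : ℝ)) t =
        ∫ s, Complex.exp ((t / √n * orbitSum f n (x n) s : ℝ) * Complex.I) ∂pathMeasure ν := by
      intro n
      have := h.measurable_orbitSum_right n (x n)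
      rw [charFun_apply_real, integral_map (Measurable.aemeasurable (by fun_prop))
        (Measurable.aestronglyMeasurable (by fun_prop))]
      refine integral_congr_ae (ae_of_all _ fun s => ?_)
      dsimp only
      congr 1
      push_cast
      ring
    rw [hlim]
    simp only [hchar]
    rw [Metric.tendsto_atTop]
    intro ε hε
    obtain ⟨n₀, hn₀⟩ := h.exists_norm_integral_cexp_orbitSum_sub_le t (half_pos hε)
    refine ⟨n₀, fun n hn => ?_⟩
    rw [dist_eq_norm]
    exact (hn₀ n hn (x n)).trans_lt (half_lt_self hε)

end IsMixing

end

/-! ### Exponential moments and the upper half of the iterated logarithm law -/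

section

theorem exp_le_quadratic_add_cubic {y : ℝ} (hy : |y| ≤ 1) :
    Real.exp y ≤ 1 + y + y ^ 2 / 2 + |y| ^ 3 := by
  have h := (abs_le.1 (Real.exp_bound hy (n := 3) (by norm_num))).2
  simp only [Finset.sum_range_succ, Finset.sum_range_zero, Nat.factorial] at h
  push_cast at h
  have : 0 ≤ |y| ^ 3 := by positivity
  linarith

/-- The normalization in the law of the iterated logarithm. -/
noncomputable def lilScale (t : ℝ) : ℝ := √(2 * t * Real.log (Real.log t))

theorem lilScale_nonneg (t : ℝ) : 0 ≤ lilScale t := Real.sqrt_nonneg _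

theorem log_log_nonneg {t : ℝ} (ht : Real.exp 1 ≤ t) : 0 ≤ Real.log (Real.log t) := by
  refine Real.log_nonneg ?_
  rwa [Real.le_log_iff_exp_le ((Real.exp_pos 1).trans_le ht)]

theorem lilScale_mono {t t' : ℝ} (ht : Real.exp 1 ≤ t) (htt' : t ≤ t') :
    lilScale t ≤ lilScale t' := by
  have h0 := (Real.exp_pos 1).trans_le ht
  have h1 : 1 ≤ Real.log t := by rwa [Real.le_log_iff_exp_le h0]
  have h2 := log_log_nonneg ht
  have h3 : 0 ≤ 2 * t' := by linarith
  unfold lilScale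
  gcongr

theorem lilScale_sq {t : ℝ} (ht : Real.exp 1 ≤ t) :
    lilScale t ^ 2 = 2 * t * Real.log (Real.log t) := by
  have h0 := (Real.exp_pos 1).trans_le ht
  have := log_log_nonneg ht
  exact Real.sq_sqrt (by positivity)

theorem tendsto_log_log : Tendsto (fun t : ℝ => Real.log (Real.log t)) atTop atTop :=
  Real.tendsto_log_atTop.comp Real.tendsto_log_atTop

theorem tendsto_lilScale : Tendsto lilScale atTop atTop := by
  refine Real.tendsto_sqrt_atTop.comp ?_
  exact (tendsto_id.const_mul_atTop zero_lt_two).atTop_mul_atTop₀ tendsto_log_log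

/-- Ensures that the exponential parameter used at time `t` lies in the small range where the
Gaussian moment bound holds. -/
theorem tendsto_lilScale_div : Tendsto (fun t => lilScale t / t) atTop (𝓝 0) := by
  have h1 : Tendsto (fun t : ℝ => Real.log t / t) atTop (𝓝 0) := by
    simpa using Real.tendsto_pow_log_div_mul_add_atTop 1 0 1 one_ne_zero
  have h2 : Tendsto (fun t : ℝ => √(2 * (Real.log t / t))) atTop (𝓝 0) := by
    simpa using (h1.const_mul 2).sqrt
  refine squeeze_zero' ?_ ?_ h2
  · filter_upwards [eventually_gt_atTop 0] with t ht
    exact div_nonneg (lilScale_nonneg t) ht.le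
  · filter_upwards [eventually_ge_atTop (Real.exp 1)] with t ht
    have h0 := (Real.exp_pos 1).trans_le ht
    have h3 : 1 ≤ Real.log t := by rwa [Real.le_log_iff_exp_le h0]
    have h4 : Real.log (Real.log t) ≤ Real.log t := Real.log_le_self (by linarith)
    refine Real.le_sqrt_of_sq_le ?_
    rw [div_pow, lilScale_sq ht]
    rw [div_le_iff₀ (by positivity)]
    calc _ ≤ 2 * t * Real.log t := by gcongr
      _ = _ := by field_simp

namespace IsMixing

variable {ν : Measure ℝ} [IsProbabilityMeasure ν] {f : ℝ → ℝ} {K : ℝ} {a m : ℕ → ℝ}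

theorem integrable_exp_martPart (h : IsMixing ν f K a m) (c : ℝ) (n : ℕ) (x : ℝ) :
    Integrable (fun s => Real.exp (c * martPart ν f n x s)) (pathMeasure ν) := by
  have := h.measurable_martPart_right n x
  refine Integrable.of_bound (C := Real.exp (|c| * (n * K + 2 * ∑' k, a (k + 1))))
    (Measurable.aestronglyMeasurable (by fun_prop)) (ae_of_all _ fun s => ?_)
  rw [Real.norm_eq_abs, Real.abs_exp, Real.exp_le_exp]
  refine (le_abs_self _).trans ?_
  rw [abs_mul]
  gcongr
  exact h.abs_martPart_le n x s

theorem one_le_integral_exp_martPart (h : IsMixing ν f K a m) (c : ℝ) (n : ℕ) (x : ℝ) :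
    1 ≤ ∫ s, Real.exp (c * martPart ν f n x s) ∂pathMeasure ν := by
  have h1 : ∫ s, (c * martPart ν f n x s + 1) ∂pathMeasure ν = 1 := by
    rw [integral_add ((h.integrable_martPart n x).const_mul c) (integrable_const _),
      integral_const_mul, h.integral_martPart]
    simp
  rw [← h1]
  exact integral_mono (((h.integrable_martPart n x).const_mul c).add (integrable_const _))
    (h.integrable_exp_martPart c n x) fun s => Real.add_one_le_exp _

theorem integral_exp_martPart_mul_le (h : IsMixing ν f K a m) {L : ℕ} {c q : ℝ}
    (hblock : ∀ x, ∫ s, Real.exp (c * martPart ν f L x s) ∂pathMeasure ν ≤ q) (k : ℕ) (x : ℝ) :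
    ∫ s, Real.exp (c * martPart ν f (L * k) x s) ∂pathMeasure ν ≤ q ^ k := by
  have hq : 0 ≤ q := (integral_nonneg fun s => (Real.exp_pos _).le).trans (hblock 0)
  induction k generalizing x with
  | zero => simp [martPart_zero]
  | succ k ih =>
    rw [integral_splice ν L (h.integrable_exp_martPart c _ x)]
    simp only [show L * (k + 1) = L + L * k by ring, martPart_splice_add, mul_add, Real.exp_add,
      integral_const_mul]
    calc _ ≤ ∫ s, Real.exp (c * martPart ν f L x s) * q ^ k ∂pathMeasure ν := by
          refine integral_mono_of_nonneg (ae_of_all _ fun s => ?_)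
            ((h.integrable_exp_martPart c L x).mul_const _) (ae_of_all _ fun s => ?_)
          · exact mul_nonneg (Real.exp_pos _).le (integral_nonneg fun s' => (Real.exp_pos _).le)
          · dsimp only
            gcongr
            exact ih _
      _ ≤ q ^ (k + 1) := by
          rw [integral_mul_const, pow_succ']
          gcongr
          exact hblock x

/-- A Gaussian bound for exponential moments with small parameter. -/
theorem exists_integral_exp_martPart_le (h : IsMixing ν f K a m) {ε : ℝ} (hε : 0 < ε) :
    ∃ c₀ > 0, ∀ c, 0 ≤ c → c ≤ c₀ → ∀ n x,
      ∫ s, Real.exp (c * martPart ν f n x s) ∂pathMeasure ν ≤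
        2 * Real.exp (c ^ 2 * (asympVar m + ε) * n / 2) := by
  set σ := asympVar m with hσ
  have hσ0 : 0 ≤ σ := h.asympVar_nonneg
  set B := 2 * ∑' k, a (k + 1) with hB
  have hB0 : 0 ≤ B := mul_nonneg zero_le_two h.potBound_nonneg
  have hK := h.K_nonneg
  obtain ⟨L₀, hL₀⟩ := h.exists_abs_integral_martPart_sq_sub_le (half_pos hε)
  set L := L₀ + 1 with hLdef
  have hL := hL₀ L (by omega)
  have hLpos : 0 < L := by omega
  have hLr : (1 : ℝ) ≤ L := by exact_mod_cast hLpos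
  set D := 1 + L * K + 2 * B with hD
  have hLK : 0 ≤ L * K := by positivity
  have hD1 : 1 ≤ D := by linarith
  have hDM : ∀ x s, |martPart ν f L x s| ≤ D := fun x s =>
    (h.abs_martPart_le L x s).trans (by linarith)
  have hlog2 : Real.log 2 ≤ 1 := by linarith [Real.log_two_lt_d9]
  have hlog2' : 0 < Real.log 2 := Real.log_pos one_lt_two
  -- The first bound limits the effect of the incomplete last block to `exp (c * D) ≤ 2`, the source
  -- of the factor 2 in the conclusion. The second makes the cubic error of a block at most `c ^ 2 *
  -- (ε / 4 * L)`.
  refine ⟨min (Real.log 2 / D) (ε / 4 / D ^ 3), by positivity, fun c hc0 hc n x => ?_⟩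
  have hcD : c * D ≤ Real.log 2 := by
    have := hc.trans (min_le_left _ _)
    rwa [le_div_iff₀ (by positivity)] at this
  have hcD3 : c * D ^ 3 ≤ ε / 4 := by
    have := hc.trans (min_le_right _ _)
    rwa [le_div_iff₀ (by positivity)] at this
  have hblock : ∀ x, ∫ s, Real.exp (c * martPart ν f L x s) ∂pathMeasure ν ≤
      Real.exp (c ^ 2 * (σ + ε) * L / 2) := by
    intro x
    have hMi := h.integrable_martPart L x
    have hM2 := h.integrable_martPart_sq L x
    have hpt : ∀ s, Real.exp (c * martPart ν f L x s) ≤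
        1 + c * martPart ν f L x s + c ^ 2 / 2 * martPart ν f L x s ^ 2 + (c * D) ^ 3 := by
      intro s
      have hle : |c * martPart ν f L x s| ≤ c * D := by
        rw [abs_mul, abs_of_nonneg hc0]
        gcongr
        exact hDM x s
      have h1 := exp_le_quadratic_add_cubic (hle.trans (hcD.trans hlog2))
      have h2 : |c * martPart ν f L x s| ^ 3 ≤ (c * D) ^ 3 := by gcongr
      rw [mul_pow c (martPart ν f L x s)] at h1
      linarith
    have i1 : Integrable (fun s => 1 + c * martPart ν f L x s) (pathMeasure ν) :=
      (integrable_const _).add (hMi.const_mul _)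
    have i2 : Integrable (fun s => 1 + c * martPart ν f L x s +
        c ^ 2 / 2 * martPart ν f L x s ^ 2) (pathMeasure ν) := i1.add (hM2.const_mul _)
    have hint := integral_mono (h.integrable_exp_martPart c L x) (i2.add (integrable_const _)) hpt
    refine hint.trans ?_
    simp only [Pi.add_apply]
    rw [integral_add i2 (integrable_const _), integral_add i1 (hM2.const_mul _),
      integral_add (integrable_const _) (hMi.const_mul _), integral_const_mul, integral_const_mul,
      h.integral_martPart]
    simp only [integral_const, probReal_univ, one_smul, mul_zero, add_zero]
    have h3 := (abs_le.1 (hL x)).2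
    have h4 : c ^ 2 / 2 * ∫ s, martPart ν f L x s ^ 2 ∂pathMeasure ν ≤
        c ^ 2 / 2 * (L * σ + ε / 2 * L) := by
      gcongr
      linarith
    have h5 : (c * D) ^ 3 ≤ c ^ 2 * (ε / 4 * L) := by
      calc (c * D) ^ 3 = c ^ 2 * (c * D ^ 3) := by ring
        _ ≤ c ^ 2 * (ε / 4 * L) := by
          refine mul_le_mul_of_nonneg_left ?_ (sq_nonneg c)
          exact hcD3.trans (le_mul_of_one_le_right (by positivity) hLr)
    have h6 := Real.add_one_le_exp (c ^ 2 * (σ + ε) * L / 2)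
    have h7 : c ^ 2 / 2 * (L * σ + ε / 2 * L) + c ^ 2 * (ε / 4 * L) =
      c ^ 2 * (σ + ε) * L / 2 := by ring
    linarith
  set k := n / L with hk
  have hkL : L * k ≤ n := Nat.mul_div_le n L
  have hkL' : n ≤ L * k + L := by
    have := Nat.lt_mul_div_succ n hLpos
    rw [mul_add, mul_one] at this
    exact this.le
  have hkLr : (L : ℝ) * k ≤ n := by exact_mod_cast hkL
  have hkLr' : (n : ℝ) ≤ L * k + L := by exact_mod_cast hkL'
  have hstep : ∀ s, martPart ν f n x s ≤ martPart ν f (L * k) x s + D := by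
    intro s
    have d1 := (abs_le.1 (h.abs_martPart_sub_le (L * k) x s)).1
    have d2 := (abs_le.1 (abs_orbitSum_sub_le h.bound hkL x s)).2
    have d3 := (abs_le.1 (h.abs_martPart_sub_le n x s)).2
    have d4 : ((n : ℝ) - (L * k : ℕ)) * K ≤ L * K := by
      gcongr
      push_cast
      linarith
    linarith
  calc ∫ s, Real.exp (c * martPart ν f n x s) ∂pathMeasure ν
      ≤ ∫ s, 2 * Real.exp (c * martPart ν f (L * k) x s) ∂pathMeasure ν := by
        refine integral_mono (h.integrable_exp_martPart c n x)
          ((h.integrable_exp_martPart c (L * k) x).const_mul 2) fun s => ?_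
        dsimp only
        nth_rewrite 1 [← Real.exp_log (zero_lt_two' ℝ)]
        rw [← Real.exp_add, Real.exp_le_exp]
        have := mul_le_mul_of_nonneg_left (hstep s) hc0
        linarith
    _ ≤ 2 * Real.exp (c ^ 2 * (σ + ε) * L / 2) ^ k := by
        rw [integral_const_mul]
        gcongr
        exact h.integral_exp_martPart_mul_le hblock k x
    _ ≤ _ := by
        rw [← Real.exp_nat_mul]
        gcongr 2 * Real.exp ?_
        calc (k : ℝ) * (c ^ 2 * (σ + ε) * L / 2) = c ^ 2 * (σ + ε) * (L * k) / 2 := by ring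
          _ ≤ _ := by gcongr

/-- The event that the martingale part reaches the level `b` up to time `n`. -/
def reaches (ν : Measure ℝ) (f : ℝ → ℝ) (n : ℕ) (x b : ℝ) : Set (ℕ → ℝ) :=
  {s | ∃ k ≤ n, b ≤ martPart ν f k x s}

theorem measurableSet_reaches (h : IsMixing ν f K a m) (n : ℕ) (x b : ℝ) :
    MeasurableSet (reaches ν f n x b) := by
  have : reaches ν f n x b = ⋃ k ∈ Finset.range (n + 1), {s | b ≤ martPart ν f k x s} := by
    ext s
    simp [reaches]
  rw [this]
  exact Finset.measurableSet_biUnion _ fun k _ =>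
    measurableSet_le measurable_const (h.measurable_martPart_right k x)

/-- Doob's maximal inequality for the exponential submartingale, by induction on the first step
instead of a stopping time: after that step the walk faces the level `b - martPart ν f 1 x s` from
its new position, and the exponential factors recombine. -/
theorem measure_reaches_le_lintegral (h : IsMixing ν f K a m) {c : ℝ} (hc : 0 ≤ c) (n : ℕ)
    (x b : ℝ) : pathMeasure ν (reaches ν f n x b) ≤ ENNReal.ofReal (Real.exp (-(c * b))) *
      ∫⁻ s, ENNReal.ofReal (Real.exp (c * martPart ν f n x s)) ∂pathMeasure ν := by
  have hone : ∀ n x, 1 ≤ ∫⁻ s, ENNReal.ofReal (Real.exp (c * martPart ν f n x s))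
      ∂pathMeasure ν := by
    intro n x
    rw [← ofReal_integral_eq_lintegral_ofReal (h.integrable_exp_martPart c n x)
      (ae_of_all _ fun s => (Real.exp_pos _).le)]
    exact ENNReal.one_le_ofReal.2 (h.one_le_integral_exp_martPart c n x)
  -- For a non-positive level the right side is at least one, since the exponential moment is.
  have hneg : ∀ n x b, b ≤ 0 → pathMeasure ν (reaches ν f n x b) ≤
      ENNReal.ofReal (Real.exp (-(c * b))) *
      ∫⁻ s, ENNReal.ofReal (Real.exp (c * martPart ν f n x s)) ∂pathMeasure ν := by
    intro n x b hb
    have h1 : 1 ≤ ENNReal.ofReal (Real.exp (-(c * b))) := by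
      rw [ENNReal.one_le_ofReal, Real.one_le_exp_iff]
      have := mul_nonneg hc (neg_nonneg.2 hb)
      linarith
    exact prob_le_one.trans ((one_mul (1 : ENNReal)).symm.le.trans (mul_le_mul' h1 (hone n x)))
  induction n generalizing x b with
  | zero =>
    rcases le_or_gt b 0 with hb | hb
    · exact hneg 0 x b hb
    · have : reaches ν f 0 x b = ∅ := by
        ext s
        simp [reaches, martPart_zero, hb]
      simp [this]
  | succ n ih =>
    rcases le_or_gt b 0 with hb | hb
    · exact hneg _ x b hb
    · have hset : ∀ s s', (reaches ν f (n + 1) x b).indicator (1 : (ℕ → ℝ) → ENNReal)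
          (splice 1 (s, s')) = (reaches ν f n (x + walk 1 s)
            (b - martPart ν f 1 x s)).indicator 1 s' := by
        intro s s'
        have : splice 1 (s, s') ∈ reaches ν f (n + 1) x b ↔
            s' ∈ reaches ν f n (x + walk 1 s) (b - martPart ν f 1 x s) := by
          simp only [reaches, Set.mem_ofPred_eq]
          constructor
          · rintro ⟨k, hk, hbk⟩
            rcases k with _ | k
            · rw [martPart_zero] at hbk
              exact absurd hbk (not_le.2 hb)
            · rw [add_comm k 1, martPart_splice_add] at hbk
              exact ⟨k, by omega, by linarith⟩
          · rintro ⟨k, hk, hbk⟩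
            refine ⟨1 + k, by omega, ?_⟩
            rw [martPart_splice_add]
            linarith
        by_cases hs : s' ∈ reaches ν f n (x + walk 1 s) (b - martPart ν f 1 x s)
        · rw [Set.indicator_of_mem hs, Set.indicator_of_mem (this.2 hs)]
          rfl
        · rw [Set.indicator_of_notMem hs, Set.indicator_of_notMem (mt this.1 hs)]
      have hm := h.measurable_martPart_right (n + 1) x
      rw [← lintegral_indicator_one (h.measurableSet_reaches _ _ _),
        lintegral_splice ν 1 (measurable_one.indicator (h.measurableSet_reaches _ _ _)),
        lintegral_splice ν 1 (G := fun s => ENNReal.ofReal (Real.exp (c *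
          martPart ν f (n + 1) x s))) (by fun_prop),
        ← lintegral_const_mul' _ _ ENNReal.ofReal_ne_top]
      refine lintegral_mono fun s => ?_
      simp only [hset]
      rw [lintegral_indicator_one (h.measurableSet_reaches _ _ _)]
      refine (ih _ _).trans (le_of_eq ?_)
      rw [← lintegral_const_mul' _ _ ENNReal.ofReal_ne_top,
        ← lintegral_const_mul' _ _ ENNReal.ofReal_ne_top]
      refine lintegral_congr fun s' => ?_
      rw [add_comm n 1, martPart_splice_add, ← ENNReal.ofReal_mul (Real.exp_pos _).le,
        ← ENNReal.ofReal_mul (Real.exp_pos _).le, ← Real.exp_add, ← Real.exp_add]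
      congr 2
      ring

/-- The exponential maximal inequality. -/
theorem measureReal_reaches_le (h : IsMixing ν f K a m) {c : ℝ} (hc : 0 ≤ c) (n : ℕ) (x b : ℝ) :
    (pathMeasure ν).real (reaches ν f n x b) ≤
      Real.exp (-(c * b)) * ∫ s, Real.exp (c * martPart ν f n x s) ∂pathMeasure ν := by
  have h1 := h.measure_reaches_le_lintegral hc n x b
  rw [← ofReal_integral_eq_lintegral_ofReal (h.integrable_exp_martPart c n x)
      (ae_of_all _ fun s => (Real.exp_pos _).le), ← ENNReal.ofReal_mul (Real.exp_pos _).le] at h1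
  exact ENNReal.toReal_le_of_le_ofReal
    (mul_nonneg (Real.exp_pos _).le (integral_nonneg fun s => (Real.exp_pos _).le)) h1

/-- First Borel–Cantelli lemma at the geometric times θ^j. The maximal inequality controls all
earlier times at once, and the gap between `c₀` and `c₁` makes the probabilities summable. -/
theorem ae_eventually_martPart_lt (h : IsMixing ν f K a m) {c₀ c₁ θ : ℝ}
    (hc₀ : √(asympVar m) < c₀) (hc₁ : c₀ < c₁) (hθ : 1 < θ) (x : ℝ) :
    ∀ᵐ s ∂pathMeasure ν, ∀ᶠ j : ℕ in atTop, ∀ k : ℕ, (k : ℝ) ≤ θ ^ j →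
      martPart ν f k x s < c₁ * lilScale (θ ^ j) := by
  set σ := asympVar m with hσ
  have hσ0 : 0 ≤ σ := h.asympVar_nonneg
  have hc₀pos : 0 < c₀ := (Real.sqrt_nonneg _).trans_lt hc₀
  have hε : 0 < c₀ ^ 2 - σ := by
    have := Real.lt_sq_of_sqrt_lt hc₀
    linarith
  obtain ⟨d, hd, hmgf⟩ := h.exists_integral_exp_martPart_le hε
  rw [add_sub_cancel] at hmgf
  have hθj : Tendsto (fun j : ℕ => θ ^ j) atTop atTop := tendsto_pow_atTop_atTop_of_one_lt hθ
  -- With t = θ^j and the parameter `c` below, the exponent of the bound is exactly `-p * log (log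
  -- t)`, so the probability is at most a constant times j^(-p).
  set p := 2 * (c₁ / c₀) - 1 with hp
  have hp1 : 1 < p := by
    have : 1 < c₁ / c₀ := (one_lt_div hc₀pos).2 hc₁
    linarith
  have hlogθ : 0 < Real.log θ := Real.log_pos hθ
  set A : ℕ → Set (ℕ → ℝ) := fun j =>
    reaches ν f ⌊θ ^ j⌋₊ x (c₁ * lilScale (θ ^ j)) with hA
  have hbound : ∀ᶠ j : ℕ in atTop,
      (pathMeasure ν).real (A j) ≤ 2 * Real.log θ ^ (-p) * (j : ℝ) ^ (-p) := by
    have hsmall : ∀ᶠ j : ℕ in atTop, lilScale (θ ^ j) / θ ^ j < c₀ * d :=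
      (tendsto_lilScale_div.comp hθj).eventually (gt_mem_nhds (by positivity))
    filter_upwards [hsmall, hθj.eventually_ge_atTop (Real.exp 1), eventually_gt_atTop 0]
      with j hj1 hj2 hj3
    set t := θ ^ j with ht
    have ht0 : 0 < t := (Real.exp_pos 1).trans_le hj2
    have hℓ := lilScale_nonneg t
    -- Up to the factor `c₁ / c₀`, the parameter minimising -c·c₁·ℓ + c²c₀²t/2, where ℓ = `lilScale
    -- t`.
    set c := lilScale t / (c₀ * t) with hc
    have hc0 : 0 ≤ c := by positivity
    have hcd : c ≤ d := by
      rw [hc, mul_comm, ← div_div, div_le_iff₀ hc₀pos]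
      linarith
    have h1 := h.measureReal_reaches_le hc0 ⌊t⌋₊ x (c₁ * lilScale t)
    refine h1.trans ?_
    have h2 := hmgf c hc0 hcd ⌊t⌋₊ x
    have hfl : (⌊t⌋₊ : ℝ) ≤ t := Nat.floor_le ht0.le
    have h3 : Real.exp (c ^ 2 * c₀ ^ 2 * ⌊t⌋₊ / 2) ≤ Real.exp (c ^ 2 * c₀ ^ 2 * t / 2) := by
      gcongr
    have hlogt : Real.log t = j * Real.log θ := by rw [ht, Real.log_pow]
    have hlogt0 : 0 < Real.log t := by
      rw [hlogt]
      have : (0 : ℝ) < j := by exact_mod_cast hj3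
      positivity
    calc _ ≤ Real.exp (-(c * (c₁ * lilScale t))) *
          (2 * Real.exp (c ^ 2 * c₀ ^ 2 * t / 2)) := by
          gcongr
          exact h2.trans (by gcongr)
      _ = 2 * Real.exp (-(c * (c₁ * lilScale t)) + c ^ 2 * c₀ ^ 2 * t / 2) := by
          rw [Real.exp_add]; ring
      _ = 2 * Real.exp (Real.log (Real.log t) * (-p)) := by
          congr 2
          have e1 : c * (c₁ * lilScale t) = c₁ / c₀ * (lilScale t ^ 2 / t) := by
            rw [hc]; field_simp
          have e2 : c ^ 2 * c₀ ^ 2 * t / 2 = lilScale t ^ 2 / t / 2 := by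
            rw [hc]; field_simp
          have e3 : lilScale t ^ 2 / t = 2 * Real.log (Real.log t) := by
            rw [lilScale_sq hj2]; field_simp
          rw [e1, e2, e3, hp]
          ring
      _ = 2 * Real.log θ ^ (-p) * (j : ℝ) ^ (-p) := by
          rw [← Real.rpow_def_of_pos hlogt0, hlogt, Real.mul_rpow (by positivity) hlogθ.le]
          ring
  have hsum : Summable fun j => (pathMeasure ν).real (A j) := by
    refine Summable.of_norm_bounded_eventually_nat
      (g := fun j : ℕ => 2 * Real.log θ ^ (-p) * (j : ℝ) ^ (-p)) ?_ ?_
    · exact (Real.summable_nat_rpow.2 (by linarith)).mul_left _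
    · filter_upwards [hbound] with j hj
      rwa [Real.norm_of_nonneg measureReal_nonneg]
  have htsum : ∑' j, pathMeasure ν (A j) ≠ ⊤ := by
    have : ∀ j, pathMeasure ν (A j) = ENNReal.ofReal ((pathMeasure ν).real (A j)) := fun j =>
      (ofReal_measureReal).symm
    simp only [this]
    exact hsum.tsum_ofReal_ne_top
  filter_upwards [ae_eventually_notMem htsum] with s hs
  filter_upwards [hs] with j hj k hk
  by_contra! hcon
  exact hj ⟨k, Nat.le_floor hk, hcon⟩

/-- One factor θ multiplies the square of the scale by θ, up to the iterated logarithm. That grows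
by at most log 2, which the gap κ²/θ - 1 > 0 eventually absorbs. -/
theorem eventually_lilScale_pow_succ_le {θ κ : ℝ} (hθ : 1 < θ) (hκ : √θ < κ) :
    ∀ᶠ j : ℕ in atTop, lilScale (θ ^ (j + 1)) ≤ κ * lilScale (θ ^ j) := by
  have hθj : Tendsto (fun j : ℕ => θ ^ j) atTop atTop := tendsto_pow_atTop_atTop_of_one_lt hθ
  have hκ2 : 0 < κ ^ 2 / θ - 1 := by
    have := Real.lt_sq_of_sqrt_lt hκ
    rw [sub_pos, one_lt_div (by linarith)]
    exact this
  have hκ0 : 0 ≤ κ := (Real.sqrt_nonneg _).trans hκ.le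
  filter_upwards [hθj.eventually_ge_atTop (Real.exp 1), eventually_gt_atTop 0,
    ((tendsto_log_log.comp hθj).const_mul_atTop hκ2).eventually_ge_atTop (Real.log 2)]
    with j hj1 hj2 hj3
  have hjr : (1 : ℝ) ≤ j := by exact_mod_cast hj2
  have ht0 : 0 < θ ^ j := (Real.exp_pos 1).trans_le hj1
  have hlogθ : 0 < Real.log θ := Real.log_pos hθ
  have h1 : Real.exp 1 ≤ θ ^ (j + 1) := hj1.trans (pow_le_pow_right₀ hθ.le (by omega))
  have h2 : Real.log (Real.log (θ ^ (j + 1))) ≤ Real.log 2 + Real.log (Real.log (θ ^ j)) := by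
    rw [← Real.log_mul two_ne_zero (by rw [Real.log_pow]; positivity)]
    refine Real.log_le_log (by rw [Real.log_pow]; positivity) ?_
    rw [Real.log_pow, Real.log_pow, ← mul_assoc]
    gcongr
    push_cast
    linarith
  dsimp only [Function.comp] at hj3
  have h3 : Real.log (Real.log (θ ^ (j + 1))) ≤ κ ^ 2 / θ * Real.log (Real.log (θ ^ j)) := by
    linarith
  refine (pow_le_pow_iff_left₀ (lilScale_nonneg _) (mul_nonneg hκ0 (lilScale_nonneg _))
    two_ne_zero).1 ?_
  rw [mul_pow, lilScale_sq h1, lilScale_sq hj1]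
  calc _ ≤ 2 * θ ^ (j + 1) * (κ ^ 2 / θ * Real.log (Real.log (θ ^ j))) := by gcongr
    _ = _ := by
      rw [pow_succ]
      field_simp

/-- The upper half of the law of the iterated logarithm. -/
theorem ae_eventually_orbitSum_le (h : IsMixing ν f K a m) {c : ℝ} (hc : √(asympVar m) < c)
    (x : ℝ) : ∀ᵐ s ∂pathMeasure ν, ∀ᶠ n : ℕ in atTop, orbitSum f n x s ≤ c * lilScale n := by
  obtain ⟨c₁, hc₁, hc₁c⟩ := exists_between hc
  obtain ⟨c₀, hc₀, hc₀₁⟩ := exists_between hc₁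
  have hc₁pos : 0 < c₁ := (Real.sqrt_nonneg _).trans_lt hc₁
  -- Passing from θ^j to θ^(j+1) costs the factor `κ`. Since `c₁ * κ < c`, the remaining multiple of
  -- the scale absorbs the bounded distance between orbit sum and martingale part.
  obtain ⟨κ, hκ1, hκ⟩ : ∃ κ, 1 < κ ∧ κ < c / c₁ := exists_between ((one_lt_div hc₁pos).2 hc₁c)
  obtain ⟨θ, hθ, hθκ⟩ : ∃ θ, 1 < θ ∧ √θ < κ := by
    obtain ⟨u, hu1, hu2⟩ := exists_between hκ1
    exact ⟨u ^ 2, one_lt_pow₀ hu1 two_ne_zero, by rwa [Real.sqrt_sq (by linarith)]⟩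
  have hcκ : 0 < c - c₁ * κ := by
    rw [lt_div_iff₀ hc₁pos] at hκ
    linarith
  have hθj : Tendsto (fun j : ℕ => θ ^ j) atTop atTop := tendsto_pow_atTop_atTop_of_one_lt hθ
  filter_upwards [h.ae_eventually_martPart_lt hc₀ hc₀₁ hθ x] with s hs
  have hbig : ∀ᶠ j : ℕ in atTop, 2 * ∑' k, a (k + 1) ≤ (c - c₁ * κ) * lilScale (θ ^ j) :=
    ((tendsto_lilScale.comp hθj).const_mul_atTop hcκ).eventually_ge_atTop _
  obtain ⟨J, hJ⟩ := eventually_atTop.1 ((((tendsto_add_atTop_nat 1).eventually hs).and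
    (eventually_lilScale_pow_succ_le hθ hθκ)).and
    (hbig.and (hθj.eventually_ge_atTop (Real.exp 1))))
  filter_upwards [tendsto_natCast_atTop_atTop.eventually_ge_atTop (θ ^ J)] with n hn
  have hn1 : (1 : ℝ) ≤ n := (one_le_pow₀ hθ.le).trans hn
  obtain ⟨j, hj1, hj2⟩ := exists_nat_pow_near hn1 hθ
  have hJj : J ≤ j := by
    have := (pow_lt_pow_iff_right₀ hθ).1 (hn.trans_lt hj2)
    omega
  obtain ⟨⟨h1, h2⟩, h3, h4⟩ := hJ j hJj
  have h5 := h1 n hj2.le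
  have h6 := (abs_le.1 (h.abs_martPart_sub_le n x s)).1
  have h7 := lilScale_mono h4 hj1
  have hc0 : 0 ≤ c := by linarith
  calc orbitSum f n x s ≤ c₁ * lilScale (θ ^ (j + 1)) + 2 * ∑' k, a (k + 1) := by linarith
    _ ≤ c₁ * (κ * lilScale (θ ^ j)) + (c - c₁ * κ) * lilScale (θ ^ j) := by gcongr
    _ = c * lilScale (θ ^ j) := by ring
    _ ≤ c * lilScale n := by gcongr

end IsMixing

end

/-! ### The lower half of the iterated logarithm law -/

section

/-- A lower bound for Gaussian tails. -/
theorem exists_exp_lt_gaussianReal_Ioi {v : NNReal} (hv : v ≠ 0) {κ : ℝ}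
    (hκ : 1 / (2 * (v : ℝ)) < κ) :
    ∃ u > 0, ENNReal.ofReal (Real.exp (-(κ * u ^ 2))) < gaussianReal 0 v (Set.Ioi u) := by
  have hv0 : (0 : ℝ) < v := by positivity
  set A := (√(2 * Real.pi * v))⁻¹ with hA
  have hA0 : 0 < A := by positivity
  have hlim : Tendsto (fun u : ℝ => u * ((κ - 1 / (2 * v)) * u - 1 / v)) atTop atTop :=
    tendsto_id.atTop_mul_atTop₀
      (tendsto_atTop_add_const_right _ _ (tendsto_id.const_mul_atTop (sub_pos.2 hκ)))
  obtain ⟨u, hu0, hu⟩ := ((eventually_gt_atTop 0).and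
    (hlim.eventually_gt_atTop (1 / (2 * v) - Real.log A))).exists
  refine ⟨u, hu0, ?_⟩
  have h1 : Real.exp (-(κ * u ^ 2)) < A * Real.exp (-(u + 1) ^ 2 / (2 * v)) := by
    conv_rhs => rw [← Real.exp_log hA0]
    rw [← Real.exp_add, Real.exp_lt_exp]
    have : u * ((κ - 1 / (2 * v)) * u - 1 / v) =
        κ * u ^ 2 + -(u + 1) ^ 2 / (2 * v) + 1 / (2 * v) := by
      field_simp
      ring
    linarith
  calc _ < ENNReal.ofReal (A * Real.exp (-(u + 1) ^ 2 / (2 * v))) :=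
        (ENNReal.ofReal_lt_ofReal_iff (by positivity)).2 h1
    _ = ∫⁻ _ in Set.Ioc u (u + 1), ENNReal.ofReal (A * Real.exp (-(u + 1) ^ 2 / (2 * v))) := by
        simp
    _ ≤ ∫⁻ y in Set.Ioc u (u + 1), gaussianPDF 0 v y := by
        refine setLIntegral_mono (measurable_gaussianPDF 0 v) fun y hy => ?_
        unfold gaussianPDF gaussianPDFReal
        gcongr ENNReal.ofReal (_ * Real.exp (-?_ / _))
        rw [sub_zero]
        have := hy.1
        exact pow_le_pow_left₀ (by linarith) hy.2 2
    _ ≤ ∫⁻ y in Set.Ioi u, gaussianPDF 0 v y := lintegral_mono_set Set.Ioc_subset_Ioi_self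
    _ = _ := (gaussianReal_apply 0 hv _).symm

theorem measure_splice (ν : Measure ℝ) [IsProbabilityMeasure ν] (n : ℕ) {A : Set (ℕ → ℝ)}
    (hA : MeasurableSet A) :
    pathMeasure ν A = ∫⁻ s, pathMeasure ν {s' | splice n (s, s') ∈ A} ∂pathMeasure ν := by
  have hp := measurePreserving_splice ν n
  rw [← hp.measure_preimage hA.nullMeasurableSet, Measure.prod_apply (hp.measurable hA)]
  rfl

namespace IsMixing

variable {ν : Measure ℝ} [IsProbabilityMeasure ν] {f : ℝ → ℝ} {K : ℝ} {a m : ℕ → ℝ}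

/-- The lower bound from the central limit theorem, uniformly in the starting point. -/
theorem exists_le_measure_orbitSum (h : IsMixing ν f K a m) {u : ℝ} {p : ENNReal}
    (hp : p < gaussianReal 0 (asympVar m).toNNReal (Set.Ioi u)) :
    ∃ n₀ : ℕ, ∀ n ≥ n₀, ∀ x, p ≤ pathMeasure ν {s | u * √(n : ℝ) ≤ orbitSum f n x s} := by
  by_contra! hcon
  -- For each `n` a bad starting point is chosen whenever one exists. The central limit theorem
  -- along these varying starts, with the portmanteau bound for open sets, then contradicts badness.
  have hchoice : ∀ n : ℕ, ∃ x, (∃ y, pathMeasure ν {s | u * √(n : ℝ) ≤ orbitSum f n y s} < p) →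
      pathMeasure ν {s | u * √(n : ℝ) ≤ orbitSum f n x s} < p := by
    intro n
    by_cases hy : ∃ y, pathMeasure ν {s | u * √(n : ℝ) ≤ orbitSum f n y s} < p
    · exact ⟨hy.choose, fun _ => hy.choose_spec⟩
    · exact ⟨0, fun h => absurd h hy⟩
  choose x hx using hchoice
  have hlim := (h.tendstoInDistribution x).tendsto
  have hopen := ProbabilityMeasure.le_liminf_measure_open_of_tendsto hlim (isOpen_Ioi (a := u))
  simp only [ProbabilityMeasure.coe_mk, Measure.map_id] at hopen
  have hev := eventually_lt_of_lt_liminf (hp.trans_le hopen)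
  obtain ⟨N, hN⟩ := eventually_atTop.1 (hev.and (eventually_gt_atTop 0))
  obtain ⟨n, hn, y, hy⟩ := hcon N
  obtain ⟨h1, h2⟩ := hN n hn
  have hm := h.measurable_orbitSum_right n (x n)
  rw [Measure.map_apply (by fun_prop) measurableSet_Ioi] at h1
  refine absurd (h1.trans_le (measure_mono fun s hs => ?_)) (not_lt.2 (hx n ⟨y, hy⟩).le)
  have hs' : u < orbitSum f n (x n) s / √(n : ℝ) := hs
  have hsn : 0 < √(n : ℝ) := Real.sqrt_pos.2 (by exact_mod_cast h2)
  rw [lt_div_iff₀ hsn] at hs'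
  exact hs'.le

theorem measurableSet_le_orbitSum (h : IsMixing ν f K a m) (w : ℝ) (n : ℕ) (x : ℝ) :
    MeasurableSet {s | w ≤ orbitSum f n x s} :=
  measurableSet_le measurable_const (h.measurable_orbitSum_right n x)

/-- Requires the gain `w` in each of `r` consecutive blocks; uniformity in the start lets the
probabilities multiply. This turns the central limit theorem at a fixed level into a moderate
deviation bound. -/
theorem pow_le_measure_orbitSum_mul (h : IsMixing ν f K a m) {n : ℕ} {w : ℝ} {p : ENNReal}
    (hp : ∀ x, p ≤ pathMeasure ν {s | w ≤ orbitSum f n x s}) (r : ℕ) (x : ℝ) :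
    p ^ r ≤ pathMeasure ν {s | r * w ≤ orbitSum f (n * r) x s} := by
  induction r generalizing x with
  | zero => simp
  | succ r ih =>
    rw [measure_splice ν n (h.measurableSet_le_orbitSum _ _ _)]
    have hm := h.measurableSet_le_orbitSum w n x
    calc p ^ (r + 1) = p ^ r * p := pow_succ _ _
      _ ≤ p ^ r * pathMeasure ν {s | w ≤ orbitSum f n x s} := by gcongr; exact hp x
      _ = ∫⁻ s in {s | w ≤ orbitSum f n x s}, p ^ r ∂pathMeasure ν := by simp
      _ ≤ ∫⁻ s in {s | w ≤ orbitSum f n x s}, pathMeasure ν {s' | splice n (s, s') ∈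
            {s | ((r + 1 : ℕ) : ℝ) * w ≤ orbitSum f (n * (r + 1)) x s}} ∂pathMeasure ν := by
          refine setLIntegral_mono' hm fun s hs => (ih (x + walk n s)).trans ?_
          refine measure_mono fun s' hs' => ?_
          have e1 : w ≤ orbitSum f n x s := hs
          have e2 : r * w ≤ orbitSum f (n * r) (x + walk n s) s' := hs'
          change ((r + 1 : ℕ) : ℝ) * w ≤ orbitSum f (n * (r + 1)) x (splice n (s, s'))
          rw [show n * (r + 1) = n + n * r by ring, orbitSum_splice_add]
          push_cast
          linarith
      _ ≤ _ := setLIntegral_le_lintegral _ _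

/-- The second Borel–Cantelli lemma for the increments of `orbitSum` over consecutive blocks. -/
theorem ae_frequently_le_orbitSum_sub (h : IsMixing ν f K a m) {N b : ℕ → ℕ}
    (hN : ∀ j, N (j + 1) = N j + b j) {w p : ℕ → ℝ} (hp0 : ∀ j, 0 ≤ p j) (hps : ¬ Summable p)
    (hp : ∀ j y, ENNReal.ofReal (p j) ≤ pathMeasure ν {s | w j ≤ orbitSum f (b j) y s}) (x : ℝ) :
    ∀ᵐ s ∂pathMeasure ν, ∃ᶠ j in atTop,
      w j ≤ orbitSum f (N (j + 1)) x s - orbitSum f (N j) x s := by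
  have hNmono : Monotone N := monotone_nat_of_le_succ fun j => by rw [hN]; omega
  -- The event that none of the `k` blocks from index `i` on succeeds.
  set F : ℕ → ℕ → Set (ℕ → ℝ) := fun i k =>
    {s | ∀ j, i ≤ j → j < i + k → ¬ w j ≤ orbitSum f (N (j + 1)) x s - orbitSum f (N j) x s}
    with hF
  have hFm : ∀ i k, MeasurableSet (F i k) := by
    intro i k
    have : F i k = ⋂ j ∈ Finset.Ico i (i + k),
        {s | w j ≤ orbitSum f (N (j + 1)) x s - orbitSum f (N j) x s}ᶜ := by
      ext s
      simp [hF]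
    rw [this]
    refine Finset.measurableSet_biInter _ fun j _ => MeasurableSet.compl ?_
    have h1 := h.measurable_orbitSum_right (N (j + 1)) x
    have h2 := h.measurable_orbitSum_right (N j) x
    exact measurableSet_le measurable_const (h1.sub h2)
  have hbound : ∀ i k, pathMeasure ν (F i k) ≤
      ENNReal.ofReal (Real.exp (-∑ j ∈ Finset.range k, p (i + j))) := by
    intro i k
    induction k with
    | zero => simpa using prob_le_one
    | succ k ih =>
      rw [measure_splice ν (N (i + k)) (hFm _ _)]
      -- Given the past, the next block fails with probability at most 1 - p ≤ exp(-p), wherever it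
      -- starts. A past outside `F i k` contributes nothing.
      have hsub : ∀ s, pathMeasure ν {s' | splice (N (i + k)) (s, s') ∈ F i (k + 1)} ≤
          (F i k).indicator (fun _ => ENNReal.ofReal (Real.exp (-p (i + k)))) s := by
        intro s
        by_cases hs : s ∈ F i k
        · rw [Set.indicator_of_mem hs]
          calc _ ≤ pathMeasure ν {s' | w (i + k) ≤
                orbitSum f (b (i + k)) (x + walk (N (i + k)) s) s'}ᶜ := by
                refine measure_mono fun s' hs' hcon => ?_
                refine hs' (i + k) (by omega) (by omega) ?_
                rw [hN, orbitSum_splice_add, orbitSum_splice_of_le f le_rfl, add_sub_cancel_left]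
                exact hcon
            _ = 1 - pathMeasure ν {s' | w (i + k) ≤
                orbitSum f (b (i + k)) (x + walk (N (i + k)) s) s'} :=
                prob_compl_eq_one_sub (h.measurableSet_le_orbitSum _ _ _)
            _ ≤ 1 - ENNReal.ofReal (p (i + k)) := by gcongr; exact hp _ _
            _ = ENNReal.ofReal (1 - p (i + k)) := by
                rw [ENNReal.ofReal_sub _ (hp0 _), ENNReal.ofReal_one]
            _ ≤ _ := by
                gcongr
                linarith [Real.add_one_le_exp (-p (i + k))]
        · rw [Set.indicator_of_notMem hs, nonpos_iff_eq_zero]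
          convert measure_empty (μ := pathMeasure ν)
          ext s'
          simp only [Set.mem_empty_iff_false, iff_false]
          intro hs'
          refine hs fun j hj1 hj2 => ?_
          have h1 : N (j + 1) ≤ N (i + k) := hNmono (by omega)
          have h2 : N j ≤ N (i + k) := hNmono (by omega)
          have h3 := hs' j hj1 (by omega)
          rwa [orbitSum_splice_of_le f h1, orbitSum_splice_of_le f h2] at h3
      refine (lintegral_mono hsub).trans ?_
      rw [lintegral_indicator_const (hFm i k), Finset.sum_range_succ, neg_add, Real.exp_add,
        mul_comm, ENNReal.ofReal_mul (Real.exp_pos _).le]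
      gcongr
  have hnull : ∀ i, pathMeasure ν (⋂ k, F i k) = 0 := by
    intro i
    have hdiv : Tendsto (fun k => ∑ j ∈ Finset.range k, p (i + j)) atTop atTop := by
      refine (not_summable_iff_tendsto_nat_atTop_of_nonneg fun j => hp0 _).1 ?_
      intro hsum
      refine hps ((summable_nat_add_iff i).1 ?_)
      simpa [add_comm] using hsum
    have hlim : Tendsto (fun k => ENNReal.ofReal (Real.exp (-∑ j ∈ Finset.range k, p (i + j))))
        atTop (𝓝 (ENNReal.ofReal 0)) :=
      ENNReal.tendsto_ofReal (Real.tendsto_exp_neg_atTop_nhds_zero.comp hdiv)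
    rw [ENNReal.ofReal_zero] at hlim
    refine le_antisymm (ge_of_tendsto' hlim fun k => ?_) zero_le
    exact (measure_mono (Set.iInter_subset _ k)).trans (hbound i k)
  have hae : ∀ᵐ s ∂pathMeasure ν, ∀ i, s ∉ ⋂ k, F i k :=
    ae_all_iff.2 fun i => measure_eq_zero_iff_ae_notMem.1 (hnull i)
  filter_upwards [hae] with s hs
  rw [frequently_atTop]
  intro i
  by_contra! hcon
  refine hs i (Set.mem_iInter.2 fun k j hj1 _ => ?_)
  exact not_le.2 (hcon j hj1)

theorem neg (h : IsMixing ν f K a m) : IsMixing ν (fun x => -f x) K a m := by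
  have hneg : ∀ k x, walkOp ν k (fun x => -f x) x = -walkOp ν k f x := fun k x => by
    simp only [walkOp, integral_neg]
  refine ⟨h.measurable.neg, fun x => by simpa using h.bound x, h.summable, fun k x => ?_,
    fun i d x => ?_⟩
  · rw [hneg, abs_neg]; exact h.decay k x
  · simp only [hneg, neg_mul_neg]; exact h.corr i d x

theorem ae_eventually_le_orbitSum (h : IsMixing ν f K a m) {c : ℝ} (hc : √(asympVar m) < c)
    (x : ℝ) : ∀ᵐ s ∂pathMeasure ν, ∀ᶠ n : ℕ in atTop, -(c * lilScale n) ≤ orbitSum f n x s := by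
  filter_upwards [h.neg.ae_eventually_orbitSum_le hc x] with s hs
  filter_upwards [hs] with n hn
  have : orbitSum (fun x => -f x) n x s = -orbitSum f n x s := by simp [orbitSum]
  rw [this] at hn
  linarith

/-- The constant `A` only adds `log A`, which any factor `e > 1` eventually outweighs. -/
theorem eventually_log_log_le {M : ℕ → ℕ} {A e : ℝ} (he : 1 < e) (hA : 0 < A)
    (hM : Tendsto M atTop atTop) (hle : ∀ j, Real.log (M j) ≤ A * (j + 1)) :
    ∀ᶠ j : ℕ in atTop, Real.log (Real.log (M j)) ≤ e * Real.log (j + 1) := by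
  have h1 : Tendsto (fun j : ℕ => (e - 1) * Real.log ((j : ℝ) + 1)) atTop atTop :=
    (Real.tendsto_log_atTop.comp (tendsto_atTop_add_const_right _ _
      tendsto_natCast_atTop_atTop)).const_mul_atTop (sub_pos.2 he)
  filter_upwards [hM.eventually_ge_atTop 2, h1.eventually_ge_atTop (Real.log A)] with j hj1 hj2
  have hMj : (1 : ℝ) < M j := by exact_mod_cast hj1
  calc Real.log (Real.log (M j)) ≤ Real.log (A * (j + 1)) :=
        Real.log_le_log (Real.log_pos hMj) (hle j)
    _ = Real.log A + Real.log (j + 1) := Real.log_mul hA.ne' (by positivity)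
    _ ≤ _ := by linarith

-- Infinitely many long blocks gain nearly the extremal amount. The upper half for -f prevents the
-- sum at the start of such a block from being too negative, and rapidly growing block lengths make
-- that possible loss small against the gain.
set_option maxHeartbeats 800000 in
theorem ae_frequently_le_orbitSum_of_pos (h : IsMixing ν f K a m) {c : ℝ} (hc0 : 0 < c)
    (hc : c < √(asympVar m)) (x : ℝ) :
    ∀ᵐ s ∂pathMeasure ν, ∃ᶠ n : ℕ in atTop, c * lilScale n ≤ orbitSum f n x s := by
  set v := asympVar m with hv
  have hv0 : 0 < v := Real.sqrt_pos.1 (hc0.trans hc)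
  obtain ⟨c₂, hcc₂, hc₂⟩ := exists_between hc
  have hc₂0 : 0 < c₂ := hc0.trans hcc₂
  have hc₂v : c₂ ^ 2 < v := (Real.lt_sqrt hc₂0.le).1 hc₂
  obtain ⟨κ, hκ1, hκ2⟩ : ∃ κ, 1 / (2 * v) < κ ∧ κ < 1 / (2 * c₂ ^ 2) :=
    exists_between (one_div_lt_one_div_of_lt (by positivity) (by linarith))
  have hκ0 : 0 < κ := lt_trans (by positivity) hκ1
  have hκc : 2 * κ * c₂ ^ 2 < 1 := by
    rw [lt_div_iff₀ (by positivity)] at hκ2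
    linarith
  obtain ⟨e, he1, he2⟩ : ∃ e, 1 < e ∧ e < 1 / (2 * κ * c₂ ^ 2) :=
    exists_between ((one_lt_div (by positivity)).2 hκc)
  have heκ : 2 * κ * e * c₂ ^ 2 < 1 := by
    rw [lt_div_iff₀ (by positivity)] at he2
    linarith
  set c' := √v + 1 with hc'
  have hc'0 : 0 < c' := by positivity
  -- The growth ratio of the blocks. The first inequality pays for replacing the block length by the
  -- whole time N(j+1) ≤ q·b(j)/(q-1); the second makes the loss inherited from N(j) ≤ N(j+1)/q fit
  -- into the gap between `c` and `c₂`.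
  obtain ⟨q, hq2, hq3, hq4⟩ : ∃ q : ℕ, 2 ≤ q ∧ 2 * κ * e * c₂ ^ 2 * q ≤ q - 1 ∧
      c' ^ 2 ≤ (c₂ - c) ^ 2 * q := by
    have t1 : Tendsto (fun q : ℕ => (1 - 2 * κ * e * c₂ ^ 2) * (q : ℝ)) atTop atTop :=
      tendsto_natCast_atTop_atTop.const_mul_atTop (by linarith)
    have t2 : Tendsto (fun q : ℕ => (c₂ - c) ^ 2 * (q : ℝ)) atTop atTop :=
      tendsto_natCast_atTop_atTop.const_mul_atTop (pow_pos (sub_pos.2 hcc₂) 2)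
    obtain ⟨q, h1, h2, h3⟩ := ((eventually_ge_atTop 2).and ((t1.eventually_ge_atTop 1).and
      (t2.eventually_ge_atTop (c' ^ 2)))).exists
    exact ⟨q, h1, by linarith, h3⟩
  have hqr : (2 : ℝ) ≤ q := by exact_mod_cast hq2
  obtain ⟨u, hu0, hu⟩ := exists_exp_lt_gaussianReal_Ioi (v := v.toNNReal) (κ := κ)
    (by simpa using hv0) (by rwa [Real.coe_toNNReal _ hv0.le])
  obtain ⟨n₀, hn₀⟩ := h.exists_le_measure_orbitSum hu
  have hκu : 0 < κ * u ^ 2 := by positivity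
  -- the lengths of the blocks
  set ρ := 1 / (κ * u ^ 2) with hρ
  have hρ0 : 0 < ρ := by positivity
  set L : ℕ → ℕ := fun j => (n₀ + 1) * q ^ j with hL
  -- With ρ = 1/(κu²), `r j` repetitions succeed with probability at least a constant times 1/(j+1),
  -- just enough for divergence. The `+ 1` keeps the block non-empty at `j = 0`.
  set r : ℕ → ℕ := fun j => ⌈ρ * Real.log (j + 1)⌉₊ + 1 with hr
  set b : ℕ → ℕ := fun j => L j * r j with hb
  set N : ℕ → ℕ := fun j => ∑ i ∈ Finset.range j, b i with hN
  have hNs : ∀ j, N (j + 1) = N j + b j := fun j => Finset.sum_range_succ _ _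
  have hlog0 : ∀ j : ℕ, 0 ≤ Real.log ((j : ℝ) + 1) := fun j => Real.log_nonneg (by
    have : (0 : ℝ) ≤ j := by positivity
    linarith)
  have hr1 : ∀ j : ℕ, ρ * Real.log (j + 1) ≤ r j := fun j => by
    have := Nat.le_ceil (ρ * Real.log (j + 1))
    simp only [hr]
    push_cast
    linarith
  have hr2 : ∀ j : ℕ, (r j : ℝ) ≤ ρ * Real.log (j + 1) + 2 := fun j => by
    have := (Nat.ceil_lt_add_one (mul_nonneg hρ0.le (hlog0 j))).le
    simp only [hr]
    push_cast
    linarith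
  have hrmono : ∀ j, r j ≤ r (j + 1) := fun j => by
    simp only [hr]
    gcongr
    omega
  have hLpos : ∀ j, 0 < L j := fun j => by
    simp only [hL]
    positivity
  have hbpos : ∀ j, 0 < b j := fun j => Nat.mul_pos (hLpos j) (Nat.succ_pos _)
  have hLn₀ : ∀ j, n₀ ≤ L j := fun j => by
    have : 1 ≤ q ^ j := Nat.one_le_pow _ _ (by omega)
    simp only [hL]
    nlinarith
  have hNmono : StrictMono N := strictMono_nat_of_lt_succ fun j => by
    have := hbpos j
    rw [hNs]
    omega
  have hNtop : Tendsto N atTop atTop := hNmono.tendsto_atTop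
  have hNtop' : Tendsto (fun j => N (j + 1)) atTop atTop :=
    hNtop.comp (tendsto_add_atTop_nat 1)
  have hNb : ∀ j, ((q : ℝ) - 1) * N j ≤ b j := by
    intro j
    induction j with
    | zero => simp [hN]
    | succ j ih =>
      have h1 : q * b j ≤ b (j + 1) := by
        simp only [hb, hL]
        calc q * ((n₀ + 1) * q ^ j * r j) = (n₀ + 1) * q ^ (j + 1) * r j := by ring
          _ ≤ _ := Nat.mul_le_mul_left _ (hrmono j)
      have h2 : (q : ℝ) * b j ≤ b (j + 1) := by exact_mod_cast h1
      rw [hNs]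
      push_cast
      linarith
  have hNs' : ∀ j, (N (j + 1) : ℝ) = N j + b j := fun j => by rw [hNs]; push_cast; rfl
  have hNle : ∀ j, ((q : ℝ) - 1) * N (j + 1) ≤ q * b j := fun j => by
    rw [hNs']
    linarith [hNb j]
  have hNge : ∀ j, (q : ℝ) * N j ≤ N (j + 1) := fun j => by
    rw [hNs']
    linarith [hNb j]
  -- the gains over the blocks
  set w : ℕ → ℝ := fun j => r j * (u * √(L j : ℝ)) with hw
  set p : ℕ → ℝ := fun j => Real.exp (-(κ * u ^ 2)) ^ r j with hp
  have hpq : ∀ j y, ENNReal.ofReal (p j) ≤ pathMeasure ν {s | w j ≤ orbitSum f (b j) y s} := by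
    intro j y
    rw [hp, ENNReal.ofReal_pow (Real.exp_pos _).le]
    exact h.pow_le_measure_orbitSum_mul (hn₀ (L j) (hLn₀ j)) (r j) y
  have hps : ¬ Summable p := by
    intro hsum
    have h1 : ∀ j : ℕ, Real.exp (-(2 * (κ * u ^ 2))) * (1 / ((j + 1 : ℕ) : ℝ)) ≤ p j := by
      intro j
      have hj : (0 : ℝ) < (j : ℝ) + 1 := by positivity
      have h2 : κ * u ^ 2 * (r j : ℝ) ≤ Real.log (j + 1) + 2 * (κ * u ^ 2) := by
        calc κ * u ^ 2 * (r j : ℝ) ≤ κ * u ^ 2 * (ρ * Real.log (j + 1) + 2) := by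
              gcongr
              exact hr2 j
          _ = _ := by
              rw [hρ]
              field_simp
      have h3 : p j = Real.exp (-(κ * u ^ 2 * (r j : ℝ))) := by
        simp only [hp]
        rw [← Real.exp_nat_mul]
        congr 1
        ring
      have h4 : (1 : ℝ) / ((j + 1 : ℕ) : ℝ) = Real.exp (-Real.log (j + 1)) := by
        rw [Real.exp_neg, Real.exp_log hj]
        push_cast
        rw [one_div]
      rw [h3, h4, ← Real.exp_add, Real.exp_le_exp]
      linarith
    have h2 : Summable fun j : ℕ => Real.exp (-(2 * (κ * u ^ 2))) * (1 / ((j + 1 : ℕ) : ℝ)) :=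
      .of_nonneg_of_le (fun j => by positivity) h1 hsum
    rw [summable_mul_left_iff (Real.exp_pos _).ne'] at h2
    exact Real.not_summable_one_div_natCast
      ((summable_nat_add_iff (f := fun j : ℕ => 1 / (j : ℝ)) 1).1 h2)
  have hlogN : ∀ j : ℕ, Real.log (N (j + 1)) ≤
      (Real.log (2 * (n₀ + 1)) + Real.log q + ρ + 2) * (j + 1) := by
    intro j
    have hj : (0 : ℝ) ≤ j := by positivity
    have hrp : (0 : ℝ) < r j := by exact_mod_cast Nat.succ_pos _
    have hN0 : (0 : ℝ) < N (j + 1) := by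
      have : 0 < N (j + 1) := by
        rw [hNs]
        have := hbpos j
        omega
      exact_mod_cast this
    have h1 : (N (j + 1) : ℝ) ≤ 2 * (n₀ + 1) * q ^ j * r j := by
      have h2 : (N j : ℝ) ≤ b j := by
        have h3 : (0 : ℝ) ≤ N j := by positivity
        nlinarith [hNb j]
      have h4 : (b j : ℝ) = (n₀ + 1) * q ^ j * r j := by
        simp only [hb, hL]
        push_cast
        ring
      rw [hNs']
      linarith
    have h2 := Real.log_le_log hN0 h1
    rw [Real.log_mul (by positivity) hrp.ne', Real.log_mul (by positivity) (by positivity),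
      Real.log_pow] at h2
    have h3 : Real.log (r j) ≤ ρ * (j + 1) + 2 := by
      have e1 := Real.log_le_self hrp.le
      have e2 := hr2 j
      have e3 : Real.log ((j : ℝ) + 1) ≤ (j : ℝ) + 1 := Real.log_le_self (by positivity)
      have e4 := mul_le_mul_of_nonneg_left e3 hρ0.le
      linarith
    have h4 : 0 ≤ Real.log (2 * ((n₀ : ℝ) + 1)) := Real.log_nonneg (by
      have : (0 : ℝ) ≤ n₀ := by positivity
      linarith)
    have h5 : 0 ≤ Real.log (q : ℝ) := Real.log_nonneg (by linarith)
    have h6 : 0 ≤ Real.log (2 * ((n₀ : ℝ) + 1)) * j := mul_nonneg h4 hj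
    linarith
  have hloglog := eventually_log_log_le (M := fun j => N (j + 1)) he1 (by
    have h4 : 0 ≤ Real.log (2 * ((n₀ : ℝ) + 1)) := Real.log_nonneg (by
      have : (0 : ℝ) ≤ n₀ := by positivity
      linarith)
    have h5 : 0 ≤ Real.log (q : ℝ) := Real.log_nonneg (by linarith)
    positivity) hNtop' hlogN
  have hNe : ∀ᶠ j in atTop, Real.exp 1 ≤ (N j : ℝ) :=
    (tendsto_natCast_atTop_atTop.comp hNtop).eventually_ge_atTop _
  have hgain : ∀ᶠ j in atTop, c₂ * lilScale (N (j + 1)) ≤ w j := by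
    filter_upwards [hloglog, hNe] with j hj1 hj2
    have hj3 : Real.exp 1 ≤ (N (j + 1) : ℝ) :=
      hj2.trans (by exact_mod_cast hNmono.monotone (Nat.le_succ j))
    have hw0 : 0 ≤ w j := by positivity
    refine (pow_le_pow_iff_left₀ (mul_nonneg hc₂0.le (lilScale_nonneg _)) hw0 two_ne_zero).1 ?_
    -- As `b j = L j * r j`, the squared gain per unit of time is u²·r(j) ≥ log(j+1)/κ, and 1/κ is
    -- close to 2v.
    have hw2 : w j ^ 2 = u ^ 2 * r j * b j := by
      simp only [hw, hb, mul_pow, Real.sq_sqrt (Nat.cast_nonneg (L j))]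
      push_cast
      ring
    rw [mul_pow, lilScale_sq hj3, hw2]
    have hl := hlog0 j
    have hq1 : (0 : ℝ) < q - 1 := by linarith
    have h1 : b j * Real.log (j + 1) / κ ≤ u ^ 2 * r j * b j := by
      calc (b j : ℝ) * Real.log (j + 1) / κ = u ^ 2 * (ρ * Real.log (j + 1)) * b j := by
            rw [hρ]
            field_simp
        _ ≤ _ := by
            gcongr
            exact hr1 j
    refine le_trans ?_ h1
    have h2 : (N (j + 1) : ℝ) ≤ q * b j / (q - 1) := by
      rw [le_div_iff₀ hq1]
      linarith [hNle j]
    calc c₂ ^ 2 * (2 * (N (j + 1) : ℝ) * Real.log (Real.log (N (j + 1))))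
        ≤ c₂ ^ 2 * (2 * (N (j + 1) : ℝ) * (e * Real.log (j + 1))) := by gcongr
      _ ≤ c₂ ^ 2 * (2 * (q * b j / (q - 1)) * (e * Real.log (j + 1))) := by gcongr
      _ = (2 * κ * e * c₂ ^ 2 * q) * (b j * Real.log (j + 1) / κ / (q - 1)) := by
          field_simp
      _ ≤ (q - 1) * (b j * Real.log (j + 1) / κ / (q - 1)) := by gcongr
      _ = _ := by field_simp
  have hloss : ∀ᶠ j in atTop, c' * lilScale (N j) ≤ (c₂ - c) * lilScale (N (j + 1)) := by
    filter_upwards [hNe] with j hj2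
    have hNle' : (N j : ℝ) ≤ N (j + 1) := by exact_mod_cast hNmono.monotone (Nat.le_succ j)
    have hj3 := hj2.trans hNle'
    have hcc : 0 < c₂ - c := sub_pos.2 hcc₂
    refine (pow_le_pow_iff_left₀ (mul_nonneg hc'0.le (lilScale_nonneg _))
      (mul_nonneg hcc.le (lilScale_nonneg _)) two_ne_zero).1 ?_
    have hl := log_log_nonneg hj2
    have hll : Real.log (Real.log (N j)) ≤ Real.log (Real.log (N (j + 1))) := by
      have h0 := (Real.exp_pos 1).trans_le hj2
      have h1 : 1 ≤ Real.log (N j) := by rwa [Real.le_log_iff_exp_le h0]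
      gcongr
    rw [mul_pow, mul_pow, lilScale_sq hj2, lilScale_sq hj3]
    calc c' ^ 2 * (2 * (N j : ℝ) * Real.log (Real.log (N j)))
        ≤ ((c₂ - c) ^ 2 * q) * (2 * (N j : ℝ) * Real.log (Real.log (N j))) := by gcongr
      _ = (c₂ - c) ^ 2 * (2 * (q * (N j : ℝ)) * Real.log (Real.log (N j))) := by ring
      _ ≤ (c₂ - c) ^ 2 * (2 * (N (j + 1) : ℝ) * Real.log (Real.log (N (j + 1)))) := by
          have := hNge j
          gcongr
  filter_upwards [h.ae_frequently_le_orbitSum_sub hNs (fun j => by positivity) hps hpq x,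
    h.ae_eventually_le_orbitSum (c := c') (by linarith) x] with s hs1 hs2
  have hfreq : ∃ᶠ j in atTop, c * lilScale (N (j + 1)) ≤ orbitSum f (N (j + 1)) x s := by
    refine (hs1.and_eventually ((hNtop.eventually hs2).and (hgain.and hloss))).mono ?_
    rintro j ⟨h1, h2, h3, h4⟩
    linarith
  exact hNtop'.frequently hfreq

theorem ae_frequently_le_orbitSum (h : IsMixing ν f K a m) {c : ℝ} (hc : c < √(asympVar m))
    (x : ℝ) : ∀ᵐ s ∂pathMeasure ν, ∃ᶠ n : ℕ in atTop, c * lilScale n ≤ orbitSum f n x s := by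
  rcases (Real.sqrt_nonneg (asympVar m)).eq_or_lt with h0 | h0
  · rw [← h0] at hc
    -- With zero variance `c` is negative, so the upper half for -f with constant `-c > 0` already
    -- gives the bound for all large times.
    filter_upwards [h.ae_eventually_le_orbitSum (c := -c) (by rw [← h0]; linarith) x] with s hs
    refine Eventually.frequently (hs.mono fun n hn => ?_)
    linarith
  · obtain ⟨c₂, h1, h2⟩ := exists_between (max_lt hc h0)
    filter_upwards [h.ae_frequently_le_orbitSum_of_pos ((le_max_right _ _).trans_lt h1) h2 x]
      with s hs
    refine hs.mono fun n hn => le_trans ?_ hn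
    have : c ≤ c₂ := (le_max_left _ _).trans h1.le
    exact mul_le_mul_of_nonneg_right this (lilScale_nonneg _)

/-- The law of the iterated logarithm. -/
theorem ae_limsup_eq (h : IsMixing ν f K a m) (x : ℝ) : ∀ᵐ s ∂pathMeasure ν,
    limsup (fun n : ℕ => ((orbitSum f n x s / lilScale n : ℝ) : EReal)) atTop =
      ((√(asympVar m) : ℝ) : EReal) := by
  set σ := √(asympVar m) with hσ
  have hup : ∀ᵐ s ∂pathMeasure ν, ∀ i : ℕ, ∀ᶠ n : ℕ in atTop,
      orbitSum f n x s ≤ (σ + 1 / ((i : ℝ) + 1)) * lilScale n :=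
    ae_all_iff.2 fun i => h.ae_eventually_orbitSum_le (lt_add_of_pos_right _ (by positivity)) x
  have hlow : ∀ᵐ s ∂pathMeasure ν, ∀ i : ℕ, ∃ᶠ n : ℕ in atTop,
      (σ - 1 / ((i : ℝ) + 1)) * lilScale n ≤ orbitSum f n x s :=
    ae_all_iff.2 fun i => h.ae_frequently_le_orbitSum (sub_lt_self _ (by positivity)) x
  have hpos : ∀ᶠ n : ℕ in atTop, 0 < lilScale n :=
    (tendsto_lilScale.comp tendsto_natCast_atTop_atTop).eventually_gt_atTop 0
  have hlim : Tendsto (fun i : ℕ => 1 / ((i : ℝ) + 1)) atTop (𝓝 0) :=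
    tendsto_one_div_add_atTop_nhds_zero_nat
  have hlim1 : Tendsto (fun i : ℕ => ((σ + 1 / ((i : ℝ) + 1) : ℝ) : EReal)) atTop
      (𝓝 ((σ : ℝ) : EReal)) :=
    (continuous_coe_real_ereal.tendsto _).comp (by simpa using hlim.const_add σ)
  have hlim2 : Tendsto (fun i : ℕ => ((σ - 1 / ((i : ℝ) + 1) : ℝ) : EReal)) atTop
      (𝓝 ((σ : ℝ) : EReal)) :=
    (continuous_coe_real_ereal.tendsto _).comp (by simpa using hlim.const_sub σ)
  filter_upwards [hup, hlow] with s hs1 hs2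
  refine le_antisymm (ge_of_tendsto' hlim1 fun i => ?_) (le_of_tendsto' hlim2 fun i => ?_)
  · refine limsup_le_of_le (by isBoundedDefault) ?_
    filter_upwards [hs1 i, hpos] with n hn1 hn2
    exact EReal.coe_le_coe_iff.2 ((div_le_iff₀ hn2).2 hn1)
  · refine le_limsup_of_frequently_le ?_ (by isBoundedDefault)
    refine ((hs2 i).and_eventually hpos).mono ?_
    rintro n ⟨hn1, hn2⟩
    exact EReal.coe_le_coe_iff.2 ((le_div_iff₀ hn2).2 hn1)

end IsMixing

end

/-! ### Discrepancy estimates and functions of bounded variation -/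

section

instance : IsProbabilityMeasure unif := ⟨by simp [unif]⟩

theorem integrable_of_abs_le {α : Type*} [MeasurableSpace α] {μ : Measure α} [IsFiniteMeasure μ]
    {u : α → ℝ} (hu : Measurable u) {K : ℝ} (hK : ∀ x, |u x| ≤ K) : Integrable u μ :=
  .of_bound hu.aestronglyMeasurable K (ae_of_all _ hK)

theorem abs_integral_le_of_abs_le {α : Type*} [MeasurableSpace α] {μ : Measure α}
    [IsProbabilityMeasure μ] {u : α → ℝ} {K : ℝ} (hK : ∀ x, |u x| ≤ K) : |∫ x, u x ∂μ| ≤ K := by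
  simpa using norm_integral_le_of_norm_le_const (μ := μ) (f := u) (C := K) (ae_of_all _ hK)

theorem integral_unif (g : ℝ → ℝ) : ∫ u, g u ∂unif = ∫ u in (0 : ℝ)..1, g u := by
  rw [intervalIntegral.integral_of_le zero_le_one, unif, integral_Ico_eq_integral_Ioc]

theorem integral_unif_add {g : ℝ → ℝ} (hg : Function.Periodic g 1) (c : ℝ) :
    ∫ u, g (u + c) ∂unif = ∫ u, g u ∂unif := by
  rw [integral_unif, integral_unif, intervalIntegral.integral_comp_add_right]
  have := hg.intervalIntegral_add_eq c 0
  rwa [zero_add, add_comm c 1, ← zero_add c, ← add_assoc, add_zero] at this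

theorem unif_real_Iic {t : ℝ} (ht : t ∈ Set.Icc (0 : ℝ) 1) : unif.real (Set.Iic t) = t := by
  obtain ⟨h0, h1⟩ := ht
  rw [unif, measureReal_restrict_apply measurableSet_Iic]
  rcases h1.lt_or_eq with h1 | rfl
  · have : Set.Iic t ∩ Set.Ico 0 1 = Set.Icc 0 t := by
      ext y
      simp only [Set.mem_inter_iff, Set.mem_Iic, Set.mem_Ico, Set.mem_Icc]
      constructor
      · rintro ⟨h2, h3, _⟩; exact ⟨h3, h2⟩
      · rintro ⟨h2, h3⟩; exact ⟨h3, h2, by linarith⟩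
    rw [this]
    simp [h0]
  · have : Set.Iic (1 : ℝ) ∩ Set.Ico 0 1 = Set.Ico 0 1 :=
      Set.inter_eq_right.2 fun y hy => hy.2.le
    rw [this]
    simp

/-! ### The Koksma inequality -/

/-- The mass of a lower set is determined up to the discrepancy. -/
theorem abs_measureReal_isLowerSet_sub_le {ρ : Measure ℝ} [IsProbabilityMeasure ρ] {ψ : ℝ}
    (hρ : ∀ t ∈ Set.Icc (0 : ℝ) 1, |ρ.real (Set.Iic t) - t| ≤ ψ) {S : Set ℝ}
    (hS : IsLowerSet S) : |ρ.real S - sSup (insert 0 (S ∩ Set.Icc 0 1))| ≤ ψ := by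
  -- Inserting 0 gives the supremum the right value when `S` misses the unit interval.
  set T := insert 0 (S ∩ Set.Icc (0 : ℝ) 1) with hT
  set b := sSup T with hb
  have hψ : 0 ≤ ψ := (abs_nonneg _).trans (hρ 0 (by simp))
  have hTb : BddAbove T := ⟨1, by rintro y (rfl | hy); exacts [zero_le_one, hy.2.2]⟩
  have hb0 : 0 ≤ b := le_csSup hTb (Set.mem_insert _ _)
  have hb1 : b ≤ 1 :=
    csSup_le (Set.insert_nonempty _ _) (by rintro y (rfl | hy); exacts [zero_le_one, hy.2.2])
  rw [abs_sub_le_iff]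
  constructor
  · rcases hb1.lt_or_eq with hb1' | hb1'
    · have hsub : S ⊆ Set.Iic b := by
        intro y hy
        by_contra hyb
        have hyb : b < y := not_le.1 hyb
        have hmem : min y 1 ∈ T := Set.mem_insert_of_mem _
          ⟨hS (min_le_left _ _) hy, le_min (hb0.trans hyb.le) zero_le_one, min_le_right _ _⟩
        exact absurd (le_csSup hTb hmem) (not_le.2 (lt_min hyb hb1'))
      have h1 := measureReal_mono (μ := ρ) hsub
      have h2 := (abs_le.1 (hρ b ⟨hb0, hb1⟩)).2
      linarith
    · have h1 : ρ.real S ≤ 1 := measureReal_le_one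
      linarith
  · have : b ≤ ρ.real S + ψ := by
      refine csSup_le (Set.insert_nonempty _ _) ?_
      rintro y (rfl | hy)
      · have : 0 ≤ ρ.real S := measureReal_nonneg
        linarith
      · have h1 : Set.Iic y ⊆ S := fun z hz => hS hz hy.1
        have h2 := measureReal_mono (μ := ρ) h1
        have h3 := (abs_le.1 (hρ y hy.2)).1
        linarith
    linarith

/-- Layer cake: the integral of `p` is that of the masses of its superlevel sets over levels in (0,
c]. Their complements are lower sets, whose mass under `ρ` and under the uniform law differs by at
most `ψ`. -/
theorem abs_integral_monotone_sub_le {ρ : Measure ℝ} [IsProbabilityMeasure ρ] {ψ : ℝ}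
    (hρ : ∀ t ∈ Set.Icc (0 : ℝ) 1, |ρ.real (Set.Iic t) - t| ≤ ψ) {p : ℝ → ℝ} (hp : Monotone p)
    {c : ℝ} (hp0 : ∀ y, 0 ≤ p y) (hpc : ∀ y, p y ≤ c) :
    |∫ y, p y ∂ρ - ∫ y, p y ∂unif| ≤ ψ * c := by
  have hc : 0 ≤ c := (hp0 0).trans (hpc 0)
  have hlayer : ∀ (ρ : Measure ℝ) [IsProbabilityMeasure ρ],
      ∫ y, p y ∂ρ = ∫ t in Set.Ioc 0 c, ρ.real {y | t < p y} := by
    intro ρ _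
    have hint : Integrable p ρ := integrable_of_abs_le hp.measurable fun y => by
      rw [abs_of_nonneg (hp0 y)]; exact hpc y
    rw [hint.integral_eq_integral_meas_lt (ae_of_all _ hp0)]
    have hz : ∀ t ∈ Set.Ioi 0 \ Set.Ioc 0 c, ρ.real {y | t < p y} = 0 := by
      rintro t ⟨ht0, ht⟩
      have htc : c < t := by
        by_contra hcon
        exact ht ⟨ht0, not_lt.1 hcon⟩
      have : {y | t < p y} = ∅ := by
        ext y
        simpa using (hpc y).trans htc.le
      simp [this]
    exact setIntegral_eq_of_subset_of_forall_sdiff_eq_zero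
      measurableSet_Ioi Set.Ioc_subset_Ioi_self hz
  have hanti : ∀ (ρ : Measure ℝ) [IsProbabilityMeasure ρ],
      IntegrableOn (fun t => ρ.real {y | t < p y}) (Set.Ioc 0 c) := by
    intro ρ _
    have ha : Antitone fun t => ρ.real {y | t < p y} := fun t t' htt' =>
      measureReal_mono fun y hy => lt_of_le_of_lt htt' hy
    refine integrable_of_abs_le (K := 1) ha.measurable fun t => ?_
    rw [abs_of_nonneg measureReal_nonneg]
    exact measureReal_le_one
  rw [hlayer ρ, hlayer unif, ← integral_sub (hanti ρ) (hanti unif)]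
  have hbound : ∀ t, |ρ.real {y | t < p y} - unif.real {y | t < p y}| ≤ ψ := by
    intro t
    have hlow : IsLowerSet {y | t < p y}ᶜ := by
      intro y z hzy hy hz
      exact hy (lt_of_lt_of_le hz (hp hzy))
    have hm : MeasurableSet {y | t < p y} := measurableSet_lt measurable_const hp.measurable
    have h1 := abs_measureReal_isLowerSet_sub_le hρ hlow
    have h2 := abs_measureReal_isLowerSet_sub_le (ρ := unif) (ψ := 0)
      (fun t ht => by rw [unif_real_Iic ht]; simp) hlow
    rw [probReal_compl_eq_one_sub hm] at h1 h2
    rw [abs_nonpos_iff] at h2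
    have h3 : ρ.real {y | t < p y} - unif.real {y | t < p y} =
        -(1 - ρ.real {y | t < p y} - sSup (insert 0 ({y | t < p y}ᶜ ∩ Set.Icc 0 1))) := by
      linarith
    rw [h3, abs_neg]
    exact h1
  have := norm_setIntegral_le_of_norm_le_const (μ := volume) (s := Set.Ioc 0 c) (C := ψ)
    (f := fun t => ρ.real {y | t < p y} - unif.real {y | t < p y}) (by simp)
    (fun t _ => hbound t)
  simpa [hc] using this

theorem abs_integral_monotoneOn_sub_le {ρ : Measure ℝ} [IsProbabilityMeasure ρ] {ψ : ℝ}
    (hρ : ∀ t ∈ Set.Icc (0 : ℝ) 1, |ρ.real (Set.Iic t) - t| ≤ ψ)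
    (hρ1 : ∀ᵐ y ∂ρ, y ∈ Set.Icc (0 : ℝ) 1) {p : ℝ → ℝ} (hp : MonotoneOn p (Set.Icc 0 1)) :
    Integrable p ρ ∧ |∫ y, p y ∂ρ - ∫ y, p y ∂unif| ≤ ψ * (p 1 - p 0) := by
  -- Clamping to the unit interval makes the function monotone on the whole line, and subtracting `p
  -- 0` makes it non-negative, with supremum `p 1 - p 0`.
  set P : ℝ → ℝ := fun y => p (max 0 (min 1 y)) - p 0 with hP
  have hmem : ∀ y : ℝ, max 0 (min 1 y) ∈ Set.Icc (0 : ℝ) 1 := fun y =>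
    ⟨le_max_left _ _, max_le zero_le_one (min_le_left _ _)⟩
  have hPm : Monotone P := by
    intro y z hyz
    have : max 0 (min 1 y) ≤ max 0 (min 1 z) := by gcongr
    have := hp (hmem y) (hmem z) this
    simp only [hP]
    linarith
  have h0 : (0 : ℝ) ∈ Set.Icc (0 : ℝ) 1 := by simp
  have h1 : (1 : ℝ) ∈ Set.Icc (0 : ℝ) 1 := by simp
  have hP0 : ∀ y, 0 ≤ P y := fun y => sub_nonneg.2 (hp h0 (hmem y) (hmem y).1)
  have hPc : ∀ y, P y ≤ p 1 - p 0 := fun y => sub_le_sub_right (hp (hmem y) h1 (hmem y).2) _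
  have heq : ∀ y ∈ Set.Icc (0 : ℝ) 1, P y = p y - p 0 := fun y hy => by
    simp only [hP]
    rw [min_eq_right hy.2, max_eq_right hy.1]
  have hu1 : ∀ᵐ y ∂unif, y ∈ Set.Icc (0 : ℝ) 1 := by
    filter_upwards [ae_restrict_mem measurableSet_Ico] with y hy
    exact ⟨hy.1, hy.2.le⟩
  have key : ∀ (ρ : Measure ℝ) [IsProbabilityMeasure ρ], (∀ᵐ y ∂ρ, y ∈ Set.Icc (0 : ℝ) 1) →
      Integrable p ρ ∧ ∫ y, P y ∂ρ = ∫ y, p y ∂ρ - p 0 := by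
    intro ρ _ hρ1
    have hPi : Integrable P ρ := integrable_of_abs_le hPm.measurable fun y => by
      rw [abs_of_nonneg (hP0 y)]; exact hPc y
    have hae : (fun y => P y + p 0) =ᵐ[ρ] p := by
      filter_upwards [hρ1] with y hy
      rw [heq y hy]; ring
    refine ⟨(hPi.add (integrable_const (p 0))).congr hae, ?_⟩
    rw [← integral_congr_ae hae, integral_add hPi (integrable_const _)]
    simp
  have := abs_integral_monotone_sub_le hρ hPm hP0 hPc
  rw [(key ρ hρ1).2, (key unif hu1).2, sub_sub_sub_cancel_right] at this
  exact ⟨(key ρ hρ1).1, this⟩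

/-- **Koksma's inequality** for periodic functions of bounded variation. -/
theorem abs_integral_sub_le_eVariationOn {Ω : Type*} [MeasurableSpace Ω] {μ : Measure Ω}
    [IsProbabilityMeasure μ] {S : Ω → ℝ} (hS : Measurable S) {ψ : ℝ}
    (hψ : ∀ t ∈ Set.Icc (0 : ℝ) 1, |μ.real {ω | Int.fract (S ω) ≤ t} - t| ≤ ψ) {g : ℝ → ℝ}
    (hg : Function.Periodic g 1) (hgm : Measurable g) (hbv : BoundedVariationOn g (Set.Icc 0 1)) :
    |∫ ω, g (S ω) ∂μ - ∫ u, g u ∂unif| ≤ 2 * (eVariationOn g (Set.Icc 0 1)).toReal * ψ := by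
  set V := (eVariationOn g (Set.Icc 0 1)).toReal with hV
  have hfm : Measurable fun ω => Int.fract (S ω) := measurable_fract.comp hS
  set ρ := μ.map fun ω => Int.fract (S ω) with hρdef
  have : IsProbabilityMeasure ρ := Measure.isProbabilityMeasure_map hfm.aemeasurable
  have hρ : ∀ t ∈ Set.Icc (0 : ℝ) 1, |ρ.real (Set.Iic t) - t| ≤ ψ := by
    intro t ht
    rw [hρdef, map_measureReal_apply hfm measurableSet_Iic]
    exact hψ t ht
  have hρ1 : ∀ᵐ y ∂ρ, y ∈ Set.Icc (0 : ℝ) 1 := by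
    rw [hρdef]
    refine (ae_map_iff hfm.aemeasurable measurableSet_Icc).2 ?_
    exact ae_of_all _ fun ω => ⟨Int.fract_nonneg _, (Int.fract_lt_one _).le⟩
  have hu1 : ∀ᵐ y ∂unif, y ∈ Set.Icc (0 : ℝ) 1 := by
    filter_upwards [ae_restrict_mem measurableSet_Ico] with y hy
    exact ⟨hy.1, hy.2.le⟩
  have hgρ : ∫ ω, g (S ω) ∂μ = ∫ y, g y ∂ρ := by
    rw [hρdef, integral_map hfm.aemeasurable hgm.aestronglyMeasurable]
    refine integral_congr_ae (ae_of_all _ fun ω => ?_)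
    dsimp only
    have := hg.sub_int_mul_eq (x := S ω) ⌊S ω⌋
    rw [mul_one] at this
    rw [Int.fract, this]
  have h0 : (0 : ℝ) ∈ Set.Icc (0 : ℝ) 1 := by simp
  have h1 : (1 : ℝ) ∈ Set.Icc (0 : ℝ) 1 := by simp
  set p := variationOnFromTo g (Set.Icc 0 1) 0 with hp
  have hpm : MonotoneOn p (Set.Icc 0 1) :=
    variationOnFromTo.monotoneOn hbv.locallyBoundedVariationOn h0
  have hqm : MonotoneOn (p - g) (Set.Icc 0 1) :=
    variationOnFromTo.sub_self_monotoneOn hbv.locallyBoundedVariationOn h0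
  have hp0 : p 0 = 0 := variationOnFromTo.self _ _ _
  have hp1 : p 1 = V := by
    rw [hp, variationOnFromTo.eq_of_le _ _ zero_le_one, Set.inter_self]
  -- By periodicity both monotone parts `p` and `p - g` increase by exactly `V` over the period,
  -- hence the constant `2 * V`.
  have hg01 : g 1 = g 0 := by simpa using hg 0
  obtain ⟨i1, b1⟩ := abs_integral_monotoneOn_sub_le hρ hρ1 hpm
  obtain ⟨i2, b2⟩ := abs_integral_monotoneOn_sub_le hρ hρ1 hqm
  obtain ⟨i3, -⟩ := abs_integral_monotoneOn_sub_le (ψ := 0)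
    (fun t ht => by rw [unif_real_Iic ht]; simp) hu1 hpm
  obtain ⟨i4, -⟩ := abs_integral_monotoneOn_sub_le (ψ := 0)
    (fun t ht => by rw [unif_real_Iic ht]; simp) hu1 hqm
  have e1 : ∫ y, g y ∂ρ = ∫ y, p y ∂ρ - ∫ y, (p - g) y ∂ρ := by
    rw [← integral_sub i1 i2]
    simp
  have e2 : ∫ y, g y ∂unif = ∫ y, p y ∂unif - ∫ y, (p - g) y ∂unif := by
    rw [← integral_sub i3 i4]
    simp
  rw [hgρ, e1, e2]
  simp only [Pi.sub_apply, hp0, hp1, hg01] at b1 b2 ⊢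
  rw [abs_le] at b1 b2 ⊢
  constructor <;> linarith [b1.1, b1.2, b2.1, b2.2]

/-! ### Functions of bounded variation -/

theorem eVariationOn_mul_le {f g : ℝ → ℝ} {s : Set ℝ} {Kf Kg : NNReal} (hf : ∀ x, |f x| ≤ Kf)
    (hg : ∀ x, |g x| ≤ Kg) :
    eVariationOn (fun x => f x * g x) s ≤ Kf * eVariationOn g s + Kg * eVariationOn f s := by
  refine iSup_le fun p => ?_
  have hpt : ∀ x y, edist (f x * g x) (f y * g y) ≤ Kf * edist (g x) (g y) +
      Kg * edist (f x) (f y) := by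
    intro x y
    simp only [edist_nndist]
    norm_cast
    rw [← NNReal.coe_le_coe]
    push_cast
    simp only [Real.dist_eq]
    calc |f x * g x - f y * g y| = |f x * (g x - g y) + g y * (f x - f y)| := by congr 1; ring
      _ ≤ |f x * (g x - g y)| + |g y * (f x - f y)| := abs_add_le _ _
      _ ≤ _ := by
        rw [abs_mul, abs_mul]
        gcongr
        · exact hf x
        · exact hg y
  calc ∑ i ∈ Finset.range p.1, edist (f (p.2.1 (i + 1)) * g (p.2.1 (i + 1)))
        (f (p.2.1 i) * g (p.2.1 i))
      ≤ ∑ i ∈ Finset.range p.1, (Kf * edist (g (p.2.1 (i + 1))) (g (p.2.1 i)) +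
          Kg * edist (f (p.2.1 (i + 1))) (f (p.2.1 i))) := Finset.sum_le_sum fun i _ => hpt _ _
    _ = Kf * ∑ i ∈ Finset.range p.1, edist (g (p.2.1 (i + 1))) (g (p.2.1 i)) +
          Kg * ∑ i ∈ Finset.range p.1, edist (f (p.2.1 (i + 1))) (f (p.2.1 i)) := by
        rw [Finset.sum_add_distrib, Finset.mul_sum, Finset.mul_sum]
    _ ≤ _ := by
        gcongr
        · exact eVariationOn.sum_le p.2.2.1 p.2.2.2
        · exact eVariationOn.sum_le p.2.2.1 p.2.2.2

/-- After reduction of `c` modulo one, the shifted window lies in `[0, 2]`, which is two periods. -/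
theorem eVariationOn_add_right_le {f : ℝ → ℝ} (hf : Function.Periodic f 1) (c : ℝ) :
    eVariationOn (fun y => f (c + y)) (Set.Icc 0 1) ≤ 2 * eVariationOn f (Set.Icc 0 1) := by
  have h1 : (fun y => f (c + y)) = f ∘ fun y => Int.fract c + y := by
    ext y
    have := hf.sub_int_mul_eq (x := c + y) ⌊c⌋
    rw [mul_one] at this
    simp only [Function.comp]
    rw [← this, Int.fract]
    congr 1
    ring
  have h2 : eVariationOn (f ∘ fun y => Int.fract c + y) (Set.Icc 0 1) ≤
      eVariationOn f (Set.Icc 0 2) := by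
    refine eVariationOn.comp_le_of_monotoneOn f _ (fun y _ z _ hyz => by simpa using hyz) ?_
    intro y hy
    have := Int.fract_nonneg c
    have := (Int.fract_lt_one c).le
    exact ⟨by linarith [hy.1], by linarith [hy.2]⟩
  have h3 : eVariationOn f (Set.Icc 0 2) =
      eVariationOn f (Set.Icc 0 1) + eVariationOn f (Set.Icc 1 2) := by
    have := eVariationOn.Icc_add_Icc f (s := Set.univ) (zero_le_one' ℝ) (one_le_two)
      (Set.mem_univ _)
    simpa using this.symm
  have h4 : eVariationOn f (Set.Icc 1 2) ≤ eVariationOn f (Set.Icc 0 1) := by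
    have h5 : f = f ∘ fun y => y - 1 := by
      ext y
      exact (hf.sub_eq y).symm
    conv_lhs => rw [h5]
    refine eVariationOn.comp_le_of_monotoneOn f _ (fun y _ z _ hyz => by simpa using hyz) ?_
    intro y hy
    exact ⟨by linarith [hy.1], by linarith [hy.2]⟩
  rw [h1, two_mul]
  refine h2.trans ?_
  rw [h3]
  gcongr

theorem exists_abs_le_of_mem_meanZeroBV {f : ℝ → ℝ} (hf : f ∈ meanZeroBV) :
    ∃ K : NNReal, ∀ x, |f x| ≤ K := by
  obtain ⟨hper, hbv, -⟩ := hf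
  refine ⟨⟨|f 0| + (eVariationOn f (Set.Icc 0 1)).toReal, by positivity⟩, fun x => ?_⟩
  have h1 := hbv.dist_le (x := Int.fract x) (y := 0)
    ⟨Int.fract_nonneg _, (Int.fract_lt_one _).le⟩ (by simp)
  have h2 := hper.sub_int_mul_eq (x := x) ⌊x⌋
  rw [mul_one] at h2
  rw [Int.fract, h2, Real.dist_eq] at h1
  have h3 := abs_sub_abs_le_abs_sub (f x) (f 0)
  change |f x| ≤ |f 0| + (eVariationOn f (Set.Icc 0 1)).toReal
  linarith

/-- By periodicity f is the Jordan decomposition on the unit interval composed with the fractional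
part, and monotone functions are measurable. -/
theorem measurable_of_mem_meanZeroBV {f : ℝ → ℝ} (hf : f ∈ meanZeroBV) : Measurable f := by
  obtain ⟨hper, hbv, -⟩ := hf
  obtain ⟨p, q, hp, hq, hpq⟩ :=
    hbv.locallyBoundedVariationOn.exists_monotoneOn_sub_monotoneOn
  have hm : ∀ p : ℝ → ℝ, MonotoneOn p (Set.Icc 0 1) → Measurable fun x => p (Int.fract x) := by
    intro p hp
    have hmem : ∀ y : ℝ, max 0 (min 1 y) ∈ Set.Icc (0 : ℝ) 1 := fun y =>
      ⟨le_max_left _ _, max_le zero_le_one (min_le_left _ _)⟩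
    have hP : Monotone fun y => p (max 0 (min 1 y)) := fun y z hyz =>
      hp (hmem y) (hmem z) (by gcongr)
    have heq : (fun x => p (Int.fract x)) =
        (fun y => p (max 0 (min 1 y))) ∘ fun x => Int.fract x := by
      ext x
      simp only [Function.comp]
      rw [min_eq_right (Int.fract_lt_one x).le, max_eq_right (Int.fract_nonneg x)]
    rw [heq]
    exact hP.measurable.comp measurable_fract
  have heq : f = fun x => p (Int.fract x) - q (Int.fract x) := by
    ext x
    have h2 := hper.sub_int_mul_eq (x := x) ⌊x⌋
    rw [mul_one] at h2
    rw [← h2, hpq]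
    rfl
  rw [heq]
  exact (hm p hp).sub (hm q hq)

end

section

variable {ν : Measure ℝ} [IsProbabilityMeasure ν]

/-! ### Autocovariances -/

/-- `E f(U) g(U + S_k)` for the canonical walk. -/
noncomputable def walkCov (ν : Measure ℝ) (f g : ℝ → ℝ) (k : ℕ) : ℝ :=
  ∫ u, f u * walkOp ν k g u ∂unif

theorem abs_mul_le_mul {α : Type*} {u v : α → ℝ} {K K' : ℝ} (hu : ∀ x, |u x| ≤ K)
    (hv : ∀ x, |v x| ≤ K') (x y : α) : |u x * v y| ≤ K * K' := by
  rw [abs_mul]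
  exact mul_le_mul (hu x) (hv y) (abs_nonneg _) ((abs_nonneg _).trans (hu x))

theorem integrable_mul_walk {f g : ℝ → ℝ} (hf : Measurable f) (hg : Measurable g) {K K' : ℝ}
    (hK : ∀ x, |f x| ≤ K) (hK' : ∀ x, |g x| ≤ K') (k : ℕ) :
    Integrable (fun p : ℝ × (ℕ → ℝ) => f p.1 * g (p.1 + walk k p.2))
      (unif.prod (pathMeasure ν)) :=
  integrable_of_abs_le (by fun_prop) fun p => by
    rw [abs_mul]
    exact mul_le_mul (hK _) (hK' _) (abs_nonneg _) ((abs_nonneg _).trans (hK 0))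

theorem integral_prod_mul_walk {f g : ℝ → ℝ} (hf : Measurable f) (hg : Measurable g) {K K' : ℝ}
    (hK : ∀ x, |f x| ≤ K) (hK' : ∀ x, |g x| ≤ K') (k : ℕ) :
    ∫ p : ℝ × (ℕ → ℝ), f p.1 * g (p.1 + walk k p.2) ∂(unif.prod (pathMeasure ν)) =
      walkCov ν f g k := by
  rw [integral_prod _ (integrable_mul_walk hf hg hK hK' k)]
  simp only [integral_const_mul]
  rfl

theorem walkCov_eq_integral_integral {f g : ℝ → ℝ} (hf : Measurable f) (hg : Measurable g)
    {K K' : ℝ} (hK : ∀ x, |f x| ≤ K) (hK' : ∀ x, |g x| ≤ K') (k : ℕ) :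
    walkCov ν f g k = ∫ s, ∫ u, f u * g (u + walk k s) ∂unif ∂pathMeasure ν := by
  rw [← integral_prod_mul_walk hf hg hK hK' k]
  exact integral_prod_symm _ (integrable_mul_walk hf hg hK hK' k)

theorem abs_walkCov_le {f g : ℝ → ℝ} {K : ℝ} (hK : ∀ x, |f x| ≤ K) {k : ℕ} {r : ℝ}
    (hr : ∀ x, |walkOp ν k g x| ≤ r) : |walkCov ν f g k| ≤ K * r :=
  abs_integral_le_of_abs_le fun x => abs_mul_le_mul hK hr x x

/-! ### Mixing of functions of bounded variation -/

/-- Koksma's inequality for y ↦ f(x + y), whose uniform mean is zero. The constant 4 is the 2 of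
that inequality times the 2 lost in translating a function of bounded variation. -/
theorem abs_walkOp_le_of_mem_meanZeroBV {f : ℝ → ℝ} (hf : f ∈ meanZeroBV) {k : ℕ} {ψ : ℝ}
    (hψ : ∀ t ∈ Set.Icc (0 : ℝ) 1, |(pathMeasure ν).real {s | Int.fract (walk k s) ≤ t} - t| ≤ ψ)
    (x : ℝ) : |walkOp ν k f x| ≤ 4 * (eVariationOn f (Set.Icc 0 1)).toReal * ψ := by
  have hψ0 : 0 ≤ ψ := (abs_nonneg _).trans (hψ 0 (by simp))
  have hfm := measurable_of_mem_meanZeroBV hf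
  obtain ⟨hper, hbv, h0⟩ := hf
  have hvar := eVariationOn_add_right_le hper x
  have hne : 2 * eVariationOn f (Set.Icc 0 1) ≠ ⊤ := ENNReal.mul_ne_top (by simp) hbv
  have hbv' : BoundedVariationOn (fun y => f (x + y)) (Set.Icc 0 1) :=
    ne_top_of_le_ne_top hne hvar
  have hper' : Function.Periodic (fun y => f (x + y)) 1 := fun y => by
    dsimp only
    rw [← add_assoc, hper]
  have h1 := abs_integral_sub_le_eVariationOn (measurable_walk k) hψ hper' (by fun_prop) hbv'
  have h2 : ∫ u, f (x + u) ∂unif = 0 := by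
    simp only [add_comm x]
    rw [integral_unif_add hper, integral_unif, h0]
  rw [h2, sub_zero] at h1
  have h3 := ENNReal.toReal_mono hne hvar
  rw [ENNReal.toReal_mul, ENNReal.toReal_ofNat] at h3
  refine h1.trans (mul_le_mul_of_nonneg_right ?_ hψ0)
  linarith

/-- The rate is the sum of the constant `4V` needed for `decay` and the constant `8KV` needed for
`corr`, so that one sequence serves both. -/
theorem isMixing_of_mem_meanZeroBV {f : ℝ → ℝ} (hf : f ∈ meanZeroBV) {ψ : ℕ → ℝ}
    (hsum : Summable ψ) (hψ : ∀ k, ∀ t ∈ Set.Icc (0 : ℝ) 1,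
      |(pathMeasure ν).real {s | Int.fract (walk k s) ≤ t} - t| ≤ ψ k) {K : NNReal}
    (hK : ∀ x, |f x| ≤ K) :
    IsMixing ν f K (fun k => (4 * (eVariationOn f (Set.Icc 0 1)).toReal +
      8 * K * (eVariationOn f (Set.Icc 0 1)).toReal) * ψ k) (walkCov ν f f) := by
  have hψ0 : ∀ k, 0 ≤ ψ k := fun k => (abs_nonneg _).trans (hψ k 0 (by simp))
  have hfm := measurable_of_mem_meanZeroBV hf
  set V := (eVariationOn f (Set.Icc 0 1)).toReal with hV
  have hV0 : 0 ≤ V := ENNReal.toReal_nonneg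
  have hK0 : (0 : ℝ) ≤ K := K.2
  refine ⟨hfm, hK, hsum.mul_left _, fun k x => ?_, fun i d x => ?_⟩
  · refine (abs_walkOp_le_of_mem_meanZeroBV hf (hψ k) x).trans ?_
    have := hψ0 k
    gcongr
    rw [← hV]
    have : 0 ≤ 8 * K * V := by positivity
    linarith
  · obtain ⟨hper, hbv, h0⟩ := hf
    -- The displacement `c` between the two times is frozen, so that Koksma's inequality applies to
    -- a product of two translates, of variation at most `4KV`. Its uniform mean does not depend on
    -- `x`. Fubini then averages over `c`.
    have hb : ∀ c, |∫ s, f (x + walk i s) * f (x + walk i s + c) ∂pathMeasure ν -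
        ∫ u, f u * f (u + c) ∂unif| ≤ 8 * K * V * ψ i := by
      intro c
      have hvar1 := eVariationOn_add_right_le hper x
      have hvar2 := eVariationOn_add_right_le hper (x + c)
      have hvar := eVariationOn_mul_le (f := fun y => f (x + y)) (g := fun y => f (x + c + y))
        (s := Set.Icc 0 1) (fun y => hK _) (fun y => hK _)
      have hvar' : eVariationOn (fun y => f (x + y) * f (x + c + y)) (Set.Icc 0 1) ≤
          4 * K * eVariationOn f (Set.Icc 0 1) := by
        refine hvar.trans ?_
        calc _ ≤ K * (2 * eVariationOn f (Set.Icc 0 1)) +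
              K * (2 * eVariationOn f (Set.Icc 0 1)) := by gcongr
          _ = _ := by ring
      have hne : 4 * K * eVariationOn f (Set.Icc 0 1) ≠ ⊤ :=
        ENNReal.mul_ne_top (ENNReal.mul_ne_top (by simp) (by simp)) hbv
      have hper' : Function.Periodic (fun y => f (x + y) * f (x + c + y)) 1 := fun y => by
        simp only [← add_assoc]
        rw [hper, hper]
      have h1 := abs_integral_sub_le_eVariationOn (measurable_walk i) (hψ i) hper' (by fun_prop)
        (ne_top_of_le_ne_top hne hvar')
      have h2 : ∫ u, f (x + u) * f (x + c + u) ∂unif = ∫ u, f u * f (u + c) ∂unif := by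
        have hp2 : Function.Periodic (fun u => f u * f (u + c)) 1 := fun y => by
          simp only [add_right_comm y 1 c]
          rw [hper, hper]
        rw [← integral_unif_add hp2 x]
        refine integral_congr_ae (ae_of_all _ fun u => ?_)
        dsimp only
        congr 2 <;> ring
      rw [h2] at h1
      have h3 := ENNReal.toReal_mono hne hvar'
      rw [ENNReal.toReal_mul, ENNReal.toReal_mul, ENNReal.toReal_ofNat, ENNReal.coe_toReal] at h3
      have h4 : ∀ s, x + c + walk i s = x + walk i s + c := fun s => by ring
      simp only [h4] at h1
      refine h1.trans (mul_le_mul_of_nonneg_right ?_ (hψ0 i))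
      linarith
    have e1 : walkOp ν i (fun y => f y * walkOp ν d f y) x =
        ∫ s', ∫ s, f (x + walk i s) * f (x + walk i s + walk d s') ∂pathMeasure ν
          ∂pathMeasure ν := by
      have hint : Integrable (fun p : (ℕ → ℝ) × (ℕ → ℝ) =>
          f (x + walk i p.1) * f (x + walk i p.1 + walk d p.2))
          ((pathMeasure ν).prod (pathMeasure ν)) :=
        integrable_of_abs_le (by fun_prop) fun p => by
          rw [abs_mul]
          exact mul_le_mul (hK _) (hK _) (abs_nonneg _) hK0
      rw [← integral_prod_symm _ hint, integral_prod _ hint]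
      simp only [integral_const_mul]
      rfl
    rw [e1, walkCov_eq_integral_integral hfm hfm hK hK]
    have i1 : Integrable (fun s' => ∫ s, f (x + walk i s) * f (x + walk i s + walk d s')
        ∂pathMeasure ν) (pathMeasure ν) := by
      refine .of_bound (C := K * K) ?_ (ae_of_all _ fun s' => ?_)
      · refine StronglyMeasurable.aestronglyMeasurable ?_
        refine StronglyMeasurable.integral_prod_left' (f := fun p : (ℕ → ℝ) × (ℕ → ℝ) =>
          f (x + walk i p.1) * f (x + walk i p.1 + walk d p.2)) ?_
        exact Measurable.stronglyMeasurable (by fun_prop)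
      · refine abs_integral_le_of_abs_le fun s => ?_
        rw [abs_mul]
        exact mul_le_mul (hK _) (hK _) (abs_nonneg _) hK0
    have i2 : Integrable (fun s' => ∫ u, f u * f (u + walk d s') ∂unif) (pathMeasure ν) := by
      refine .of_bound (C := K * K) ?_ (ae_of_all _ fun s' => ?_)
      · refine StronglyMeasurable.aestronglyMeasurable ?_
        refine StronglyMeasurable.integral_prod_left' (f := fun p : ℝ × (ℕ → ℝ) =>
          f p.1 * f (p.1 + walk d p.2)) ?_
        exact Measurable.stronglyMeasurable (by fun_prop)
      · refine abs_integral_le_of_abs_le fun s => ?_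
        rw [abs_mul]
        exact mul_le_mul (hK _) (hK _) (abs_nonneg _) hK0
    rw [← integral_sub i1 i2]
    refine abs_integral_le_of_abs_le fun s' => (hb (walk d s')).trans ?_
    have := hψ0 i
    gcongr
    have : 0 ≤ 4 * V := by positivity
    linarith

/-! ### Degenerate variance -/

theorem sq_integral_le {α : Type*} [MeasurableSpace α] {μ : Measure α} [IsProbabilityMeasure μ]
    {u : α → ℝ} (hu : Measurable u) {K : ℝ} (hK : ∀ x, |u x| ≤ K) :
    (∫ x, u x ∂μ) ^ 2 ≤ ∫ x, u x ^ 2 ∂μ := by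
  set I := ∫ x, u x ∂μ with hI
  have i1 : Integrable u μ := integrable_of_abs_le hu hK
  have i2 : Integrable (fun x => u x ^ 2) μ :=
    integrable_of_abs_le (K := K ^ 2) (by fun_prop) fun x => by
      rw [abs_pow]; exact pow_le_pow_left₀ (abs_nonneg _) (hK x) 2
  have h0 : 0 ≤ ∫ x, (u x ^ 2 - 2 * I * u x + I ^ 2) ∂μ :=
    integral_nonneg fun x => by
      have : u x ^ 2 - 2 * I * u x + I ^ 2 = (u x - I) ^ 2 := by ring
      rw [this]
      exact sq_nonneg _
  have i3 : Integrable (fun x => u x ^ 2 - 2 * I * u x) μ := i2.sub (i1.const_mul _)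
  rw [integral_add i3 (integrable_const _), integral_sub i2 (i1.const_mul _),
    integral_const_mul, ← hI] at h0
  simp only [integral_const, probReal_univ, one_smul] at h0
  nlinarith

theorem periodic_walkOp {w : ℝ → ℝ} (hw : Function.Periodic w 1) (k : ℕ) :
    Function.Periodic (walkOp ν k w) 1 := fun x => by
  unfold walkOp
  refine integral_congr_ae (ae_of_all _ fun s => ?_)
  dsimp only
  rw [add_right_comm, hw]

/-- The loss of energy of `w` under one step of the walk. -/
theorem integral_sq_sub_walkOp {w : ℝ → ℝ} (hw : Function.Periodic w 1) (hm : Measurable w)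
    {K : ℝ} (hK : ∀ x, |w x| ≤ K) :
    ∫ s, ∫ u, (w (u + walk 1 s) - walkOp ν 1 w u) ^ 2 ∂unif ∂pathMeasure ν =
      ∫ u, w u ^ 2 ∂unif - ∫ u, walkOp ν 1 w u ^ 2 ∂unif := by
  have hP := abs_walkOp_le (ν := ν) hK 1
  have hPm : Measurable (walkOp ν 1 w) := measurable_walkOp hm 1
  have hsq : ∀ {v : ℝ → ℝ}, Measurable v → (∀ x, |v x| ≤ K) →
      Integrable (fun u => v u ^ 2) unif := fun {v} hv hvK =>
    integrable_of_abs_le (K := K ^ 2) (by fun_prop) fun x => by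
      rw [abs_pow]; exact pow_le_pow_left₀ (abs_nonneg _) (hvK x) 2
  have hinner : ∀ s, ∫ u, (w (u + walk 1 s) - walkOp ν 1 w u) ^ 2 ∂unif =
      (∫ u, w u ^ 2 ∂unif + ∫ u, walkOp ν 1 w u ^ 2 ∂unif) -
        2 * ∫ u, walkOp ν 1 w u * w (u + walk 1 s) ∂unif := by
    intro s
    have h1 : ∀ u, (w (u + walk 1 s) - walkOp ν 1 w u) ^ 2 =
        (w (u + walk 1 s) ^ 2 + walkOp ν 1 w u ^ 2) -
          2 * (walkOp ν 1 w u * w (u + walk 1 s)) := fun u => by ring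
    simp only [h1]
    have i1 : Integrable (fun u => w (u + walk 1 s) ^ 2) unif :=
      hsq (v := fun u => w (u + walk 1 s)) (by fun_prop) fun x => hK _
    have i2 := hsq hPm hP
    have i3 : Integrable (fun u => walkOp ν 1 w u * w (u + walk 1 s)) unif :=
      integrable_of_abs_le (by fun_prop) fun x =>
        abs_mul_le_mul (v := fun u => w (u + walk 1 s)) hP (fun x => hK _) x x
    have i4 : Integrable (fun u => w (u + walk 1 s) ^ 2 + walkOp ν 1 w u ^ 2) unif := i1.add i2
    rw [integral_sub i4 (i3.const_mul 2), integral_add i1 i2, integral_const_mul]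
    congr 2
    exact integral_unif_add (g := fun u => w u ^ 2) (fun u => by dsimp only; rw [hw]) _
  have i5 : Integrable (fun s => ∫ u, walkOp ν 1 w u * w (u + walk 1 s) ∂unif)
      (pathMeasure ν) := by
    refine .of_bound (C := K * K) ?_ (ae_of_all _ fun s' => ?_)
    · refine StronglyMeasurable.aestronglyMeasurable ?_
      refine StronglyMeasurable.integral_prod_left' (f := fun p : ℝ × (ℕ → ℝ) =>
        walkOp ν 1 w p.1 * w (p.1 + walk 1 p.2)) ?_
      exact Measurable.stronglyMeasurable (by fun_prop)
    · exact abs_integral_le_of_abs_le fun x =>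
        abs_mul_le_mul (v := fun u => w (u + walk 1 s')) hP (fun x => hK _) x x
  simp only [hinner]
  rw [integral_sub (integrable_const _) (i5.const_mul 2), integral_const_mul,
    ← walkCov_eq_integral_integral hPm hm hP hK]
  -- Averaging `w (u + walk 1 s)` over the step turns the cross term into ∫ (Pw)², which after
  -- doubling leaves ∫ w² - ∫ (Pw)².
  have : walkCov ν (walkOp ν 1 w) w 1 = ∫ u, walkOp ν 1 w u ^ 2 ∂unif :=
    integral_congr_ae (ae_of_all _ fun u => (sq _).symm)
  rw [this]
  simp
  ring

/-- The loss of energy decreases along the walk. -/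
theorem integral_sq_sub_walkOp_walkOp_le {w : ℝ → ℝ} (hw : Function.Periodic w 1)
    (hm : Measurable w) {K : ℝ} (hK : ∀ x, |w x| ≤ K) (n : ℕ) :
    ∫ u, walkOp ν n w u ^ 2 ∂unif - ∫ u, walkOp ν (n + 1) w u ^ 2 ∂unif ≤
      ∫ u, w u ^ 2 ∂unif - ∫ u, walkOp ν 1 w u ^ 2 ∂unif := by
  have hcomm : ∀ x, walkOp ν 1 (walkOp ν n w) x = walkOp ν (n + 1) w x := fun x => by
    rw [← walkOp_add hm hK, add_comm]
  have hnm : Measurable (walkOp ν n w) := measurable_walkOp hm n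
  have hP := abs_walkOp_le (ν := ν) hK 1
  have hPm : Measurable (walkOp ν 1 w) := measurable_walkOp hm 1
  have h1 := integral_sq_sub_walkOp (ν := ν) (periodic_walkOp (ν := ν) hw n) hnm
    (abs_walkOp_le hK n)
  simp only [hcomm] at h1
  rw [← h1, ← integral_sq_sub_walkOp hw hm hK]
  set D : (ℕ → ℝ) → ℝ → ℝ := fun s u => w (u + walk 1 s) - walkOp ν 1 w u with hD
  have hDK : ∀ s u, |D s u| ≤ 2 * K := fun s u => by
    have h1 := abs_sub (w (u + walk 1 s)) (walkOp ν 1 w u)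
    have h2 := hK (u + walk 1 s)
    have h3 := hP u
    simp only [hD]
    linarith
  have hD2 : ∀ s u, |D s u ^ 2| ≤ (2 * K) ^ 2 := fun s u => by
    rw [abs_pow]; exact pow_le_pow_left₀ (abs_nonneg _) (hDK s u) 2
  have hDm : Measurable fun p : (ℕ → ℝ) × ℝ => D p.1 p.2 := by
    simp only [hD]
    fun_prop
  have hmain : ∀ s, ∫ u, (walkOp ν n w (u + walk 1 s) - walkOp ν (n + 1) w u) ^ 2 ∂unif ≤
      ∫ u, D s u ^ 2 ∂unif := by
    intro s
    have hDs : Measurable (D s) := hDm.comp (measurable_const.prodMk measurable_id)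
    -- The operator commutes with translations, so the deviation for P^n w is an average of
    -- translates of the deviation `D s` for `w`. Jensen's inequality and translation invariance
    -- then bound its energy.
    have h2 : ∀ u, walkOp ν n w (u + walk 1 s) - walkOp ν (n + 1) w u =
        ∫ s', D s (u + walk n s') ∂pathMeasure ν := by
      intro u
      rw [walkOp_add hm hK]
      simp only [walkOp, hD]
      rw [integral_sub]
      · congr 1
        refine integral_congr_ae (ae_of_all _ fun s' => ?_)
        dsimp only
        congr 1
        ring
      · exact integrable_of_abs_le (by fun_prop) fun s' => hK _
      · exact integrable_walk hPm hP n u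
    have hint : Integrable (fun p : ℝ × (ℕ → ℝ) => D s (p.1 + walk n p.2) ^ 2)
        (unif.prod (pathMeasure ν)) :=
      integrable_of_abs_le (by fun_prop) fun p => hD2 s _
    calc ∫ u, (walkOp ν n w (u + walk 1 s) - walkOp ν (n + 1) w u) ^ 2 ∂unif
        ≤ ∫ u, ∫ s', D s (u + walk n s') ^ 2 ∂pathMeasure ν ∂unif := by
          refine integral_mono_of_nonneg (ae_of_all _ fun u => sq_nonneg _)
            hint.integral_prod_left (ae_of_all _ fun u => ?_)
          dsimp only
          rw [h2]
          exact sq_integral_le (by fun_prop) fun s' => hDK s _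
      _ = ∫ s', ∫ u, D s (u + walk n s') ^ 2 ∂unif ∂pathMeasure ν := by
          rw [← integral_prod _ hint, integral_prod_symm _ hint]
      _ = ∫ u, D s u ^ 2 ∂unif := by
          have hper : Function.Periodic (fun u => D s u ^ 2) 1 := fun u => by
            simp only [hD]
            rw [periodic_walkOp hw 1 u, add_right_comm, hw]
          have : ∀ s', ∫ u, D s (u + walk n s') ^ 2 ∂unif = ∫ u, D s u ^ 2 ∂unif := fun s' =>
            integral_unif_add hper _
          simp [this]
  refine integral_mono_of_nonneg (ae_of_all _ fun s => integral_nonneg fun u => sq_nonneg _) ?_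
    (ae_of_all _ hmain)
  have : Integrable (fun p : (ℕ → ℝ) × ℝ => D p.1 p.2 ^ 2) ((pathMeasure ν).prod unif) :=
    integrable_of_abs_le (by fun_prop) fun p => hD2 _ _
  exact this.integral_prod_left

theorem ae_eq_zero_of_integral_sq {u : ℝ → ℝ} (hu : Measurable u) {K : ℝ} (hK : ∀ x, |u x| ≤ K)
    (h : ∫ x, u x ^ 2 ∂unif = 0) : u =ᵐ[unif] 0 := by
  rw [integral_eq_zero_iff_of_nonneg (fun x => sq_nonneg _)
    (integrable_of_abs_le (K := K ^ 2) (hu.pow_const 2) fun x => by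
      rw [abs_pow]; exact pow_le_pow_left₀ (abs_nonneg _) (hK x) 2)] at h
  filter_upwards [h] with x hx
  simpa using hx

namespace IsMixing

variable {f : ℝ → ℝ} {K : ℝ} {a : ℕ → ℝ}

/-- Degeneracy of the asymptotic variance. -/
theorem ae_eq_zero_of_asympVar_eq_zero (h : IsMixing ν f K a (walkCov ν f f))
    (hper : Function.Periodic f 1) (h0 : asympVar (walkCov ν f f) = 0) : f =ᵐ[unif] 0 := by
  set g₀ := potential ν f with hg₀
  set B := ∑' k, a (k + 1) with hB
  have hfm := h.measurable
  have hg₀m : Measurable g₀ := h.measurable_potential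
  have hg₀B : ∀ x, |g₀ x| ≤ B := h.abs_potential_le
  set g : ℝ → ℝ := fun x => f x + g₀ x with hg
  have hgm : Measurable g := hfm.add hg₀m
  have hgK : ∀ x, |g x| ≤ K + B := fun x => (abs_add_le _ _).trans (add_le_add (h.bound x) (hg₀B x))
  have hg₀per : Function.Periodic g₀ 1 := fun x =>
    tsum_congr fun k => periodic_walkOp hper (k + 1) x
  have hgper : Function.Periodic g 1 := hper.add hg₀per
  have hwg : ∀ n x, walkOp ν n g x = walkOp ν n f x + ∑' k, walkOp ν (n + k + 1) f x := by
    intro n x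
    rw [← h.walkOp_potential]
    exact integral_add (integrable_walk hfm h.bound n x) (integrable_walk hg₀m hg₀B n x)
  have hw1 : ∀ x, walkOp ν 1 g x = g₀ x := by
    intro x
    rw [hwg, hg₀, potential, (h.summable_walkOp x).tsum_eq_zero_add]
    congr 1
    refine tsum_congr fun k => ?_
    rw [add_comm 1 k]
  have hf2 : ∫ u, f u * g₀ u ∂unif = ∑' k, walkCov ν f f (k + 1) := by
    have hi : ∀ k, Integrable (fun u => f u * walkOp ν (k + 1) f u) unif := fun k =>
      integrable_of_abs_le (by fun_prop) (h.abs_mul_walkOp_le (k + 1))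
    have hs : Summable fun k => ∫ u, ‖f u * walkOp ν (k + 1) f u‖ ∂unif := by
      refine .of_nonneg_of_le (fun k => integral_nonneg fun s => norm_nonneg _) (fun k => ?_)
        (h.summable_succ.mul_left K)
      refine (le_abs_self _).trans (abs_integral_le_of_abs_le fun u => ?_)
      rw [Real.norm_eq_abs, abs_abs]
      exact h.abs_mul_walkOp_le (k + 1) u
    have := (hasSum_integral_of_summable_integral_norm hi hs).tsum_eq
    simp only [walkCov]
    rw [this]
    refine integral_congr_ae (ae_of_all _ fun u => ?_)
    simp only [hg₀, potential]
    rw [tsum_mul_left]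
  -- Since Pg = g₀, the difference is ∫ f² + 2∫ f·g₀, and integrating the series for g₀ termwise
  -- identifies it with the asymptotic variance.
  have hvar : ∫ u, g u ^ 2 ∂unif - ∫ u, walkOp ν 1 g u ^ 2 ∂unif = 0 := by
    have i1 : Integrable (fun u => f u * f u) unif :=
      integrable_of_abs_le (by fun_prop) fun x => abs_mul_le_mul h.bound h.bound x x
    have i2 : Integrable (fun u => f u * g₀ u) unif :=
      integrable_of_abs_le (by fun_prop) fun x => abs_mul_le_mul h.bound hg₀B x x
    have i3 : Integrable (fun u => g₀ u ^ 2) unif := by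
      simp only [sq]
      exact integrable_of_abs_le (by fun_prop) fun x => abs_mul_le_mul hg₀B hg₀B x x
    have h1 : ∀ u, g u ^ 2 = f u * f u + 2 * (f u * g₀ u) + g₀ u ^ 2 := fun u => by
      simp only [hg]; ring
    have i4 : Integrable (fun u => f u * f u + 2 * (f u * g₀ u)) unif := i1.add (i2.const_mul 2)
    have h2 : walkCov ν f f 0 = ∫ u, f u * f u ∂unif := by simp [walkCov]
    simp only [hw1, h1]
    rw [integral_add i4 i3, integral_add i1 (i2.const_mul 2), integral_const_mul, hf2, ← h2]
    rw [asympVar] at h0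
    linarith
  -- Every later step loses no more energy than the first one, which loses none.
  have henergy : ∀ n, ∫ u, g u ^ 2 ∂unif ≤ ∫ u, walkOp ν n g u ^ 2 ∂unif := by
    intro n
    induction n with
    | zero => simp
    | succ n ih =>
      have := integral_sq_sub_walkOp_walkOp_le (ν := ν) hgper hgm hgK n
      linarith
  have hbound : ∀ n x, |walkOp ν n g x| ≤ a n + ∑' k, a (k + (n + 1)) := by
    intro n x
    rw [hwg]
    refine (abs_add_le _ _).trans (add_le_add (h.decay n x) ?_)
    refine tsum_of_norm_bounded (f := fun k => walkOp ν (n + k + 1) f x)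
      ((summable_nat_add_iff (n + 1)).2 h.summable).hasSum fun k => ?_
    rw [show k + (n + 1) = n + k + 1 by ring]
    exact h.decay _ x
  have hlim : Tendsto (fun n => (a n + ∑' k, a (k + (n + 1))) ^ 2) atTop (𝓝 ((0 + 0) ^ 2)) :=
    (h.summable.tendsto_atTop_zero.add
      ((tendsto_sum_nat_add a).comp (tendsto_add_atTop_nat 1))).pow 2
  have hg2 : ∫ u, g u ^ 2 ∂unif = 0 := by
    refine le_antisymm ?_ (integral_nonneg fun u => sq_nonneg _)
    have := ge_of_tendsto' hlim (b := ∫ u, g u ^ 2 ∂unif) fun n => (henergy n).trans ?_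
    · simpa using this
    · refine (le_abs_self _).trans (abs_integral_le_of_abs_le fun u => ?_)
      rw [abs_pow]
      exact pow_le_pow_left₀ (abs_nonneg _) (hbound n u) 2
  have hg₀2 : ∫ u, g₀ u ^ 2 ∂unif = 0 := by
    simp only [hw1] at hvar
    linarith
  filter_upwards [ae_eq_zero_of_integral_sq hgm hgK hg2,
    ae_eq_zero_of_integral_sq hg₀m hg₀B hg₀2] with u h1 h2
  have : f u + g₀ u = 0 := h1
  rw [h2] at this
  simpa using this

end IsMixing

theorem ae_eq_zero_of_periodic {f : ℝ → ℝ} (hper : Function.Periodic f 1)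
    (h : f =ᵐ[unif] 0) : f =ᵐ[volume] 0 := by
  have h1 : ∀ᵐ u, u ∈ Set.Ico (0 : ℝ) 1 → f u = 0 := (ae_restrict_iff' measurableSet_Ico).1 h
  have h2 : ∀ n : ℤ, ∀ᵐ u : ℝ, u - n ∈ Set.Ico (0 : ℝ) 1 → f (u - n) = 0 := fun n =>
    (measurePreserving_sub_right volume (n : ℝ)).quasiMeasurePreserving.ae h1
  filter_upwards [ae_all_iff.2 h2] with u hu
  have h3 := hper.sub_int_mul_eq (x := u) ⌊u⌋
  rw [mul_one] at h3
  rw [← h3]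
  exact hu ⌊u⌋ ⟨Int.fract_nonneg u, Int.fract_lt_one u⟩

end

/-! ### Transfer to the canonical space -/

section Transfer

variable {Ω : Type*} [MeasurableSpace Ω] {μ : Measure Ω} [IsProbabilityMeasure μ]
  {X : ℕ → Ω → ℝ}

theorem measurePreserving_path (hmeas : ∀ i, Measurable (X i)) (hindep : iIndepFun X μ)
    (hident : ∀ i, IdentDistrib (X i) (X 0) μ μ) :
    MeasurePreserving (fun ω i => X i ω) μ (pathMeasure (μ.map (X 0))) := by
  refine ⟨measurable_pi_lambda _ hmeas, ?_⟩
  rw [hindep.map_fun_eq_infinitePi_map hmeas]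
  simp only [fun i => (hident i).map_eq]
  rfl

theorem abs_measureReal_fract_sub_le_psi {ν : Measure ℝ} [IsProbabilityMeasure ν]
    (hY : MeasurePreserving (fun ω i => X i ω) μ (pathMeasure ν)) (k : ℕ) {t : ℝ}
    (ht : t ∈ Set.Icc (0 : ℝ) 1) :
    |(pathMeasure ν).real {s | Int.fract (walk k s) ≤ t} - t| ≤ psi μ X k := by
  have hm : MeasurableSet {s | Int.fract (walk k s) ≤ t} :=
    measurableSet_le (measurable_fract.comp (measurable_walk k)) measurable_const
  rw [← hY.measureReal_preimage hm.nullMeasurableSet]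
  -- The supremum defining `psi` is a real one, so it dominates its members only once the family is
  -- known to be bounded; any bound will do, here 2.
  refine le_ciSup (f := fun t : Set.Icc (0 : ℝ) 1 =>
    |μ.real {ω | Int.fract (partialSum X k ω) ≤ (t : ℝ)} - (t : ℝ)|) ⟨2, ?_⟩ ⟨t, ht⟩
  rintro _ ⟨t, rfl⟩
  have h1 : μ.real {ω | Int.fract (partialSum X k ω) ≤ (t : ℝ)} ≤ 1 := measureReal_le_one
  have h2 : 0 ≤ μ.real {ω | Int.fract (partialSum X k ω) ≤ (t : ℝ)} := measureReal_nonneg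
  have h3 := t.2.1
  have h4 := t.2.2
  rw [abs_le]
  constructor <;> linarith

theorem crossCov_eq_walkCov {ν : Measure ℝ} [IsProbabilityMeasure ν]
    (hY : MeasurePreserving (fun ω i => X i ω) μ (pathMeasure ν)) {f g : ℝ → ℝ}
    (hf : f ∈ meanZeroBV) (hg : g ∈ meanZeroBV) (k : ℕ) :
    Integrable (fun p : ℝ × Ω => f p.1 * g (p.1 + partialSum X k p.2)) (unif.prod μ) ∧
      crossCov μ X f g k = walkCov ν f g k := by
  have hfm := measurable_of_mem_meanZeroBV hf
  have hgm := measurable_of_mem_meanZeroBV hg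
  obtain ⟨K, hK⟩ := exists_abs_le_of_mem_meanZeroBV hf
  obtain ⟨K', hK'⟩ := exists_abs_le_of_mem_meanZeroBV hg
  have hp := (MeasurePreserving.id unif).prod hY
  have hint := integrable_mul_walk (ν := ν) hfm hgm hK hK' k
  refine ⟨hp.integrable_comp_of_integrable hint, ?_⟩
  rw [← integral_prod_mul_walk hfm hgm hK hK' k, ← hp.map_eq,
    integral_map hp.measurable.aemeasurable (Measurable.aestronglyMeasurable (by fun_prop))]
  rfl

theorem sum_Icc_partialSum (f : ℝ → ℝ) (N : ℕ) (ω : Ω) :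
    ∑ k ∈ Finset.Icc 1 N, f (partialSum X k ω) = orbitSum f N 0 fun i => X i ω := by
  induction N with
  | zero => simp
  | succ N ih =>
    rw [Finset.sum_Icc_succ_top (by omega), ih, orbitSum_succ, zero_add]
    rfl

end Transfer

/-! ### The covariance form -/

section Form

variable {ν : Measure ℝ} [IsProbabilityMeasure ν]

theorem integrable_mul_walkOp {f g : ℝ → ℝ} (hf : f ∈ meanZeroBV) (hg : g ∈ meanZeroBV) (k : ℕ) :
    Integrable (fun u => f u * walkOp ν k g u) unif := by
  have hfm := measurable_of_mem_meanZeroBV hf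
  have hgm := measurable_of_mem_meanZeroBV hg
  obtain ⟨K, hK⟩ := exists_abs_le_of_mem_meanZeroBV hf
  obtain ⟨K', hK'⟩ := exists_abs_le_of_mem_meanZeroBV hg
  exact integrable_of_abs_le (by fun_prop) fun x => abs_mul_le_mul hK (abs_walkOp_le hK' k) x x

theorem walkCov_add_left {f f' g : ℝ → ℝ} (hf : f ∈ meanZeroBV) (hf' : f' ∈ meanZeroBV)
    (hg : g ∈ meanZeroBV) (k : ℕ) :
    walkCov ν (f + f') g k = walkCov ν f g k + walkCov ν f' g k := by
  simp only [walkCov, Pi.add_apply, add_mul]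
  exact integral_add (integrable_mul_walkOp hf hg k) (integrable_mul_walkOp hf' hg k)

theorem walkCov_add_right {f g g' : ℝ → ℝ} (hf : f ∈ meanZeroBV) (hg : g ∈ meanZeroBV)
    (hg' : g' ∈ meanZeroBV) (k : ℕ) :
    walkCov ν f (g + g') k = walkCov ν f g k + walkCov ν f g' k := by
  obtain ⟨K, hK⟩ := exists_abs_le_of_mem_meanZeroBV hg
  obtain ⟨K', hK'⟩ := exists_abs_le_of_mem_meanZeroBV hg'
  have : ∀ u, walkOp ν k (g + g') u = walkOp ν k g u + walkOp ν k g' u := fun u =>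
    integral_add (integrable_walk (measurable_of_mem_meanZeroBV hg) hK k u)
      (integrable_walk (measurable_of_mem_meanZeroBV hg') hK' k u)
  simp only [walkCov, this, mul_add]
  exact integral_add (integrable_mul_walkOp hf hg k) (integrable_mul_walkOp hf hg' k)

theorem walkCov_smul_left (c : ℝ) (f g : ℝ → ℝ) (k : ℕ) :
    walkCov ν (c • f) g k = c * walkCov ν f g k := by
  simp only [walkCov, Pi.smul_apply, smul_eq_mul, mul_assoc, integral_const_mul]

theorem walkCov_smul_right (c : ℝ) (f g : ℝ → ℝ) (k : ℕ) :
    walkCov ν f (c • g) k = c * walkCov ν f g k := by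
  simp only [walkCov, walkOp, Pi.smul_apply, smul_eq_mul, integral_const_mul, mul_left_comm _ c]

theorem walkCov_zero (f g : ℝ → ℝ) : walkCov ν f g 0 = ∫ u, f u * g u ∂unif := by
  simp [walkCov]

/-- The covariance form of the canonical walk. -/
noncomputable def covForm (ν : Measure ℝ) (f g : ℝ → ℝ) : ℝ :=
  ∫ u, f u * g u ∂unif + ∑' k, walkCov ν f g (k + 1) + ∑' k, walkCov ν g f (k + 1)

theorem covForm_comm (f g : ℝ → ℝ) : covForm ν f g = covForm ν g f := by
  simp only [covForm, mul_comm (f _)]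
  ring

/-- On the diagonal the two series coincide, which is the factor 2 in `asympVar`. Through this
identity the form inherits positivity, its null space and both limit theorems. -/
theorem covForm_self (f : ℝ → ℝ) :
    covForm ν f f = asympVar (walkCov ν f f) := by
  rw [covForm, asympVar, walkCov_zero]
  ring

theorem covForm_add_left {f f' g : ℝ → ℝ} (hf : f ∈ meanZeroBV) (hf' : f' ∈ meanZeroBV)
    (hg : g ∈ meanZeroBV) (hs : ∀ f ∈ meanZeroBV, ∀ g ∈ meanZeroBV,
      Summable fun k => |walkCov ν f g (k + 1)|) :
    covForm ν (f + f') g = covForm ν f g + covForm ν f' g := by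
  have h0 := walkCov_add_left (ν := ν) hf hf' hg 0
  simp only [walkCov_zero] at h0
  simp only [covForm, h0, walkCov_add_left hf hf' hg, walkCov_add_right hg hf hf']
  rw [(hs f hf g hg).of_abs.tsum_add (hs f' hf' g hg).of_abs,
    (hs g hg f hf).of_abs.tsum_add (hs g hg f' hf').of_abs]
  ring

theorem covForm_smul_left (c : ℝ) (f g : ℝ → ℝ) :
    covForm ν (c • f) g = c * covForm ν f g := by
  have h0 := walkCov_smul_left (ν := ν) c f g 0
  simp only [walkCov_zero] at h0
  simp only [covForm, h0, walkCov_smul_left, walkCov_smul_right, tsum_mul_left]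
  ring

theorem summable_abs_walkCov {ψ : ℕ → ℝ} (hsum : Summable ψ) (hψ : ∀ k, ∀ t ∈ Set.Icc (0 : ℝ) 1,
    |(pathMeasure ν).real {s | Int.fract (walk k s) ≤ t} - t| ≤ ψ k) {f g : ℝ → ℝ}
    (hf : f ∈ meanZeroBV) (hg : g ∈ meanZeroBV) :
    Summable fun k => |walkCov ν f g (k + 1)| := by
  obtain ⟨K, hK⟩ := exists_abs_le_of_mem_meanZeroBV hf
  refine .of_nonneg_of_le (fun k => abs_nonneg _)
    (fun k => abs_walkCov_le hK (abs_walkOp_le_of_mem_meanZeroBV hg (hψ (k + 1))))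
    ((((summable_nat_add_iff 1).2 hsum).mul_left _).mul_left _)

end Form

end RandomWalkModOne

theorem theorem1 {Ω : Type*} [MeasurableSpace Ω] (μ : Measure Ω) [IsProbabilityMeasure μ]
    (X : ℕ → Ω → ℝ) (hmeas : ∀ i, Measurable (X i)) (hindep : iIndepFun X μ)
    (hident : ∀ i, IdentDistrib (X i) (X 0) μ μ)
    (hpsi : ∃ δ : ℝ, 0 < δ ∧
      (fun k : ℕ => RandomWalkModOne.psi μ X k) =O[atTop] (fun k : ℕ => (k : ℝ) ^ (-(1 + δ)))) :
    -- all expectations in `C(f,g)` exist and both series converge absolutely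
    (∀ f g : RandomWalkModOne.meanZeroBV,
      Integrable (fun u : ℝ => f.1 u * g.1 u) RandomWalkModOne.unif ∧
      (∀ k : ℕ, 1 ≤ k → Integrable
        (fun p : ℝ × Ω => f.1 p.1 * g.1 (p.1 + RandomWalkModOne.partialSum X k p.2))
        (RandomWalkModOne.unif.prod μ)) ∧
      (∀ k : ℕ, 1 ≤ k → Integrable
        (fun p : ℝ × Ω => g.1 p.1 * f.1 (p.1 + RandomWalkModOne.partialSum X k p.2))
        (RandomWalkModOne.unif.prod μ)) ∧
      Summable (fun k : ℕ => |RandomWalkModOne.crossCov μ X f.1 g.1 (k + 1)|) ∧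
      Summable (fun k : ℕ => |RandomWalkModOne.crossCov μ X g.1 f.1 (k + 1)|)) ∧
    -- `C` is a symmetric positive semidefinite bilinear form, and `C(f,f) = 0` iff `f = 0` a.e.
    (∃ B : LinearMap.BilinForm ℝ RandomWalkModOne.meanZeroBV,
      (∀ f g : RandomWalkModOne.meanZeroBV, B f g = RandomWalkModOne.C μ X f.1 g.1) ∧
      B.IsSymm ∧ B.IsPosSemidef) ∧
    (∀ f : RandomWalkModOne.meanZeroBV,
      RandomWalkModOne.C μ X f.1 f.1 = 0 ↔ f.1 =ᵐ[volume] 0) ∧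
    -- central limit theorem (`gaussianReal 0 0` is the point mass at `0`)
    (∀ f : RandomWalkModOne.meanZeroBV,
      TendstoInDistribution
        (fun (N : ℕ) (ω : Ω) =>
          (∑ k ∈ Finset.Icc 1 N, f.1 (RandomWalkModOne.partialSum X k ω)) / √(N : ℝ))
        atTop (id : ℝ → ℝ) (fun _ => μ)
        (gaussianReal 0 (RandomWalkModOne.C μ X f.1 f.1).toNNReal)) ∧
    -- law of the iterated logarithm, with the limsup taken in the extended reals
    (∀ f : RandomWalkModOne.meanZeroBV, ∀ᵐ ω ∂μ,
      limsup (fun N : ℕ =>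
        (((∑ k ∈ Finset.Icc 1 N, f.1 (RandomWalkModOne.partialSum X k ω)) /
          √(2 * (N : ℝ) * Real.log (Real.log (N : ℝ))) : ℝ) : EReal)) atTop
      = ((√(RandomWalkModOne.C μ X f.1 f.1) : ℝ) : EReal)) := by
  obtain ⟨δ, hδ, hO⟩ := hpsi
  set ν := μ.map (X 0) with hν
  have : IsProbabilityMeasure ν := Measure.isProbabilityMeasure_map (hmeas 0).aemeasurable
  have hY : MeasurePreserving (fun ω i => X i ω) μ (RandomWalkModOne.pathMeasure ν) :=
    RandomWalkModOne.measurePreserving_path hmeas hindep hident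
  -- Only the summability of the discrepancies is used from here on; it holds because the exponent
  -- is below -1.
  have hsum : Summable fun k => RandomWalkModOne.psi μ X k :=
    summable_of_isBigO_nat (Real.summable_nat_rpow.2 (by linarith)) hO
  have hψ : ∀ k, ∀ t ∈ Set.Icc (0 : ℝ) 1, |(RandomWalkModOne.pathMeasure ν).real
      {s | Int.fract (RandomWalkModOne.walk k s) ≤ t} - t| ≤ RandomWalkModOne.psi μ X k :=
    fun k t ht => RandomWalkModOne.abs_measureReal_fract_sub_le_psi hY k ht
  have hC : ∀ f g : RandomWalkModOne.meanZeroBV,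
      RandomWalkModOne.C μ X f.1 g.1 = RandomWalkModOne.covForm ν f.1 g.1 := fun f g => by
    simp only [RandomWalkModOne.C, RandomWalkModOne.covForm,
      fun k => (RandomWalkModOne.crossCov_eq_walkCov hY f.2 g.2 k).2,
      fun k => (RandomWalkModOne.crossCov_eq_walkCov hY g.2 f.2 k).2]
  have hs : ∀ f ∈ RandomWalkModOne.meanZeroBV, ∀ g ∈ RandomWalkModOne.meanZeroBV,
      Summable fun k => |RandomWalkModOne.walkCov ν f g (k + 1)| :=
    fun f hf g hg => RandomWalkModOne.summable_abs_walkCov hsum hψ hf hg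
  have hmix : ∀ f : RandomWalkModOne.meanZeroBV, ∃ (K : ℝ) (a : ℕ → ℝ),
      RandomWalkModOne.IsMixing ν f.1 K a (RandomWalkModOne.walkCov ν f.1 f.1) := fun f => by
    obtain ⟨K, hK⟩ := RandomWalkModOne.exists_abs_le_of_mem_meanZeroBV f.2
    exact ⟨_, _, RandomWalkModOne.isMixing_of_mem_meanZeroBV f.2 hsum hψ hK⟩
  have hself : ∀ f : RandomWalkModOne.meanZeroBV, RandomWalkModOne.C μ X f.1 f.1 =
      RandomWalkModOne.asympVar (RandomWalkModOne.walkCov ν f.1 f.1) := fun f => by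
    rw [hC, RandomWalkModOne.covForm_self]
  refine ⟨fun f g => ⟨?_, fun k _ => (RandomWalkModOne.crossCov_eq_walkCov hY f.2 g.2 k).1,
    fun k _ => (RandomWalkModOne.crossCov_eq_walkCov hY g.2 f.2 k).1, ?_, ?_⟩, ?_, ?_, ?_, ?_⟩
  · simpa using RandomWalkModOne.integrable_mul_walkOp (ν := ν) f.2 g.2 0
  · simpa only [fun k => (RandomWalkModOne.crossCov_eq_walkCov hY f.2 g.2 k).2]
      using hs f.1 f.2 g.1 g.2
  · simpa only [fun k => (RandomWalkModOne.crossCov_eq_walkCov hY g.2 f.2 k).2]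
      using hs g.1 g.2 f.1 f.2
  · have hadd : ∀ f f' g : RandomWalkModOne.meanZeroBV,
        RandomWalkModOne.covForm ν (f + f').1 g.1 =
          RandomWalkModOne.covForm ν f.1 g.1 + RandomWalkModOne.covForm ν f'.1 g.1 :=
      fun f f' g => RandomWalkModOne.covForm_add_left f.2 f'.2 g.2 hs
    have hsmul : ∀ (c : ℝ) (f g : RandomWalkModOne.meanZeroBV),
        RandomWalkModOne.covForm ν (c • f).1 g.1 = c • RandomWalkModOne.covForm ν f.1 g.1 :=
      fun c f g => RandomWalkModOne.covForm_smul_left c f.1 g.1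
    refine ⟨LinearMap.mk₂ ℝ (fun f g : RandomWalkModOne.meanZeroBV =>
      RandomWalkModOne.covForm ν f.1 g.1) hadd hsmul (fun f g g' => ?_) (fun c f g => ?_),
      fun f g => (hC f g).symm, ?_, ?_⟩
    · simp only [RandomWalkModOne.covForm_comm f.1]
      exact hadd g g' f
    · simp only [RandomWalkModOne.covForm_comm f.1]
      exact hsmul c g f
    · exact ⟨fun f g => RandomWalkModOne.covForm_comm f.1 g.1⟩
    · refine LinearMap.BilinForm.isPosSemidef_def.2 ⟨⟨fun f g =>
        RandomWalkModOne.covForm_comm f.1 g.1⟩, ⟨fun f => ?_⟩⟩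
      -- Positivity comes from probability: the diagonal value is the limit of second moments of
      -- orbit sums divided by their length.
      obtain ⟨K, a, h⟩ := hmix f
      exact h.asympVar_nonneg.trans_eq (RandomWalkModOne.covForm_self f.1).symm
  · intro f
    rw [hself]
    constructor
    · intro h0
      obtain ⟨K, a, h⟩ := hmix f
      exact RandomWalkModOne.ae_eq_zero_of_periodic f.2.1
        (h.ae_eq_zero_of_asympVar_eq_zero f.2.1 h0)
    · intro h0
      have h1 : f.1 =ᵐ[RandomWalkModOne.unif] 0 := ae_restrict_of_ae h0
      have h2 : ∀ k, RandomWalkModOne.walkCov ν f.1 f.1 k = 0 := fun k => by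
        refine integral_eq_zero_of_ae ?_
        filter_upwards [h1] with u hu
        simp [hu]
      simp [RandomWalkModOne.asympVar, h2]
  · intro f
    obtain ⟨K, a, h⟩ := hmix f
    rw [hself]
    -- The partial sums are the positions of the walk started at 0, and the map to the path space
    -- preserves measure, so the laws agree.
    have hlim := h.tendstoInDistribution fun _ => 0
    have hm : ∀ n : ℕ, Measurable fun s : ℕ → ℝ =>
        RandomWalkModOne.orbitSum f.1 n 0 s / √(n : ℝ) := fun n =>
      (h.measurable_orbitSum_right n 0).div_const _
    simp only [RandomWalkModOne.sum_Icc_partialSum]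
    refine ⟨fun n => ((hm n).comp hY.measurable).aemeasurable, aemeasurable_id,
      hlim.tendsto.congr fun n => Subtype.ext ?_⟩
    dsimp only
    rw [← hY.map_eq, Measure.map_map (hm n) hY.measurable]
    rfl
  · intro f
    obtain ⟨K, a, h⟩ := hmix f
    rw [hself]
    filter_upwards [hY.quasiMeasurePreserving.ae (h.ae_limsup_eq 0)] with ω hω
    simp only [RandomWalkModOne.sum_Icc_partialSum]
    exact hω
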